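/- Let $p$ be an odd prime and let $m,\ell$ be positive integers such that $m_\ell := m/\delta$ is even, where $\delta=\gcd(m,\ell)$, and $m>6\ell$. Put $\varepsilon=(-1)^{m_\ell/2}$, $n=p^m-1$, let $\mathrm{Tr}$ be the trace from $\mathbb F_{p^m}$ to $\mathbb F_p$, and let $\mathcal L=\langle x^{p^\ell},x^{p^{3\ell}}\rangle$ be the $\mathbb F_{p^m}$-linear span of $x^{p^\ell}$ and $x^{p^{3\ell}}$ in $\mathbb F_{p^m}[x]$. Consider the codes $$\mathcal C_{\mathcal L,0}=\{(\mathrm{Tr}(xR(x))+b)_{x\in\mathbb F_{p^m}^*}: R\in\mathcal L,\ b\in\mathbb F_p\},$$ $$\mathcal C_{\mathcal L,2}=\{(\mathrm{Tr}(xR(x)+\beta x)+b)_{x\in\mathbb F_{p^m}^*}: R\in\mathcal L,\ \beta\in\mathbb F_{p^m},\ b\in\mathbb F_p\}$$ over $\mathbb F_p$. Then $\mathcal C_{\mathcal L,0}$ is an $[n,2m+1,d]_p$-code (length, dimension, minimum Hamming distance) with $d=p^{m-1}(p-1)-d'$, where $d'=p^{\frac m2+3\delta-1}+1$ if $\frac12m_\ell$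 is even and $d'=(p-1)p^{\frac m2+3\delta-1}$ if $\frac12 m_\ell$ is odd; and $\mathcal C_{\mathcal L,2}$ is an $[n,3m+1,\hat d]_p$-code with $\hat d=d$ if $\frac12m_\ell$ is even and $\hat d=d-1$ if $\frac12 m_\ell$ is odd. Put $D=p^{6\delta}+p^{5\delta}-p^{4\delta}+p^{2\delta}-p^{\delta}-1$, $\Sigma=\sum_{j=0}^{5}(-1)^{j+1}p^{j\delta}$ and \begin{align*} D F_0&=p^{2m+6\delta}-p^{2m+4\delta}-p^{2m+\delta}+p^{m+4\delta}+p^{m+\delta}-p^{6\delta}+\varepsilon\big(p^{\frac{3m}2+5\delta}-p^{\frac{3m}2+4\delta}-p^{\frac m2+5\delta}+p^{\frac m2+4\delta}\big),\\ D F_1&=p^{2m-2\delta}(p^{7\delta}-p^{2\delta}-1)+p^{m-2\delta}(p^{5\delta}-p^{6\delta}+p^{2\delta}+1)-p^{3\delta}(p^{2\delta}-p^{\delta}+1)-\varepsilon\big(p^{\frac{3m}2}-p^{\frac m2}\big)\Sigma,\\ D F_2&=p^{2m-3\delta}(p^{5\delta}+p^{\delta}-1)-p^{m-3\delta}(p^{6\delta}+p^{4\delta}+p^{\delta}-1)+p^{\delta}(p^{2\delta}-p^{\delta}+1)+\varepsilon\big(p^{\frac{3m}2-2\delta}-p^{\frac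 m2-2\delta}\big)\Sigma,\\ D F_3&=p^{2m-3\delta}-p^{m}-p^{m-3\delta}+1-\varepsilon\big(p^{\frac{3m}2-\delta}-p^{\frac{3m}2-2\delta}-p^{\frac m2-\delta}+p^{\frac m2-2\delta}\big). \end{align*} For $0\le i\le 3$ put $\varepsilon_i=(-1)^i\varepsilon$, $r_i=m-2i\delta$ and $u_i=p^{\frac m2+i\delta-1}$, $v_i=p^{\frac{r_i}2-1}$. The weight distribution of $\mathcal C_{\mathcal L,0}$ is as follows, and no other weight occurs: weight $0$ with frequency $1$; weight $p^m-1$ with frequency $p-1$; and, for $i=0,1,2,3$, weight $p^m-p^{m-1}-\varepsilon_i(p-1)u_i$ with frequency $F_i$ and weight $p^m-p^{m-1}+\varepsilon_iu_i-1$ with frequency $(p-1)F_i$. The weight distribution of $\mathcal C_{\mathcal L,2}$ is as follows, and no other weight occurs: weight $0$ with frequency $1$; weight $p^m-1$ with frequency $p-1$; weight $p^m-p^{m-1}$ with frequency $A:=p^m-1+\sum_{i=0}^3F_i(p^m-p^{r_i})$; weight $p^m-p^{m-1}-1$ with frequency $(p-1)A$; and, for $i=0,1,2,3$, - weight $p^m-p^{m-1}-\varepsilon_i(p-1)u_i$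 with frequency $\big(p^{r_i-1}+\varepsilon_i(p-1)v_i\big)F_i$; - weight $p^m-p^{m-1}+\varepsilon_iu_i$ with frequency $\big(p^{r_i-1}-\varepsilon_iv_i\big)(p-1)F_i$; - weight $p^m-p^{m-1}-1-\varepsilon_i(p-1)u_i$ with frequency $\big(p^{r_i-1}-\varepsilon_iv_i\big)(p-1)F_i$; - weight $p^m-p^{m-1}-1+\varepsilon_iu_i$ with frequency $\big(p^{r_i}-p^{r_i-1}+\varepsilon_iv_i\big)(p-1)F_i$. -/

import Mathlib

open Polynomial

namespace TraceCode

section Coding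

variable {F ι : Type*} [Field F] [DecidableEq F] [Fintype ι]

/-- A linear code `C ⊆ F^ι` is an `[n, k, d]`-code: it has length `n`, dimension `k`, and `d` is the
minimum of the Hamming distances between distinct codewords. -/
structure IsCode (C : Submodule F (ι → F)) (n k d : ℕ) : Prop where
  length_eq : Fintype.card ι = n
  finrank_eq : Module.finrank F C = k
  isLeast_dist : IsLeast {e : ℕ | ∃ c ∈ C, ∃ c' ∈ C, c ≠ c' ∧ hammingDist c c' = e} d

/-- The number of codewords of `C` of Hamming weight `w`. -/
noncomputable def weightFreq (C : Submodule F (ι → F)) (w : ℤ) : ℕ :=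
  {c : ι → F | c ∈ C ∧ (hammingNorm c : ℤ) = w}.ncard

/-- The weight distribution of `C` is given by the table `T`, a list of rows `(weight, frequency)`:
each listed weight occurs with the listed frequency, and no other weight occurs. -/
def HasWeightDistribution (C : Submodule F (ι → F)) (T : List (ℤ × ℚ)) : Prop :=
  (∀ row ∈ T, (weightFreq C row.1 : ℚ) = row.2) ∧
    ∀ c ∈ C, ∃ row ∈ T, (hammingNorm c : ℤ) = row.1

end Coding

section Codes

variable (p : ℕ) [Fact p.Prime] {K : Type*} [Field K] [Algebra (ZMod p) K]

/-- The code `{ (Tr(x R(x)) + b)_{x ∈ Kˣ} : R ∈ L, b ∈ 𝔽_p }`. -/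
def code0 (L : Submodule K K[X]) : Submodule (ZMod p) (Kˣ → ZMod p) where
  carrier := {c | ∃ R ∈ L, ∃ b : ZMod p, c = fun x : Kˣ =>
    Algebra.trace (ZMod p) K ((x : K) * R.eval (x : K)) + b}
  zero_mem' := ⟨0, L.zero_mem, 0, by funext x; simp⟩
  add_mem' := by
    rintro _ _ ⟨R, hR, b, rfl⟩ ⟨S, hS, b', rfl⟩
    refine ⟨R + S, L.add_mem hR hS, b + b', ?_⟩
    funext x
    simp only [Pi.add_apply, eval_add, mul_add, map_add]
    ring
  smul_mem' := by
    rintro a _ ⟨R, hR, b, rfl⟩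
    refine ⟨algebraMap (ZMod p) K a • R, L.smul_mem _ hR, a * b, ?_⟩
    funext x
    have h : (x : K) * (algebraMap (ZMod p) K a • R).eval (x : K)
        = a • ((x : K) * R.eval (x : K)) := by
      rw [eval_smul, smul_eq_mul, Algebra.smul_def]
      ring
    rw [h, map_smul]
    simp only [Pi.smul_apply, smul_eq_mul, mul_add]

/-- The code `{ (Tr(x R(x) + β x) + b)_{x ∈ Kˣ} : R ∈ L, β ∈ K, b ∈ 𝔽_p }`. -/
def code2 (L : Submodule K K[X]) : Submodule (ZMod p) (Kˣ → ZMod p) where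
  carrier := {c | ∃ R ∈ L, ∃ β : K, ∃ b : ZMod p, c = fun x : Kˣ =>
    Algebra.trace (ZMod p) K ((x : K) * R.eval (x : K) + β * (x : K)) + b}
  zero_mem' := ⟨0, L.zero_mem, 0, 0, by funext x; simp⟩
  add_mem' := by
    rintro _ _ ⟨R, hR, β, b, rfl⟩ ⟨S, hS, β', b', rfl⟩
    refine ⟨R + S, L.add_mem hR hS, β + β', b + b', ?_⟩
    funext x
    simp only [Pi.add_apply, eval_add, mul_add, add_mul, map_add]
    ring
  smul_mem' := by
    rintro a _ ⟨R, hR, β, b, rfl⟩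
    refine ⟨algebraMap (ZMod p) K a • R, L.smul_mem _ hR, a • β, a * b, ?_⟩
    funext x
    have h : (x : K) * (algebraMap (ZMod p) K a • R).eval (x : K) + (a • β) * (x : K)
        = a • ((x : K) * R.eval (x : K) + β * (x : K)) := by
      rw [eval_smul, smul_eq_mul, Algebra.smul_def, Algebra.smul_def]
      ring
    rw [h, map_smul]
    simp only [Pi.smul_apply, smul_eq_mul, mul_add]

variable (K)

/-- The `K`-linear span of `x^{p^ℓ}` and `x^{p^{3ℓ}}` in `K[x]`. -/
noncomputable def linFamily (ℓ : ℕ) : Submodule K K[X] :=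
  Submodule.span K {X ^ p ^ ℓ, X ^ p ^ (3 * ℓ)}

end Codes

section Tables

/-! In the formulas below `δ = gcd(m, ℓ)`; they are used only for `m / δ` even and `m > 6ℓ > 0`, so
that `m` is even, `m ≥ 8δ`, and all divisions and subtractions in exponents are exact. -/

/-- The sign `ε_ℓ = (-1)^{m_ℓ / 2}`, where `m_ℓ = m / gcd(m, ℓ)`. -/
def eps (m ℓ : ℕ) : ℤ := (-1) ^ (m / m.gcd ℓ / 2)

/-- The common denominator of the frequencies `F₀, …, F₃`. -/
def freqDen (p : ℚ) (δ : ℕ) : ℚ :=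
  p ^ (6 * δ) + p ^ (5 * δ) - p ^ (4 * δ) + p ^ (2 * δ) - p ^ δ - 1

/-- `∑_{i=0}^{5} (-1)^{i+1} p^{iδ}` -/
def altSum (p : ℚ) (δ : ℕ) : ℚ := ∑ i ∈ Finset.range 6, (-1) ^ (i + 1) * p ^ (i * δ)

/-- `F₀`, with `e` the sign `ε_ℓ`. -/
def freq0 (p : ℚ) (m δ : ℕ) (e : ℚ) : ℚ :=
  (p ^ (2 * m + 6 * δ) - p ^ (2 * m + 4 * δ) - p ^ (2 * m + δ) + p ^ (m + 4 * δ) + p ^ (m + δ)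
      - p ^ (6 * δ)
      + e * (p ^ (3 * m / 2 + 5 * δ) - p ^ (3 * m / 2 + 4 * δ) - p ^ (m / 2 + 5 * δ)
        + p ^ (m / 2 + 4 * δ)))
    / freqDen p δ

/-- `F₁`, with `e` the sign `ε_ℓ`. -/
def freq1 (p : ℚ) (m δ : ℕ) (e : ℚ) : ℚ :=
  (p ^ (2 * m - 2 * δ) * (p ^ (7 * δ) - p ^ (2 * δ) - 1)
      + p ^ (m - 2 * δ) * (p ^ (5 * δ) - p ^ (6 * δ) + p ^ (2 * δ) + 1)
      - p ^ (3 * δ) * (p ^ (2 * δ) - p ^ δ + 1)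
      - e * (p ^ (3 * m / 2) - p ^ (m / 2)) * altSum p δ)
    / freqDen p δ

/-- `F₂`, with `e` the sign `ε_ℓ`. -/
def freq2 (p : ℚ) (m δ : ℕ) (e : ℚ) : ℚ :=
  (p ^ (2 * m - 3 * δ) * (p ^ (5 * δ) + p ^ δ - 1)
      - p ^ (m - 3 * δ) * (p ^ (6 * δ) + p ^ (4 * δ) + p ^ δ - 1)
      + p ^ δ * (p ^ (2 * δ) - p ^ δ + 1)
      + e * (p ^ (3 * m / 2 - 2 * δ) - p ^ (m / 2 - 2 * δ)) * altSum p δ)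
    / freqDen p δ

/-- `F₃`, with `e` the sign `ε_ℓ`. -/
def freq3 (p : ℚ) (m δ : ℕ) (e : ℚ) : ℚ :=
  (p ^ (2 * m - 3 * δ) - p ^ m - p ^ (m - 3 * δ) + 1
      - e * (p ^ (3 * m / 2 - δ) - p ^ (3 * m / 2 - 2 * δ) - p ^ (m / 2 - δ)
        + p ^ (m / 2 - 2 * δ)))
    / freqDen p δ

/-- The frequencies `F₀, F₁, F₂, F₃`. -/
def freq (p m ℓ : ℕ) : Fin 4 → ℚ :=
  ![freq0 p m (m.gcd ℓ) (eps m ℓ), freq1 p m (m.gcd ℓ) (eps m ℓ),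
    freq2 p m (m.gcd ℓ) (eps m ℓ), freq3 p m (m.gcd ℓ) (eps m ℓ)]

/-- The sign `(-1)^i ε_ℓ`. -/
def sgn (m ℓ : ℕ) (i : Fin 4) : ℤ := (-1) ^ (i : ℕ) * eps m ℓ

/-- The weight distribution of `code0` for the family `⟨x^{p^ℓ}, x^{p^{3ℓ}}⟩`: two single rows, and
two rows for each `i = 0, 1, 2, 3`. -/
def table0 (p m ℓ : ℕ) : List (ℤ × ℚ) :=
  [(0, 1), ((p : ℤ) ^ m - 1, (p : ℚ) - 1)] ++
  (List.finRange 4).flatMap fun i =>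
    [((p : ℤ) ^ m - (p : ℤ) ^ (m - 1)
        - sgn m ℓ i * ((p : ℤ) - 1) * (p : ℤ) ^ (m / 2 + i * m.gcd ℓ - 1),
      freq p m ℓ i),
     ((p : ℤ) ^ m - (p : ℤ) ^ (m - 1)
        + sgn m ℓ i * (p : ℤ) ^ (m / 2 + i * m.gcd ℓ - 1) - 1,
      ((p : ℚ) - 1) * freq p m ℓ i)]

/-- The weight distribution of `code2` for the family `⟨x^{p^ℓ}, x^{p^{3ℓ}}⟩`: four single rows, and
four rows for each `i = 0, 1, 2, 3`. -/
def table2 (p m ℓ : ℕ) : List (ℤ × ℚ) :=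
  [(0, 1), ((p : ℤ) ^ m - 1, (p : ℚ) - 1),
   ((p : ℤ) ^ m - (p : ℤ) ^ (m - 1),
     (p : ℚ) ^ m - 1
       + ∑ i : Fin 4, freq p m ℓ i * ((p : ℚ) ^ m - (p : ℚ) ^ (m - 2 * i * m.gcd ℓ))),
   ((p : ℤ) ^ m - (p : ℤ) ^ (m - 1) - 1,
     ((p : ℚ) - 1) * ((p : ℚ) ^ m - 1
       + ∑ i : Fin 4, freq p m ℓ i * ((p : ℚ) ^ m - (p : ℚ) ^ (m - 2 * i * m.gcd ℓ))))] ++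
  (List.finRange 4).flatMap fun i =>
    [((p : ℤ) ^ m - (p : ℤ) ^ (m - 1)
        - sgn m ℓ i * ((p : ℤ) - 1) * (p : ℤ) ^ (m / 2 + i * m.gcd ℓ - 1),
      ((p : ℚ) ^ (m - 2 * i * m.gcd ℓ - 1)
        + sgn m ℓ i * ((p : ℚ) - 1) * (p : ℚ) ^ (m / 2 - i * m.gcd ℓ - 1)) * freq p m ℓ i),
     ((p : ℤ) ^ m - (p : ℤ) ^ (m - 1)
        + sgn m ℓ i * (p : ℤ) ^ (m / 2 + i * m.gcd ℓ - 1),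
      ((p : ℚ) ^ (m - 2 * i * m.gcd ℓ - 1)
        - sgn m ℓ i * (p : ℚ) ^ (m / 2 - i * m.gcd ℓ - 1)) * ((p : ℚ) - 1) * freq p m ℓ i),
     ((p : ℤ) ^ m - (p : ℤ) ^ (m - 1) - 1
        - sgn m ℓ i * ((p : ℤ) - 1) * (p : ℤ) ^ (m / 2 + i * m.gcd ℓ - 1),
      ((p : ℚ) ^ (m - 2 * i * m.gcd ℓ - 1)
        - sgn m ℓ i * (p : ℚ) ^ (m / 2 - i * m.gcd ℓ - 1)) * ((p : ℚ) - 1) * freq p m ℓ i),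
     ((p : ℤ) ^ m - (p : ℤ) ^ (m - 1) - 1
        + sgn m ℓ i * (p : ℤ) ^ (m / 2 + i * m.gcd ℓ - 1),
      ((p : ℚ) ^ (m - 2 * i * m.gcd ℓ) - (p : ℚ) ^ (m - 2 * i * m.gcd ℓ - 1)
        + sgn m ℓ i * (p : ℚ) ^ (m / 2 - i * m.gcd ℓ - 1)) * ((p : ℚ) - 1) * freq p m ℓ i)]

end Tables

end TraceCode

open Polynomial

set_option linter.unusedSectionVars false

/-! Put δ = gcd(m, ℓ), q = p^δ and m = 2nδ, so that |K| = q^(2n) and the bound m > 6ℓ gives n ≥ 4.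
Let σ be x ↦ x^(p^ℓ). Since m/δ is even, ℓ/δ is odd; hence σ² has fixed field 𝔽_{q²} and σ acts
there as the q-power map. This is `IsHermitianFrobenius`, and everything up to the section on the
Frobenius map uses only these properties.

For t in 𝔽_{q²}, replacing x by t x multiplies x(aσ(x) + bσ³(x)) by the norm t^(q+1). Three
consequences follow for the exponential sum S of the quadratic form Q = Tr(x(aσ(x) + bσ³(x))). Every
nonzero scalar of 𝔽_p is a norm, so all nonzero levels of Q have the same size and S is an integer.
As -1 is a norm, S equals its conjugate sum and S² = |K| |Rad Q| (`charSum_sq`). The q+1 elements of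
norm one act freely on the nonzero vectors of each level, so S ≡ 1 mod q+1 (`dvd_charSum_sub_one`).
The radical is an 𝔽_{q²}-space, and for (a, b) ≠ 0 it is the kernel of a nonzero σ²-polynomial of
degree at most 3. So |Rad Q| = q^(2i) with i ≤ 3, and the congruence fixes the sign: S = (-q)^(n+i)
(`charSum_of_radCard`).

The number of pairs (a, b) with each value of S comes from the moments of order 0 to 3. By
orthogonality, the k-th moment counts the common zeros of Σ xσ(x) and Σ xσ³(x) in k variables. For k
= 3 these zeros are the K-multiples of the q³+1 points of the Hermitian curve over 𝔽_{q²}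
(`card_triples`). The four equations form a Vandermonde system in the nodes 1, -q, q², -q³, whose
solution is F₀, …, F₃ (`moment_solution`, `rankCount_eq_freq`).

Adding Tr(βx) + c does one of two things. If β is in the image of the polar map, completing the
square turns the zero set into a level set of Q. Otherwise the word is equidistributed. So p·(number
of zeros) - |K| is (p-1)S, -S or 0, and this is divisible by p². The weight therefore also reveals
whether c = 0, which matters because x = 0 is omitted (`hammingNorm_eq_iff_of_dvd`). Counting the β
of each type gives both tables. The minimum distances come from the words with i = 3, which occur
because F₃ > 0. -/

namespace TraceCode

/-! ### Kernels of linearized polynomials in a field endomorphism -/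

section TauPolynomials

variable {K : Type*} [Field K] [Fintype K] [DecidableEq K]

/-- If `f = g ∘ (τ - 1)` then the kernel of `f` is at most `|Fix τ|` times as large as that of `g`. -/
lemma card_ker_comp_sub_le (τ : K →+* K) (f g : K → K) (h : ∀ y, f y = g (τ y - y)) :
    (Finset.univ.filter fun y => f y = 0).card ≤
      (Finset.univ.filter fun y => τ y = y).card * (Finset.univ.filter fun y => g y = 0).card := by
  refine Finset.card_le_mul_card_image_of_maps_to (f := fun y => τ y - y) ?_ _ ?_
  · intro y hy
    simpa [h] using hy
  · intro z _
    by_cases hne : ((Finset.univ.filter fun y => f y = 0).filter fun y => τ y - y = z).Nonempty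
    · obtain ⟨y₀, hy₀⟩ := hne
      -- A nonempty fibre of `y ↦ τ y - y` is contained in a translate of the fixed points of `τ`.
      refine Finset.card_le_card_of_injOn (fun y => y - y₀) ?_ ?_
      · intro y hy
        simp only [Finset.coe_filter, Set.mem_ofPred_eq, Finset.mem_filter, Finset.mem_univ,
          true_and] at hy hy₀ ⊢
        rw [map_sub]
        linear_combination hy.2 - hy₀.2
      · intro y _ y' _ hyy
        simpa using hyy
    · rw [Finset.not_nonempty_iff_eq_empty.1 hne]
      simp

/-- Rescaling the variable by a nonzero element does not change the number of zeros. -/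
lemma card_ker_rescale (f : K → K) {v : K} (hv : v ≠ 0) :
    (Finset.univ.filter fun y => f y = 0).card = (Finset.univ.filter fun y => f (v * y) = 0).card := by
  symm
  refine Finset.card_bij' (fun y _ => v * y) (fun y _ => v⁻¹ * y) ?_ ?_ ?_ ?_
  · intro y hy; simpa using hy
  · intro y hy; simpa [mul_inv_cancel_left₀ hv] using hy
  · intro y _; simp [inv_mul_cancel_left₀ hv]
  · intro y _; simp [mul_inv_cancel_left₀ hv]

lemma one_le_card_fix (τ : K →+* K) : 1 ≤ (Finset.univ.filter fun y => τ y = y).card :=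
  Finset.card_pos.2 ⟨0, by simp⟩

/-- Either `f` has no nonzero zero, or it may be rescaled so that `1` is a zero. -/
lemma card_ker_le_one_or (f : K → K) :
    (Finset.univ.filter fun y => f y = 0).card ≤ 1 ∨ ∃ v, v ≠ 0 ∧ f v = 0 := by
  by_cases h : ∃ v, v ≠ 0 ∧ f v = 0
  · exact Or.inr h
  · left
    push Not at h
    refine Finset.card_le_one.2 fun a ha b hb => ?_
    simp only [Finset.mem_filter, Finset.mem_univ, true_and] at ha hb
    have h1 : a = 0 := by by_contra h'; exact h a h' ha
    have h2 : b = 0 := by by_contra h'; exact h b h' hb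
    rw [h1, h2]

/-- This starts the induction on degree. Rescaling by a nonzero zero `v` makes `1` a zero, so the
polynomial is divisible on the right by `τ - 1`. The coefficients of the quotient, one degree lower,
are the tail sums of the rescaled coefficients. Degrees two and three use the same division. -/
lemma card_ker_deg_one_le (τ : K →+* K) (c₀ c₁ : K) (hc : ¬ (c₀ = 0 ∧ c₁ = 0)) :
    (Finset.univ.filter fun y => c₀ * y + c₁ * τ y = 0).card ≤
      (Finset.univ.filter fun y => τ y = y).card := by
  rcases card_ker_le_one_or fun y => c₀ * y + c₁ * τ y with h | ⟨v, hv, h⟩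
  · exact h.trans (one_le_card_fix τ)
  · rw [card_ker_rescale (fun y => c₀ * y + c₁ * τ y) hv]
    refine (card_ker_comp_sub_le τ _ (fun y => c₁ * τ v * y) ?_).trans ?_
    · intro y
      simp only [map_mul]
      linear_combination y * h
    · have hτv : τ v ≠ 0 := by simpa using hv
      have hc₁ : c₁ ≠ 0 := by
        rintro rfl
        refine hc ⟨?_, rfl⟩
        simpa [hv] using h
      simp [hτv, hc₁, Finset.filter_eq']

lemma card_ker_deg_two_le (τ : K →+* K) (c₀ c₁ c₂ : K) (hc : ¬ (c₀ = 0 ∧ c₁ = 0 ∧ c₂ = 0)) :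
    (Finset.univ.filter fun y => c₀ * y + c₁ * τ y + c₂ * τ (τ y) = 0).card ≤
      (Finset.univ.filter fun y => τ y = y).card ^ 2 := by
  rcases card_ker_le_one_or fun y => c₀ * y + c₁ * τ y + c₂ * τ (τ y) with h | ⟨v, hv, h⟩
  · exact h.trans (Nat.one_le_pow _ _ (one_le_card_fix τ))
  · rw [card_ker_rescale (fun y => c₀ * y + c₁ * τ y + c₂ * τ (τ y)) hv]
    have h1 : τ v ≠ 0 := by simpa using hv
    have h2 : τ (τ v) ≠ 0 := by simpa using hv
    refine (card_ker_comp_sub_le τ _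
      (fun y => (c₁ * τ v + c₂ * τ (τ v)) * y + (c₂ * τ (τ v)) * τ y) ?_).trans ?_
    · intro y
      simp only [map_mul, map_sub]
      linear_combination y * h
    · rw [pow_two]
      refine Nat.mul_le_mul_left _ (card_ker_deg_one_le τ _ _ ?_)
      rintro ⟨ha, hb⟩
      have hc2 : c₂ = 0 := by simpa [h2] using hb
      have hc1 : c₁ = 0 := by simpa [h1, hc2] using ha
      refine hc ⟨?_, hc1, hc2⟩
      simpa [hc1, hc2, hv] using h

/-- A nonzero `τ`-polynomial of degree at most three has at most `|Fix τ| ^ 3` zeros. -/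
lemma card_ker_deg_three_le (τ : K →+* K) (c₀ c₁ c₂ c₃ : K)
    (hc : ¬ (c₀ = 0 ∧ c₁ = 0 ∧ c₂ = 0 ∧ c₃ = 0)) :
    (Finset.univ.filter fun y =>
        c₀ * y + c₁ * τ y + c₂ * τ (τ y) + c₃ * τ (τ (τ y)) = 0).card ≤
      (Finset.univ.filter fun y => τ y = y).card ^ 3 := by
  rcases card_ker_le_one_or fun y =>
    c₀ * y + c₁ * τ y + c₂ * τ (τ y) + c₃ * τ (τ (τ y)) with h | ⟨v, hv, h⟩
  · exact h.trans (Nat.one_le_pow _ _ (one_le_card_fix τ))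
  · rw [card_ker_rescale (fun y => c₀ * y + c₁ * τ y + c₂ * τ (τ y) + c₃ * τ (τ (τ y))) hv]
    have h1 : τ v ≠ 0 := by simpa using hv
    have h2 : τ (τ v) ≠ 0 := by simpa using hv
    have h3 : τ (τ (τ v)) ≠ 0 := by simpa using hv
    refine (card_ker_comp_sub_le τ _
      (fun y => (c₁ * τ v + c₂ * τ (τ v) + c₃ * τ (τ (τ v))) * y
        + (c₂ * τ (τ v) + c₃ * τ (τ (τ v))) * τ y + (c₃ * τ (τ (τ v))) * τ (τ y)) ?_).trans ?_
    · intro y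
      simp only [map_mul, map_sub]
      linear_combination y * h
    · rw [pow_succ', pow_two, ← pow_two]
      refine Nat.mul_le_mul_left _ (card_ker_deg_two_le τ _ _ _ ?_)
      rintro ⟨ha, hb, hd⟩
      have hc3 : c₃ = 0 := by simpa [h3] using hd
      have hc2 : c₂ = 0 := by simpa [h2, hc3] using hb
      have hc1 : c₁ = 0 := by simpa [h1, hc2, hc3] using ha
      refine hc ⟨?_, hc1, hc2, hc3⟩
      simpa [hc1, hc2, hc3, hv] using h

end TauPolynomials

/-! ### Roots of unity and power residues in a finite field -/

section Norms

variable {K : Type*} [Field K] [Fintype K] [DecidableEq K]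

/-- If `d * e` divides `|K| - 1` and `c ^ e = 1`, then `c` is a `d`-th power. -/
lemma exists_pow_eq_of_pow_eq_one {d e : ℕ} (he : 0 < e)
    (hde : d * e ∣ Fintype.card K - 1) {c : K} (hc : c ^ e = 1) : ∃ t : K, t ^ d = c := by
  have hc0 : c ≠ 0 := by
    rintro rfl
    rw [zero_pow he.ne'] at hc
    exact zero_ne_one hc
  obtain ⟨g, hg⟩ := IsCyclic.exists_generator (α := Kˣ)
  obtain ⟨j, hj⟩ := (mem_powers_iff_mem_zpowers.2 (hg (Units.mk0 c hc0)))
  have hord : orderOf g = Fintype.card K - 1 := by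
    rw [orderOf_eq_card_of_forall_mem_zpowers hg, Nat.card_eq_fintype_card, Fintype.card_units]
  have h1 : g ^ (j * e) = 1 := by
    have hj' : g ^ j = Units.mk0 c hc0 := hj
    rw [pow_mul, hj']
    ext
    simpa using hc
  rw [← orderOf_dvd_iff_pow_eq_one, hord] at h1
  have h2 : d ∣ j := Nat.dvd_of_mul_dvd_mul_right he (hde.trans h1)
  obtain ⟨k, rfl⟩ := h2
  refine ⟨((g ^ k : Kˣ) : K), ?_⟩
  rw [← Units.val_pow_eq_pow_val, ← pow_mul, mul_comm k d]
  have hj' : g ^ (d * k) = Units.mk0 c hc0 := hj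
  rw [hj']
  rfl

/-- The number of `d`-th roots of unity in `K` is `d` when `d` divides `|K| - 1`. -/
lemma card_pow_eq_one {d : ℕ} (hd : 0 < d) (hdvd : d ∣ Fintype.card K - 1) :
    (Finset.univ.filter fun t : K => t ^ d = 1).card = d := by
  obtain ⟨g, hg⟩ := IsCyclic.exists_ofOrder_eq_natCard (α := Kˣ)
  obtain ⟨k, hk⟩ := hdvd
  have hK : 0 < Fintype.card K - 1 := by
    have := Fintype.one_lt_card (α := K); omega
  have hk0 : k ≠ 0 := by rintro rfl; simp at hk; omega
  have hprim : IsPrimitiveRoot ((g ^ k : Kˣ) : K) d := by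
    rw [IsPrimitiveRoot.coe_units_iff]
    have := IsPrimitiveRoot.orderOf g
    rw [hg, Nat.card_eq_fintype_card, Fintype.card_units] at this
    exact this.pow hK (by rw [hk, mul_comm])
  refine Eq.trans ?_ hprim.card_nthRootsFinset
  congr 1
  ext t
  simp [mem_nthRootsFinset hd]

/-- If `d * e` divides `|K| - 1` and `c ^ e = 1`, then `c` has exactly `d` roots of order `d`. -/
lemma card_pow_eq {d e : ℕ} (hd : 0 < d) (he : 0 < e)
    (hde : d * e ∣ Fintype.card K - 1) {c : K} (hc : c ^ e = 1) :
    (Finset.univ.filter fun t : K => t ^ d = c).card = d := by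
  obtain ⟨t₀, ht₀⟩ := exists_pow_eq_of_pow_eq_one he hde hc
  have hc0 : c ≠ 0 := by
    rintro rfl
    rw [zero_pow he.ne'] at hc
    exact zero_ne_one hc
  have ht0 : t₀ ≠ 0 := by
    rintro rfl
    exact hc0 (by rw [← ht₀, zero_pow hd.ne'])
  refine Eq.trans ?_ (card_pow_eq_one (K := K) hd ((Dvd.intro _ rfl).trans hde))
  refine Finset.card_bij' (fun t _ => t / t₀) (fun t _ => t * t₀) ?_ ?_ ?_ ?_
  · intro t ht
    simp only [Finset.mem_filter, Finset.mem_univ, true_and] at ht ⊢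
    rw [div_pow, ht, ht₀, div_self hc0]
  · intro t ht
    simp only [Finset.mem_filter, Finset.mem_univ, true_and] at ht ⊢
    rw [mul_pow, ht, ht₀, one_mul]
  · intro t _; simp [ht0]
  · intro t _; simp [ht0]

end Norms

/-- `σ` is an automorphism of `K` whose square has fixed field `𝔽_{q²}`, and which acts on that field
as the `q`-power map. -/
structure IsHermitianFrobenius {F K : Type*} [Field F] [Field K] [Fintype K] [Algebra F K]
    (σ : K ≃ₐ[F] K) (q : ℕ) : Prop where
  fix_iff : ∀ x, σ (σ x) = x ↔ x ^ (q ^ 2) = x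
  apply_of_fix : ∀ x, x ^ (q ^ 2) = x → σ x = x ^ q
  dvd : (q + 1) * (q - 1) ∣ Fintype.card K - 1
  two_lt : 2 < q

/-! ### Norms from 𝔽_{q²} and points on the Hermitian curve -/

section NormCounts

variable {F K : Type*} [Field F] [Field K] [Fintype K] [DecidableEq K] [Algebra F K]
  {σ : K ≃ₐ[F] K} {q : ℕ}

lemma sq_eq_of_pos (hq : 0 < q) : q ^ 2 = (q + 1) * (q - 1) + 1 := by
  obtain ⟨k, rfl⟩ : ∃ k, q = k + 1 := ⟨q - 1, by omega⟩
  simp only [Nat.add_sub_cancel]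
  ring

namespace IsHermitianFrobenius

lemma pow_eq_one (h : IsHermitianFrobenius σ q) {c : K} (hc0 : c ≠ 0) (hc : σ c = c) :
    c ^ (q - 1) = 1 := by
  have hq := h.two_lt
  have h1 : c ^ (q ^ 2) = c := (h.fix_iff c).1 (by rw [hc, hc])
  have h3 := h.apply_of_fix c h1
  rw [hc] at h3
  have h4 : c ^ q = c ^ (q - 1) * c := by rw [← pow_succ]; congr 1; omega
  rw [h4] at h3
  exact mul_right_cancel₀ hc0 (by rw [one_mul]; exact h3.symm)

/-- The right side does not mention the fixed field because membership is automatic: `c ^ (q - 1) =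
1` turns `t ^ (q + 1) = c` into `t ^ (q ^ 2) = t`. -/
lemma norm_iff (h : IsHermitianFrobenius σ q) {c : K} (hc0 : c ≠ 0) (hc : σ c = c) (t : K) :
    (t * σ t = c ∧ σ (σ t) = t) ↔ t ^ (q + 1) = c := by
  have hq := h.two_lt
  have h2 := h.pow_eq_one hc0 hc
  constructor
  · rintro ⟨ht, htf⟩
    rw [← ht, h.apply_of_fix t ((h.fix_iff t).1 htf), pow_succ']
  · intro ht
    have h5 : t ^ (q ^ 2) = t := by
      rw [sq_eq_of_pos (by omega), pow_succ, pow_mul, ht, h2, one_mul]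
    refine ⟨?_, (h.fix_iff t).2 h5⟩
    rw [h.apply_of_fix t h5, ← pow_succ', ht]

/-- The norm `t ↦ t * σ t` of the fixed field of `σ²` has fibres of size `q + 1`. -/
lemma card_norm (h : IsHermitianFrobenius σ q) {c : K} (hc0 : c ≠ 0) (hc : σ c = c) :
    (Finset.univ.filter fun t : K => t * σ t = c ∧ σ (σ t) = t).card = q + 1 := by
  have hq := h.two_lt
  simp only [h.norm_iff hc0 hc]
  exact card_pow_eq (by omega) (e := q - 1) (by omega) h.dvd (h.pow_eq_one hc0 hc)

lemma exists_norm (h : IsHermitianFrobenius σ q) {c : K} (hc0 : c ≠ 0) (hc : σ c = c) :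
    ∃ t : K, t * σ t = c ∧ σ (σ t) = t := by
  have h1 := h.card_norm hc0 hc
  have h2 : (Finset.univ.filter fun t : K => t * σ t = c ∧ σ (σ t) = t).Nonempty := by
    rw [← Finset.card_pos, h1]; omega
  obtain ⟨t, ht⟩ := h2
  exact ⟨t, by simpa using ht⟩

lemma card_fix (h : IsHermitianFrobenius σ q) :
    (Finset.univ.filter fun t : K => σ (σ t) = t).card = q ^ 2 := by
  have hq := h.two_lt
  have hpos : 0 < (q + 1) * (q - 1) := Nat.mul_pos (by omega) (by omega)
  have h1 : (Finset.univ.filter fun t : K => σ (σ t) = t) =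
      insert 0 (Finset.univ.filter fun t : K => t ^ ((q + 1) * (q - 1)) = 1) := by
    ext t
    simp only [Finset.mem_filter, Finset.mem_univ, true_and, Finset.mem_insert, h.fix_iff]
    rw [sq_eq_of_pos (by omega), pow_succ]
    constructor
    · intro ht
      by_cases ht0 : t = 0
      · exact Or.inl ht0
      · exact Or.inr (mul_right_cancel₀ ht0 (by rw [ht, one_mul]))
    · rintro (rfl | ht)
      · simp
      · rw [ht, one_mul]
  rw [h1, Finset.card_insert_of_notMem, card_pow_eq_one hpos h.dvd, sq_eq_of_pos (by omega)]
  simp [zero_pow (Nat.ne_of_gt hpos)]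

/-- The number of zeros `(x, y)` of the two forms `x σx + y σy` and `x σ³x + y σ³y` with `y`
fixed. -/
lemma card_pair_fiber (h : IsHermitianFrobenius σ q) (y : K) :
    (Finset.univ.filter fun x : K => x * σ x + y * σ y = 0 ∧
      x * σ (σ (σ x)) + y * σ (σ (σ y)) = 0).card = if y = 0 then 1 else q + 1 := by
  split_ifs with hy
  · subst hy
    rw [Finset.card_eq_one]
    refine ⟨0, ?_⟩
    ext x
    simp +contextual
  · rw [← h.card_norm (c := -1) (neg_ne_zero.2 one_ne_zero) (by simp)]
    have hy1 : σ y ≠ 0 := by simpa using hy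
    have hy3 : σ (σ (σ y)) ≠ 0 := by simpa using hy
    refine Finset.card_bij' (fun x _ => x / y) (fun t _ => t * y) ?_ ?_ ?_ ?_
    · intro x hx
      simp only [Finset.mem_filter, Finset.mem_univ, true_and] at hx ⊢
      obtain ⟨ha, hb⟩ := hx
      have hx0 : x ≠ 0 := by
        rintro rfl
        simp [hy] at ha
      have hn : x / y * σ (x / y) = -1 := by
        rw [map_div₀]
        field_simp
        linear_combination ha
      refine ⟨hn, ?_⟩
      have hn3 : x / y * σ (σ (σ (x / y))) = -1 := by
        rw [map_div₀, map_div₀, map_div₀]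
        field_simp
        linear_combination hb
      have hxy : x / y ≠ 0 := div_ne_zero hx0 hy
      -- The two forms give `t * σ³ t = t * σ t` for `t = x / y`, hence `σ² t = t`: the second
      -- equation only forces `t` into 𝔽_{q²}.
      exact σ.injective (mul_left_cancel₀ hxy (hn3.trans hn.symm))
    · intro t ht
      simp only [Finset.mem_filter, Finset.mem_univ, true_and] at ht ⊢
      obtain ⟨ha, hb⟩ := ht
      simp only [map_mul, hb]
      constructor
      · linear_combination y * σ y * ha
      · linear_combination y * σ (σ (σ y)) * ha
    · intro x _; simp [hy]
    · intro x _; simp [hy]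

lemma sum_ite_zero (a b : ℕ) :
    ∑ y : K, (if y = 0 then a else b) = a + (Fintype.card K - 1) * b := by
  rw [← Finset.add_sum_erase _ _ (Finset.mem_univ (0 : K))]
  simp only [if_true]
  congr 1
  rw [Finset.sum_congr rfl (g := fun _ => b)]
  · simp [Finset.card_erase_of_mem, Finset.card_univ]
  · intro y hy
    rw [if_neg (Finset.ne_of_mem_erase hy)]

lemma card_pairs (h : IsHermitianFrobenius σ q) :
    (Finset.univ.filter fun v : K × K => v.2 * σ v.2 + v.1 * σ v.1 = 0 ∧
      v.2 * σ (σ (σ v.2)) + v.1 * σ (σ (σ v.1)) = 0).card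
        = 1 + (Fintype.card K - 1) * (q + 1) := by
  rw [Finset.card_filter, Fintype.sum_prod_type]
  simp only [← Finset.card_filter, h.card_pair_fiber]
  exact sum_ite_zero _ _

/-- The number of affine points over `𝔽_{q²}` of the Hermitian curve. -/
lemma card_hermitian_points (h : IsHermitianFrobenius σ q) :
    (Finset.univ.filter fun v : K × K => v.2 * σ v.2 = -1 - v.1 * σ v.1 ∧ σ (σ v.2) = v.2 ∧
      σ (σ v.1) = v.1).card = (q + 1) * (q ^ 2 - q) := by
  have hq := h.two_lt
  rw [Finset.card_filter, Fintype.sum_prod_type]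
  -- Over `s` of norm `-1` only `t = 0` remains; over the other `q² - q - 1` elements of 𝔽_{q²}
  -- there are `q + 1` values of `t`.
  have key : ∀ s : K, (∑ t : K, if (t * σ t = -1 - s * σ s ∧ σ (σ t) = t ∧ σ (σ s) = s) then 1 else 0)
      = if σ (σ s) = s then (if s * σ s = -1 then 1 else (q + 1)) else 0 := by
    intro s
    rw [← Finset.card_filter]
    split_ifs with h1 h2
    · rw [Finset.card_eq_one]
      refine ⟨0, ?_⟩
      ext t
      simp +contextual [h1, h2]
    · rw [← h.card_norm (c := -1 - s * σ s)]
      · simp [h1]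
      · intro h3; exact h2 (by linear_combination -h3)
      · simp only [map_sub, map_neg, map_one, map_mul, h1]; ring
    · simp [h1]
  simp only [key]
  rw [← Finset.sum_filter, Finset.sum_ite, Finset.filter_filter, Finset.filter_filter]
  have e1 : (Finset.univ.filter fun s : K => σ (σ s) = s ∧ s * σ s = -1).card = q + 1 := by
    rw [← h.card_norm (c := -1) (neg_ne_zero.2 one_ne_zero) (by simp)]
    simp only [and_comm]
  have e2 : (Finset.univ.filter fun s : K => σ (σ s) = s ∧ s * σ s = -1).card
      + (Finset.univ.filter fun s : K => σ (σ s) = s ∧ ¬ s * σ s = -1).card = q ^ 2 := by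
    rw [← h.card_fix, ← Finset.filter_filter, ← Finset.filter_filter,
      Finset.card_filter_add_card_filter_not]
  rw [e1] at e2
  have e3 : (Finset.univ.filter fun s : K => σ (σ s) = s ∧ ¬ s * σ s = -1).card = q ^ 2 - q - 1 := by
    omega
  simp only [Finset.sum_const, e1, e3, smul_eq_mul, mul_one]
  obtain ⟨k, hk⟩ : ∃ k, q ^ 2 - q = k + 1 := ⟨q ^ 2 - q - 1, by
    have : q + 1 ≤ q ^ 2 := by nlinarith
    omega⟩
  rw [hk, Nat.add_sub_cancel]
  ring

/-- A common zero `(s, t, 1)` of the two ternary forms has coordinates in the fixed field of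
`σ²`. -/
lemma fix_of_affine_zero {s t : K} (h1 : s * σ s + t * σ t + 1 = 0)
    (h3 : s * σ (σ (σ s)) + t * σ (σ (σ t)) + 1 = 0) : σ (σ s) = s ∧ σ (σ t) = t := by
  have h2 : σ s * σ (σ s) + σ t * σ (σ t) + 1 = 0 := by
    simpa using congrArg σ h1
  have h4 : σ (σ s) * σ (σ (σ s)) + σ (σ t) * σ (σ (σ t)) + 1 = 0 := by
    simpa using congrArg σ h2
  have e1 : σ s * (s - σ (σ s)) + σ t * (t - σ (σ t)) = 0 := by linear_combination h1 - h2
  have e2 : σ (σ (σ s)) * (s - σ (σ s)) + σ (σ (σ t)) * (t - σ (σ t)) = 0 := by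
    linear_combination h3 - h4
  -- `e1` and `e2` form a homogeneous linear system in `s - σ² s` and `t - σ² t`. If it is singular,
  -- its determinant is `σ` of `s σ² t - t σ² s`, so `(s, t)` and `(σ² s, σ² t)` are proportional,
  -- and `h1`, `h2` normalize the factor to one.
  by_cases hdet : σ s * σ (σ (σ t)) - σ t * σ (σ (σ s)) = 0
  · have hd : s * σ (σ t) - t * σ (σ s) = 0 := by
      apply σ.injective
      simpa using hdet
    constructor
    · linear_combination (-s) * h2 + σ (σ s) * h1 + σ t * hd
    · linear_combination (-t) * h2 + σ (σ t) * h1 - σ s * hd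
  · constructor
    · have : (σ s * σ (σ (σ t)) - σ t * σ (σ (σ s))) * (s - σ (σ s)) = 0 := by
        linear_combination σ (σ (σ t)) * e1 - σ t * e2
      have := (mul_eq_zero.1 this).resolve_left hdet
      exact (sub_eq_zero.1 this).symm
    · have : (σ s * σ (σ (σ t)) - σ t * σ (σ (σ s))) * (t - σ (σ t)) = 0 := by
        linear_combination σ s * e2 - σ (σ (σ s)) * e1
      have := (mul_eq_zero.1 this).resolve_left hdet
      exact (sub_eq_zero.1 this).symm

lemma card_triple_fiber (h : IsHermitianFrobenius σ q) {z : K} (hz : z ≠ 0) :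
    (Finset.univ.filter fun v : K × K => v.2 * σ v.2 + v.1 * σ v.1 + z * σ z = 0 ∧
      v.2 * σ (σ (σ v.2)) + v.1 * σ (σ (σ v.1)) + z * σ (σ (σ z)) = 0).card
        = (q + 1) * (q ^ 2 - q) := by
  rw [← h.card_hermitian_points]
  have hz1 : σ z ≠ 0 := by simpa using hz
  have hz3 : σ (σ (σ z)) ≠ 0 := by simpa using hz
  refine Finset.card_bij' (fun v _ => (v.1 / z, v.2 / z)) (fun v _ => (v.1 * z, v.2 * z)) ?_ ?_ ?_ ?_
  · rintro ⟨y, x⟩ hv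
    simp only [Finset.mem_filter, Finset.mem_univ, true_and] at hv ⊢
    obtain ⟨ha, hb⟩ := hv
    have hn : x / z * σ (x / z) + y / z * σ (y / z) + 1 = 0 := by
      rw [map_div₀, map_div₀]
      field_simp
      linear_combination ha
    have hn3 : x / z * σ (σ (σ (x / z))) + y / z * σ (σ (σ (y / z))) + 1 = 0 := by
      simp only [map_div₀]
      field_simp
      linear_combination hb
    exact ⟨by linear_combination hn, fix_of_affine_zero hn hn3⟩
  · rintro ⟨t, s⟩ hv
    simp only [Finset.mem_filter, Finset.mem_univ, true_and] at hv ⊢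
    obtain ⟨ha, hb, hc⟩ := hv
    simp only [map_mul, hb, hc]
    constructor
    · linear_combination z * σ z * ha
    · linear_combination z * σ (σ (σ z)) * ha
  · intro x _; simp [hz]
  · intro x _; simp [hz]

/-- Slicing by `z`: the slice `z = 0` is the two-variable count, and every other slice scales to the
affine Hermitian curve. The total per nonzero scalar is `(q + 1) + (q³ - q) = q³ + 1`. -/
lemma card_triples (h : IsHermitianFrobenius σ q) :
    (Finset.univ.filter fun v : K × K × K =>
      v.2.2 * σ v.2.2 + v.2.1 * σ v.2.1 + v.1 * σ v.1 = 0 ∧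
      v.2.2 * σ (σ (σ v.2.2)) + v.2.1 * σ (σ (σ v.2.1)) + v.1 * σ (σ (σ v.1)) = 0).card
        = 1 + (Fintype.card K - 1) * (q ^ 3 + 1) := by
  have hq := h.two_lt
  rw [Finset.card_filter, Fintype.sum_prod_type]
  simp only [← Finset.card_filter]
  have key : ∀ z : K, (Finset.univ.filter fun v : K × K =>
      v.2 * σ v.2 + v.1 * σ v.1 + z * σ z = 0 ∧
      v.2 * σ (σ (σ v.2)) + v.1 * σ (σ (σ v.1)) + z * σ (σ (σ z)) = 0).card
      = if z = 0 then 1 + (Fintype.card K - 1) * (q + 1) else (q + 1) * (q ^ 2 - q) := by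
    intro z
    split_ifs with hz
    · subst hz
      rw [← h.card_pairs]
      simp
    · exact h.card_triple_fiber hz
  simp only [key]
  rw [sum_ite_zero, add_assoc, ← mul_add]
  congr 2
  have hle : q ≤ q ^ 2 := by nlinarith
  zify [hle]
  ring

end IsHermitianFrobenius

end NormCounts

/-! ### The quadratic forms, their exponential sums and the moments -/

section Forms

variable {p : ℕ} [Fact p.Prime] {K : Type*} [Field K] [Fintype K] [DecidableEq K]
  [Algebra (ZMod p) K]

/-- The form `x ↦ x (a σ(x) + b σ³(x))`. -/
def form (σ : K ≃ₐ[ZMod p] K) (a b x : K) : K := x * (a * σ x + b * σ (σ (σ x)))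

/-- The quadratic form `x ↦ Tr (x (a σ(x) + b σ³(x)))` over `𝔽_p`. -/
noncomputable def qform (σ : K ≃ₐ[ZMod p] K) (a b x : K) : ZMod p :=
  Algebra.trace (ZMod p) K (form σ a b x)

/-- The self-adjoint linear map representing the polarization of `qform` with respect to the trace
form. -/
def polar (σ : K ≃ₐ[ZMod p] K) (a b : K) : K →ₗ[ZMod p] K where
  toFun z := a * σ z + σ.symm (a * z) + b * σ (σ (σ z)) + σ.symm (σ.symm (σ.symm (b * z)))
  map_add' x y := by simp only [map_add, mul_add]; ring
  map_smul' c x := by simp only [map_smul, mul_smul_comm, RingHom.id_apply, smul_add]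

lemma polar_apply (σ : K ≃ₐ[ZMod p] K) (a b z : K) : polar σ a b z =
    a * σ z + σ.symm (a * z) + b * σ (σ (σ z)) + σ.symm (σ.symm (σ.symm (b * z))) := rfl

/-- The trace is σ-invariant, so the adjoint of `σ⁻¹` for the trace form is `σ`. This is what gives
`polar` its shape. -/
lemma trace_mul_symm (σ : K ≃ₐ[ZMod p] K) (x y : K) :
    Algebra.trace (ZMod p) K (x * σ.symm y) = Algebra.trace (ZMod p) K (σ x * y) := by
  rw [← Algebra.trace_eq_of_algEquiv σ, map_mul, AlgEquiv.apply_symm_apply]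

variable (σ : K ≃ₐ[ZMod p] K) (a b : K)

lemma qform_zero : qform σ a b 0 = 0 := by simp [qform, form]

lemma qform_add (x y : K) : qform σ a b (x + y) =
    qform σ a b x + qform σ a b y + Algebra.trace (ZMod p) K (x * polar σ a b y) := by
  simp only [qform, form, polar_apply, mul_add, map_add, add_mul, trace_mul_symm]
  rw [show y * (a * σ x) = σ x * (a * y) by ring,
    show y * (b * σ (σ (σ x))) = σ (σ (σ x)) * (b * y) by ring]
  ring

lemma trace_mul_polar (x y : K) : Algebra.trace (ZMod p) K (x * polar σ a b y) =
    Algebra.trace (ZMod p) K (y * polar σ a b x) := by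
  have h1 := qform_add σ a b x y
  have h2 := qform_add σ a b y x
  rw [add_comm y x] at h2
  linear_combination h2 - h1

/-- For `z` in the radical, `Q(2z)` is both `4 Q(z)` and `2 Q(z)`, and 2 is invertible. -/
lemma qform_eq_zero_of_polar (hp : p ≠ 2) {z : K} (hz : polar σ a b z = 0) :
    qform σ a b z = 0 := by
  have h1 := qform_add σ a b z z
  have h2 : qform σ a b (z + z) = 4 * qform σ a b z := by
    have : form σ a b (z + z) = (4 : ZMod p) • form σ a b z := by
      simp only [form, map_add, Algebra.smul_def, map_ofNat]; ring
    rw [qform, this, map_smul, smul_eq_mul, qform]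
  rw [hz, mul_zero, map_zero, h2] at h1
  have h3 : (2 : ZMod p) * qform σ a b z = 0 := by linear_combination h1
  refine (mul_eq_zero.1 h3).resolve_left ?_
  have : Fact (2 < p) := ⟨lt_of_le_of_ne (Fact.out : p.Prime).two_le (Ne.symm hp)⟩
  intro h
  have h4 : (p : ℕ) ∣ 2 := (ZMod.natCast_eq_zero_iff 2 p).1 (by exact_mod_cast h)
  exact absurd (Nat.le_of_dvd (by norm_num) h4) (not_le.2 this.out)

lemma form_mul {t : K} (ht : σ (σ t) = t) (x : K) :
    form σ a b (t * x) = t * σ t * form σ a b x := by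
  simp only [form, map_mul, ht]; ring

/-- The number of `x` with `Tr (x (a σ(x) + b σ³(x))) = c`. -/
noncomputable def levelCard (c : ZMod p) : ℕ :=
  (Finset.univ.filter fun x : K => qform σ a b x = c).card

/-- The exponential sum attached to `qform`; it is an integer. -/
noncomputable def charSum : ℤ := levelCard σ a b 0 - levelCard σ a b 1

/-- The number of elements of the radical of `qform`. -/
noncomputable def radCard : ℕ := (Finset.univ.filter fun z : K => polar σ a b z = 0).card

variable {σ} {q : ℕ}

/-- Multiplication by an element of 𝔽_{q²} of norm `c` carries level 1 onto level `c`. -/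
lemma levelCard_eq (h : IsHermitianFrobenius σ q) {c : ZMod p} (hc : c ≠ 0) :
    levelCard σ a b c = levelCard σ a b 1 := by
  obtain ⟨t, ht, htf⟩ := h.exists_norm (c := algebraMap (ZMod p) K c) (by simpa using hc) (by simp)
  have hq : ∀ x, qform σ a b (t * x) = c * qform σ a b x := by
    intro x
    rw [qform, form_mul σ a b htf, ht, ← Algebra.smul_def, map_smul, smul_eq_mul, qform]
  have ht0 : t ≠ 0 := by
    rintro rfl
    simp only [zero_mul] at ht
    exact hc (by simpa using ht.symm)
  symm
  refine Finset.card_bij' (fun x _ => t * x) (fun x _ => t⁻¹ * x) ?_ ?_ ?_ ?_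
  · intro x hx
    simp only [Finset.mem_filter, Finset.mem_univ, true_and] at hx ⊢
    rw [hq, hx, mul_one]
  · intro x hx
    simp only [Finset.mem_filter, Finset.mem_univ, true_and] at hx ⊢
    have := hq (t⁻¹ * x)
    rw [mul_inv_cancel_left₀ ht0, hx] at this
    exact mul_left_cancel₀ hc (by rw [mul_one, ← this])
  · intro x _; simp [ht0]
  · intro x _; simp [ht0]

lemma sum_levelCard : ∑ c : ZMod p, levelCard σ a b c = Fintype.card K := by
  rw [← Finset.card_univ, Finset.card_eq_sum_card_fiberwise (f := qform σ a b) (t := Finset.univ)]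
  · rfl
  · intro x _; simp

lemma levelCard_zero_add (h : IsHermitianFrobenius σ q) :
    (levelCard σ a b 0 : ℤ) + (p - 1) * levelCard σ a b 1 = Fintype.card K := by
  rw [← sum_levelCard a b (σ := σ), ← Finset.add_sum_erase _ _ (Finset.mem_univ (0 : ZMod p)),
    Finset.sum_congr rfl (g := fun _ => levelCard σ a b 1)]
  · have : 1 ≤ p := (Fact.out : p.Prime).one_le
    simp [Finset.card_erase_of_mem, ZMod.card, Nat.cast_sub this]
  · intro c hc
    exact levelCard_eq a b h (Finset.ne_of_mem_erase hc)

lemma mul_levelCard_zero (h : IsHermitianFrobenius σ q) :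
    (p : ℤ) * levelCard σ a b 0 = Fintype.card K + (p - 1) * charSum σ a b := by
  rw [charSum, ← levelCard_zero_add a b h]; ring

lemma mul_levelCard_of_ne (h : IsHermitianFrobenius σ q) {c : ZMod p} (hc : c ≠ 0) :
    (p : ℤ) * levelCard σ a b c = Fintype.card K - charSum σ a b := by
  rw [charSum, ← levelCard_zero_add a b h, levelCard_eq a b h hc]; ring

variable (p K) in
/-- The canonical additive character of `K`. -/
noncomputable def traceChar : AddChar K ℂ :=
  (ZMod.stdAddChar (N := p)).compAddMonoidHom (Algebra.trace (ZMod p) K).toAddMonoidHom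

lemma traceChar_apply (x : K) :
    traceChar p K x = ZMod.stdAddChar (Algebra.trace (ZMod p) K x) := rfl

lemma traceChar_isPrimitive : (traceChar p K).IsPrimitive := by
  have : Finite (ZMod p) := inferInstance
  have : FiniteDimensional (ZMod p) K := Module.Finite.of_finite
  apply AddChar.IsPrimitive.of_ne_one
  intro h
  obtain ⟨x, hx⟩ := Algebra.trace_surjective (ZMod p) K 1
  have h1 : traceChar p K x = 1 := by rw [h]; rfl
  rw [traceChar_apply, hx] at h1
  have h2 : (1 : ZMod p) = 0 := by
    apply ZMod.injective_stdAddChar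
    rw [h1, AddChar.map_zero_eq_one]
  exact one_ne_zero h2

lemma charSum_eq_sum (h : IsHermitianFrobenius σ q) :
    (charSum σ a b : ℂ) = ∑ x : K, traceChar p K (form σ a b x) := by
  simp only [traceChar_apply]
  have h1 : ∑ x : K, ZMod.stdAddChar (Algebra.trace (ZMod p) K (form σ a b x))
      = ∑ c : ZMod p, (levelCard σ a b c : ℂ) * ZMod.stdAddChar c := by
    rw [← Finset.sum_fiberwise (s := Finset.univ) (g := qform σ a b)]
    refine Finset.sum_congr rfl fun c _ => ?_
    rw [Finset.sum_congr rfl (g := fun _ => ZMod.stdAddChar c)]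
    · simp [levelCard]
    · intro x hx
      simp only [Finset.mem_filter, Finset.mem_univ, true_and] at hx
      rw [← hx]; rfl
  have h2 : ∑ c : ZMod p, ZMod.stdAddChar c = (0 : ℂ) := by
    apply AddChar.sum_eq_zero_of_ne_one
    intro h
    have : (1 : ZMod p) = 0 := by
      apply ZMod.injective_stdAddChar
      rw [h]; simp
    exact one_ne_zero this
  -- Since the character values sum to zero, a constant may be subtracted from all level sizes; by
  -- `levelCard_eq` only the level 0 then survives.
  have h3 : ∑ c : ZMod p, (levelCard σ a b c : ℂ) * ZMod.stdAddChar c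
      = ∑ c : ZMod p, ((levelCard σ a b c : ℂ) - levelCard σ a b 1) * ZMod.stdAddChar c := by
    simp only [sub_mul, Finset.sum_sub_distrib]
    rw [← Finset.mul_sum, h2, mul_zero, sub_zero]
  rw [h1, h3, Finset.sum_eq_single 0]
  · simp [charSum]
  · intro c _ hc
    rw [levelCard_eq a b h hc, sub_self, zero_mul]
  · simp

/-- The square of the exponential sum is `|K|` times the size of the radical. -/
lemma charSum_sq (h : IsHermitianFrobenius σ q) (hp : p ≠ 2) :
    charSum σ a b ^ 2 = Fintype.card K * radCard σ a b := by
  -- Scaling by an element of norm `-1` shows that the sum for `-Q` is again S. Thus S² can be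
  -- expanded as S times its conjugate, and after the shift `x = y + z` the sum over `y` detects the
  -- radical.
  obtain ⟨t, ht, htf⟩ := h.exists_norm (c := (-1 : K)) (neg_ne_zero.2 one_ne_zero) (by simp)
  have ht0 : t ≠ 0 := by
    rintro rfl
    simp at ht
  have e1 : (charSum σ a b : ℂ) = ∑ y : K, traceChar p K (-form σ a b y) := by
    rw [charSum_eq_sum a b h]
    symm
    refine Fintype.sum_bijective (fun y => t * y) (mulLeft_bijective₀ t ht0) _ _ fun y => ?_
    rw [form_mul σ a b htf, ht, neg_one_mul]
  have e2 : (charSum σ a b : ℂ) ^ 2 = ∑ y : K, ∑ z : K,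
      traceChar p K (form σ a b z) * traceChar p K (y * polar σ a b z) := by
    rw [pow_two]
    nth_rw 2 [e1]
    rw [charSum_eq_sum a b h, Finset.sum_mul_sum, Finset.sum_comm]
    refine Finset.sum_congr rfl fun y _ => ?_
    symm
    refine Fintype.sum_bijective (fun z => y + z) (AddGroup.addLeft_bijective y) _ _ fun z => ?_
    rw [← AddChar.map_add_eq_mul, ← AddChar.map_add_eq_mul, traceChar_apply, traceChar_apply]
    congr 1
    have := qform_add σ a b y z
    simp only [qform] at this
    rw [map_add, map_add, this, map_neg]
    ring
  have e3 : (charSum σ a b : ℂ) ^ 2 = (Fintype.card K : ℂ) * radCard σ a b := by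
    rw [e2, Finset.sum_comm]
    simp only [← Finset.mul_sum, AddChar.sum_mulShift _ traceChar_isPrimitive]
    have : ∀ z : K, traceChar p K (form σ a b z) *
        ((if polar σ a b z = 0 then Fintype.card K else 0 : ℕ) : ℂ) =
        if polar σ a b z = 0 then (Fintype.card K : ℂ) else 0 := by
      intro z
      split_ifs with hz
      · have := qform_eq_zero_of_polar σ a b hp hz
        rw [qform] at this
        rw [traceChar_apply, this, AddChar.map_zero_eq_one, one_mul]
      · simp
    simp only [this]
    rw [← Finset.sum_filter, Finset.sum_const, nsmul_eq_mul, mul_comm, radCard]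
  exact_mod_cast e3

/-- The power moments of the exponential sums count common zeros of diagonal forms. -/
lemma sum_charSum_pow (h : IsHermitianFrobenius σ q) (k : ℕ) :
    ∑ u : K × K, charSum σ u.1 u.2 ^ k = Fintype.card K ^ 2 *
      ((Finset.univ.filter fun v : Fin k → K => ∑ i, v i * σ (v i) = 0 ∧
        ∑ i, v i * σ (σ (σ (v i))) = 0).card : ℤ) := by
  have key : ∀ u : K × K, (charSum σ u.1 u.2 : ℂ) ^ k = ∑ v : Fin k → K,
      traceChar p K (u.1 * ∑ i, v i * σ (v i)) *
        traceChar p K (u.2 * ∑ i, v i * σ (σ (σ (v i)))) := by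
    intro u
    rw [charSum_eq_sum _ _ h, Fintype.sum_pow]
    refine Finset.sum_congr rfl fun v _ => ?_
    rw [← AddChar.map_add_eq_mul, Finset.mul_sum, Finset.mul_sum, ← Finset.sum_add_distrib]
    have := map_prod (AddChar.toMonoidHom (traceChar p K))
      (fun i => Multiplicative.ofAdd (form σ u.1 u.2 (v i))) Finset.univ
    rw [← ofAdd_sum] at this
    refine Eq.trans this.symm ?_
    have hsum : ∑ i, form σ u.1 u.2 (v i) =
        ∑ i, (u.1 * (v i * σ (v i)) + u.2 * (v i * σ (σ (σ (v i))))) :=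
      Finset.sum_congr rfl fun i _ => by simp only [form]; ring
    exact congrArg (traceChar p K) hsum
  have e : (∑ u : K × K, (charSum σ u.1 u.2 : ℂ) ^ k) = (Fintype.card K : ℂ) ^ 2 *
      ((Finset.univ.filter fun v : Fin k → K => ∑ i, v i * σ (v i) = 0 ∧
        ∑ i, v i * σ (σ (σ (v i))) = 0).card : ℂ) := by
    simp only [key]
    -- For fixed `v` the exponent is linear in the pair `u`, so summing over `u` is orthogonality in
    -- each coordinate separately.
    rw [Finset.sum_comm]
    have : ∀ v : Fin k → K, ∑ u : K × K, traceChar p K (u.1 * ∑ i, v i * σ (v i)) *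
        traceChar p K (u.2 * ∑ i, v i * σ (σ (σ (v i)))) =
        if (∑ i, v i * σ (v i) = 0 ∧ ∑ i, v i * σ (σ (σ (v i))) = 0) then
          (Fintype.card K : ℂ) ^ 2 else 0 := by
      intro v
      rw [Fintype.sum_prod_type]
      simp only [← Finset.mul_sum]
      rw [← Finset.sum_mul, AddChar.sum_mulShift _ traceChar_isPrimitive,
        AddChar.sum_mulShift _ traceChar_isPrimitive]
      split_ifs <;> simp_all [pow_two]
    simp only [this]
    rw [← Finset.sum_filter, Finset.sum_const, nsmul_eq_mul, mul_comm]
  exact_mod_cast e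

lemma sum_charSum (h : IsHermitianFrobenius σ q) :
    ∑ u : K × K, charSum σ u.1 u.2 = Fintype.card K ^ 2 := by
  have := sum_charSum_pow h 1
  simp only [pow_one] at this
  rw [this]
  have hc : (Finset.univ.filter fun v : Fin 1 → K => ∑ i, v i * σ (v i) = 0 ∧
        ∑ i, v i * σ (σ (σ (v i))) = 0).card = 1 := by
    rw [Finset.card_eq_one]
    refine ⟨0, ?_⟩
    ext v
    simp only [Finset.univ_unique, Fin.default_eq_zero, Finset.sum_singleton, mul_eq_zero,
      Finset.mem_filter, Finset.mem_univ, true_and, Finset.mem_singleton, funext_iff,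
      Fin.forall_fin_one, EmbeddingLike.map_eq_zero_iff, or_self, and_self, Pi.zero_apply]
  rw [hc]; simp

lemma sum_charSum_sq (h : IsHermitianFrobenius σ q) :
    ∑ u : K × K, charSum σ u.1 u.2 ^ 2 =
      (Fintype.card K : ℤ) ^ 2 * (1 + (Fintype.card K - 1) * (q + 1)) := by
  rw [sum_charSum_pow h 2]
  have hc : (Finset.univ.filter fun v : Fin 2 → K => ∑ i, v i * σ (v i) = 0 ∧
        ∑ i, v i * σ (σ (σ (v i))) = 0).card = 1 + (Fintype.card K - 1) * (q + 1) := by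
    rw [← h.card_pairs]
    refine Finset.card_bij' (fun v _ => (v 1, v 0)) (fun w _ => ![w.2, w.1]) ?_ ?_ ?_ ?_
    · intro v hv; simpa [Fin.sum_univ_two] using hv
    · intro v hv; simpa [Fin.sum_univ_two] using hv
    · intro v _; ext i; fin_cases i <;> rfl
    · intro v _; rfl
  have : 1 ≤ Fintype.card K := Fintype.card_pos
  rw [hc]; push_cast [this]; ring

lemma sum_charSum_cube (h : IsHermitianFrobenius σ q) :
    ∑ u : K × K, charSum σ u.1 u.2 ^ 3 =
      (Fintype.card K : ℤ) ^ 2 * (1 + (Fintype.card K - 1) * (q ^ 3 + 1)) := by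
  rw [sum_charSum_pow h 3]
  have hc : (Finset.univ.filter fun v : Fin 3 → K => ∑ i, v i * σ (v i) = 0 ∧
        ∑ i, v i * σ (σ (σ (v i))) = 0).card = 1 + (Fintype.card K - 1) * (q ^ 3 + 1) := by
    rw [← h.card_triples]
    refine Finset.card_bij' (fun v _ => (v 2, v 1, v 0)) (fun w _ => ![w.2.2, w.2.1, w.1])
      ?_ ?_ ?_ ?_
    · intro v hv; simpa [Fin.sum_univ_three] using hv
    · intro v hv; simpa [Fin.sum_univ_three] using hv
    · intro v _; ext i; fin_cases i <;> rfl
    · intro v _; rfl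
  have : 1 ≤ Fintype.card K := Fintype.card_pos
  rw [hc]; push_cast [this]; ring

/-- A set of nonzero elements stable under multiplication by the `d`-th roots of unity has size
divisible by `d`. -/
lemma dvd_card_of_stable {d : ℕ} (hd : 0 < d) (hdvd : d ∣ Fintype.card K - 1) (s : Finset K)
    (h0 : (0 : K) ∉ s) (hs : ∀ t : K, t ^ d = 1 → ∀ x ∈ s, t * x ∈ s) : d ∣ s.card := by
  rw [Finset.card_eq_sum_card_image (fun x => x ^ d) s]
  refine Finset.dvd_sum fun y hy => ?_
  obtain ⟨x₀, hx₀, rfl⟩ := Finset.mem_image.1 hy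
  have hx : x₀ ≠ 0 := fun h => h0 (h ▸ hx₀)
  refine dvd_of_eq ?_
  refine (card_pow_eq_one (K := K) hd hdvd).symm.trans ?_
  refine Finset.card_bij' (fun t _ => t * x₀) (fun t _ => t / x₀) ?_ ?_ ?_ ?_
  · intro t ht
    simp only [Finset.mem_filter, Finset.mem_univ, true_and] at ht ⊢
    exact ⟨hs t ht _ hx₀, by rw [mul_pow, ht, one_mul]⟩
  · intro t ht
    simp only [Finset.mem_filter, Finset.mem_univ, true_and] at ht ⊢
    rw [div_pow, ht.2, div_self (pow_ne_zero _ hx)]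
  · intro t _; simp [hx]
  · intro t _; simp [hx]

/-- Multiplication by the `q + 1` elements of norm one preserves Q and is free away from zero. The
level 1 therefore has size 0 modulo `q + 1`; the level 0 has size 1, the extra element being `x =
0`. -/
lemma dvd_charSum_sub_one (h : IsHermitianFrobenius σ q) :
    ((q : ℤ) + 1) ∣ charSum σ a b - 1 := by
  have hdvd : q + 1 ∣ Fintype.card K - 1 := (Dvd.intro _ rfl).trans h.dvd
  have hinv : ∀ t : K, t ^ (q + 1) = 1 → ∀ x, qform σ a b (t * x) = qform σ a b x := by
    intro t ht x
    obtain ⟨h1, h2⟩ := (h.norm_iff one_ne_zero (by simp) t).2 ht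
    rw [qform, form_mul σ a b h2, h1, one_mul, qform]
  have d1 : q + 1 ∣ levelCard σ a b 1 := by
    refine dvd_card_of_stable (by omega) hdvd _ ?_ ?_
    · simp [qform_zero]
    · intro t ht x hx
      simpa [hinv t ht] using hx
  have d0 : q + 1 ∣ ((Finset.univ.filter fun x : K => qform σ a b x = 0).erase 0).card := by
    refine dvd_card_of_stable (by omega) hdvd _ ?_ ?_
    · simp
    · intro t ht x hx
      have ht0 : t ≠ 0 := by
        rintro rfl
        simp at ht
      simpa [hinv t ht, ht0] using hx
  have hmem : (0 : K) ∈ Finset.univ.filter fun x : K => qform σ a b x = 0 := by simp [qform_zero]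
  have hcard : levelCard σ a b 0 =
      ((Finset.univ.filter fun x : K => qform σ a b x = 0).erase 0).card + 1 :=
    (Finset.card_erase_add_one hmem).symm
  obtain ⟨k, hk⟩ := d1
  obtain ⟨l, hl⟩ := d0
  refine ⟨l - k, ?_⟩
  rw [charSum, hcard, hk, hl]
  push_cast
  ring

end Forms

/-! ### The radical, the exact value of the exponential sum, and the moment equations -/

section Radical

variable {p : ℕ} [Fact p.Prime] {K : Type*} [Field K] [Fintype K] [DecidableEq K]
  [Algebra (ZMod p) K] {σ : K ≃ₐ[ZMod p] K} {q n : ℕ}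

lemma radCard_le (h : IsHermitianFrobenius σ q) {a b : K} (hab : (a, b) ≠ 0) :
    radCard σ a b ≤ (q ^ 2) ^ 3 := by
  set τ : K →+* K := (σ : K →+* K).comp (σ : K →+* K) with hτ
  have hτa : ∀ x, τ x = σ (σ x) := fun x => rfl
  have h1 : (Finset.univ.filter fun y => τ y = y).card = q ^ 2 := h.card_fix
  rw [← h1]
  refine le_trans (le_of_eq ?_) (card_ker_deg_three_le τ b (σ (σ a)) (σ (σ (σ a))) (σ (σ (σ b))) ?_)
  · rw [radCard]
    congr 1
    ext z
    simp only [Finset.mem_filter, Finset.mem_univ, true_and, hτa]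
    -- Applying `σ³` clears the inverses and leaves only even powers of `σ`: a polynomial of degree
    -- three in `τ = σ²`.
    have : σ (σ (σ (polar σ a b z))) = b * z + σ (σ a) * σ (σ z) + σ (σ (σ a)) * σ (σ (σ (σ z)))
        + σ (σ (σ b)) * σ (σ (σ (σ (σ (σ z))))) := by
      simp only [polar_apply, map_add, map_mul, AlgEquiv.apply_symm_apply]
      ring
    rw [← this]
    simp
  · rintro ⟨hb, ha, -, -⟩
    apply hab
    have : a = 0 := by simpa using ha
    rw [this, hb]
    rfl

/-- The radical is a vector space over the fixed field of `σ²`. -/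
lemma exists_radCard_eq (h : IsHermitianFrobenius σ q) (a b : K) :
    ∃ i : ℕ, radCard σ a b = (q ^ 2) ^ i := by
  set E : Subfield K :=
    RingHom.eqLocusField ((σ : K →+* K).comp (σ : K →+* K)) (RingHom.id K) with hE
  have hmem : ∀ x : K, x ∈ E ↔ σ (σ x) = x := fun x => Iff.rfl
  let V : Submodule E K :=
    { carrier := {z | polar σ a b z = 0}
      zero_mem' := by simp
      add_mem' := by
        intro x y hx hy
        simp only [Set.mem_ofPred_eq] at hx hy ⊢
        rw [map_add, hx, hy, add_zero]
      smul_mem' := by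
        rintro ⟨e, he⟩ x hx
        rw [hmem] at he
        simp only [Set.mem_ofPred_eq] at hx ⊢
        change polar σ a b (e * x) = 0
        -- On the fixed field of `σ²`, `σ` and its inverse agree. Every term of `polar` involves an
        -- odd power of `σ`, so all of them pull out the same factor `σ e`.
        have he' : σ.symm e = σ e := by rw [AlgEquiv.symm_apply_eq, he]
        have : polar σ a b (e * x) = σ e * polar σ a b x := by
          have h3 : σ.symm (σ e) = e := σ.symm_apply_apply e
          simp only [polar_apply, map_mul, he, he', h3]
          ring
        rw [this, hx, mul_zero] }
  have hEcard : Nat.card E = q ^ 2 := by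
    rw [← h.card_fix, ← Fintype.card_subtype, ← Nat.card_eq_fintype_card]
    rfl
  have hVcard : Nat.card V = radCard σ a b := by
    rw [radCard, ← Fintype.card_subtype, ← Nat.card_eq_fintype_card]
    rfl
  refine ⟨Module.finrank E V, ?_⟩
  rw [← hEcard, ← hVcard]
  exact Module.natCard_eq_pow_finrank

lemma exists_radCard_eq_of_ne (h : IsHermitianFrobenius σ q) {a b : K} (hab : (a, b) ≠ 0) :
    ∃ i : Fin 4, radCard σ a b = (q ^ 2) ^ (i : ℕ) := by
  obtain ⟨i, hi⟩ := exists_radCard_eq h a b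
  have hle := radCard_le h hab
  rw [hi] at hle
  have hq := h.two_lt
  have : i ≤ 3 := (Nat.pow_le_pow_iff_right (by nlinarith)).1 hle
  exact ⟨⟨i, by omega⟩, hi⟩

/-- An integer congruent to `1` modulo `q + 1` whose square is `q ^ (2 j)` equals `(-q) ^ j`. -/
lemma eq_neg_pow_of_sq {S : ℤ} {j : ℕ} (hq : 2 < q) (hS : ((q : ℤ) + 1) ∣ S - 1)
    (hsq : S ^ 2 = ((q : ℤ) ^ j) ^ 2) : S = (-(q : ℤ)) ^ j := by
  have h1 : ((q : ℤ) + 1) ∣ (-(q : ℤ)) ^ j - 1 := by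
    have := sub_dvd_pow_sub_pow (-(q : ℤ)) 1 j
    rw [one_pow] at this
    exact (by rw [← neg_dvd]; ring_nf; ring_nf at this; exact this)
  have h2 : S ^ 2 = ((-(q : ℤ)) ^ j) ^ 2 := by
    rw [hsq, ← pow_mul, ← pow_mul, mul_comm, pow_mul, pow_mul, neg_sq]
  rcases sq_eq_sq_iff_eq_or_eq_neg.1 h2 with h3 | h3
  · exact h3
  · exfalso
    rw [h3] at hS
    -- With the opposite sign both `1` and `-1` would be the residue of S, forcing `q + 1` to divide
    -- 2.
    have h4 : ((q : ℤ) + 1) ∣ 2 := by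
      have := dvd_add hS h1
      rw [show -(-(q : ℤ)) ^ j - 1 + ((-(q : ℤ)) ^ j - 1) = -2 by ring] at this
      exact (dvd_neg).1 this
    have := Int.le_of_dvd (by norm_num) h4
    omega

lemma charSum_of_radCard (h : IsHermitianFrobenius σ q) (hp : p ≠ 2)
    (hK : Fintype.card K = q ^ (2 * n)) {a b : K} {i : ℕ} (hi : radCard σ a b = (q ^ 2) ^ i) :
    charSum σ a b = (-(q : ℤ)) ^ (n + i) := by
  refine eq_neg_pow_of_sq h.two_lt (dvd_charSum_sub_one a b h) ?_
  rw [charSum_sq a b h hp, hK, hi]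
  push_cast
  ring

lemma exists_charSum_eq (h : IsHermitianFrobenius σ q) (hp : p ≠ 2)
    (hK : Fintype.card K = q ^ (2 * n)) {a b : K} (hab : (a, b) ≠ 0) :
    ∃ i : Fin 4, charSum σ a b = (-(q : ℤ)) ^ (n + i) := by
  obtain ⟨i, hi⟩ := exists_radCard_eq_of_ne h hab
  exact ⟨i, charSum_of_radCard h hp hK hi⟩

lemma radCard_of_charSum (h : IsHermitianFrobenius σ q) (hp : p ≠ 2)
    (hK : Fintype.card K = q ^ (2 * n)) {a b : K} {i : ℕ}
    (hi : charSum σ a b = (-(q : ℤ)) ^ (n + i)) : radCard σ a b = q ^ (2 * i) := by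
  have h1 := charSum_sq a b h hp
  rw [hi, hK, ← pow_mul, mul_comm, pow_mul, neg_sq, ← pow_mul] at h1
  have h2 : q ^ (2 * n) * q ^ (2 * i) = q ^ (2 * n) * radCard σ a b := by
    rw [← pow_add, ← mul_add]
    exact_mod_cast h1
  have hq := h.two_lt
  exact (Nat.eq_of_mul_eq_mul_left (by positivity) h2).symm

lemma charSum_zero (hK : Fintype.card K = q ^ (2 * n)) :
    charSum σ 0 0 = (-(q : ℤ)) ^ (2 * n) := by
  have h0 : ∀ x : K, qform σ 0 0 x = 0 := by intro x; simp [qform, form]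
  rw [charSum, levelCard, levelCard]
  simp [h0, Finset.card_univ, hK, pow_mul]

lemma neg_pow_injective (hq : 2 < q) : Function.Injective fun j : ℕ => (-(q : ℤ)) ^ j := by
  intro i j hij
  have h1 := congrArg Int.natAbs hij
  simp only [Int.natAbs_pow, Int.natAbs_neg, Int.natAbs_natCast] at h1
  exact Nat.pow_right_injective (by omega) h1

variable (σ q n) in
/-- The number of nonzero pairs `(a, b)` whose exponential sum is `(-q) ^ (n + i)`. -/
noncomputable def rankCount (i : Fin 4) : ℕ :=
  (Finset.univ.filter fun u : K × K => charSum σ u.1 u.2 = (-(q : ℤ)) ^ (n + i)).card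

/-- The zero pair has sum `(-q) ^ (2n)`, written separately; `4 ≤ n` gives `n + 3 < 2n`, so it is
never counted by `rankCount`. -/
lemma sum_eq_sum_rankCount (h : IsHermitianFrobenius σ q) (hp : p ≠ 2)
    (hK : Fintype.card K = q ^ (2 * n)) (hn : 4 ≤ n)
    {R : Type*} [CommRing R] (f : ℤ → R) :
    ∑ u : K × K, f (charSum σ u.1 u.2) = f ((-(q : ℤ)) ^ (2 * n)) +
      ∑ i : Fin 4, rankCount σ q n i * f ((-(q : ℤ)) ^ (n + i)) := by
  have hinj := neg_pow_injective h.two_lt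
  have key : ∀ u : K × K, f (charSum σ u.1 u.2) = (if u = 0 then f ((-(q : ℤ)) ^ (2 * n)) else 0) +
      ∑ i : Fin 4, if charSum σ u.1 u.2 = (-(q : ℤ)) ^ (n + i) then
        f ((-(q : ℤ)) ^ (n + i)) else 0 := by
    intro u
    split_ifs with hu
    · subst hu
      have hz : charSum σ (0 : K × K).1 (0 : K × K).2 = (-(q : ℤ)) ^ (2 * n) := charSum_zero hK
      rw [hz, Finset.sum_eq_zero, add_zero]
      intro i _
      rw [if_neg]
      intro he
      have := hinj he
      omega
    · obtain ⟨i, hi⟩ := exists_charSum_eq h hp hK (a := u.1) (b := u.2) hu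
      rw [zero_add, Finset.sum_eq_single i]
      · rw [if_pos hi, hi]
      · intro j _ hj
        rw [if_neg]
        intro he
        have : n + (i : ℕ) = n + (j : ℕ) := hinj (hi.symm.trans he)
        exact hj (Fin.ext (by omega))
      · simp
  simp only [key]
  rw [Finset.sum_add_distrib, Finset.sum_ite_eq' Finset.univ (0 : K × K), if_pos (Finset.mem_univ _),
    Finset.sum_comm]
  congr 1
  refine Finset.sum_congr rfl fun i _ => ?_
  rw [← Finset.sum_filter, Finset.sum_const, nsmul_eq_mul, rankCount]

/-- The moment equations for the numbers of forms with given exponential sum. -/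
lemma rankCount_moments (h : IsHermitianFrobenius σ q) (hp : p ≠ 2)
    (hK : Fintype.card K = q ^ (2 * n)) (hn : 4 ≤ n) (k : ℕ) :
    ∑ i : Fin 4, (rankCount σ q n i : ℤ) * ((-(q : ℤ)) ^ (n + i)) ^ k =
      ∑ u : K × K, charSum σ u.1 u.2 ^ k - ((-(q : ℤ)) ^ (2 * n)) ^ k := by
  rw [sum_eq_sum_rankCount h hp hK hn (fun x => x ^ k)]
  ring

/-- The moment equations divided by powers of `Y = (-q) ^ n`. -/
lemma moments_div {Q Y g₀ g₁ g₂ g₃ : ℚ} (hY : Y ≠ 0)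
    (e0 : g₀ + g₁ + g₂ + g₃ = Y ^ 4 - 1)
    (e1 : g₀ * Y + g₁ * (Y * (-Q)) + g₂ * (Y * (-Q) ^ 2) + g₃ * (Y * (-Q) ^ 3) = Y ^ 4 - Y ^ 2)
    (e2 : g₀ * Y ^ 2 + g₁ * (Y * (-Q)) ^ 2 + g₂ * (Y * (-Q) ^ 2) ^ 2 + g₃ * (Y * (-Q) ^ 3) ^ 2
      = Y ^ 4 * (1 + (Y ^ 2 - 1) * (Q + 1)) - Y ^ 4)
    (e3 : g₀ * Y ^ 3 + g₁ * (Y * (-Q)) ^ 3 + g₂ * (Y * (-Q) ^ 2) ^ 3 + g₃ * (Y * (-Q) ^ 3) ^ 3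
      = Y ^ 4 * (1 + (Y ^ 2 - 1) * (Q ^ 3 + 1)) - Y ^ 6) :
    (g₀ + g₁ + g₂ + g₃ = Y ^ 4 - 1) ∧
    (g₀ + g₁ * (-Q) + g₂ * Q ^ 2 + g₃ * (-Q ^ 3) = Y ^ 3 - Y) ∧
    (g₀ + g₁ * Q ^ 2 + g₂ * Q ^ 4 + g₃ * Q ^ 6 = Y ^ 2 * (Y ^ 2 - 1) * (Q + 1)) ∧
    (g₀ + g₁ * (-Q ^ 3) + g₂ * Q ^ 6 + g₃ * (-Q ^ 9) = Y * (Y ^ 2 - 1) * Q ^ 3) := by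
  refine ⟨e0, ?_, ?_, ?_⟩
  · exact mul_left_cancel₀ hY (by linear_combination e1)
  · exact mul_left_cancel₀ (pow_ne_zero 2 hY) (by linear_combination e2)
  · exact mul_left_cancel₀ (pow_ne_zero 3 hY) (by linear_combination e3)

/-- The solution of the moment equations. -/
lemma moment_solution {Q Y g₀ g₁ g₂ g₃ D : ℚ}
    (hD : D = Q ^ 6 + Q ^ 5 - Q ^ 4 + Q ^ 2 - Q - 1)
    (e0 : g₀ + g₁ + g₂ + g₃ = Y ^ 4 - 1)
    (e1 : g₀ + g₁ * (-Q) + g₂ * Q ^ 2 + g₃ * (-Q ^ 3) = Y ^ 3 - Y)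
    (e2 : g₀ + g₁ * Q ^ 2 + g₂ * Q ^ 4 + g₃ * Q ^ 6 = Y ^ 2 * (Y ^ 2 - 1) * (Q + 1))
    (e3 : g₀ + g₁ * (-Q ^ 3) + g₂ * Q ^ 6 + g₃ * (-Q ^ 9) = Y * (Y ^ 2 - 1) * Q ^ 3) :
    g₀ * D = Y ^ 4 * (Q ^ 6 - Q ^ 4 - Q) + Y ^ 2 * (Q ^ 4 + Q) - Q ^ 6
        + (Y ^ 3 - Y) * (Q ^ 5 - Q ^ 4) ∧
    g₁ * D * Q ^ 2 = Y ^ 4 * (Q ^ 7 - Q ^ 2 - 1) + Y ^ 2 * (Q ^ 5 - Q ^ 6 + Q ^ 2 + 1)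
        - Q ^ 5 * (Q ^ 2 - Q + 1)
        - Q ^ 2 * (Y ^ 3 - Y) * (Q ^ 5 - Q ^ 4 + Q ^ 3 - Q ^ 2 + Q - 1) ∧
    g₂ * D * Q ^ 3 = Y ^ 4 * (Q ^ 5 + Q - 1) - Y ^ 2 * (Q ^ 6 + Q ^ 4 + Q - 1)
        + Q ^ 4 * (Q ^ 2 - Q + 1)
        + Q * (Y ^ 3 - Y) * (Q ^ 5 - Q ^ 4 + Q ^ 3 - Q ^ 2 + Q - 1) ∧
    g₃ * D * Q ^ 3 = (Y ^ 2 - 1) * (Y ^ 2 - Q ^ 3 - (Q ^ 2 - Q) * Y) := by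
  subst hD
  refine ⟨?_, ?_, ?_, ?_⟩
  -- Each unknown is isolated by combining the equations with the coefficients of the cubic that
  -- vanishes at the three other nodes among `1, -Q, Q², -Q³`. For `g₀` this cubic takes the value
  -- `-D` at its own node. For `g₁` and `g₂` the value lacks the factor `Q² - Q + 1` of `D`, which
  -- is supplied by hand.
  · refine mul_left_cancel₀ (neg_ne_zero.2 (one_ne_zero (α := ℚ))) ?_
    linear_combination e3 - (-Q + Q ^ 2 - Q ^ 3) * e2 + (-Q ^ 3 + Q ^ 4 - Q ^ 5) * e1 - Q ^ 6 * e0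
  · linear_combination (Q ^ 2 - Q + 1) * (e3 - (1 + Q ^ 2 - Q ^ 3) * e2
      + (Q ^ 2 - Q ^ 3 - Q ^ 5) * e1 + Q ^ 5 * e0)
  · linear_combination (Q ^ 2 - Q + 1) * (e3 - (1 - Q - Q ^ 3) * e2
      + (-Q - Q ^ 3 + Q ^ 4) * e1 - Q ^ 4 * e0)
  · linear_combination - (e3 - (1 - Q + Q ^ 2) * e2 + (-Q + Q ^ 2 - Q ^ 3) * e1 + Q ^ 3 * e0)

/-- With the signed `Y = (-q) ^ n` one has |K| = Y², and all moments become polynomials in `Q` and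
`Y`; both parities of `n` are treated at once. -/
lemma rankCount_eqs (h : IsHermitianFrobenius σ q) (hp : p ≠ 2)
    (hK : Fintype.card K = q ^ (2 * n)) (hn : 4 ≤ n) {D Q Y : ℚ} (hQ : Q = q) (hY : Y = (-Q) ^ n)
    (hD : D = Q ^ 6 + Q ^ 5 - Q ^ 4 + Q ^ 2 - Q - 1) :
    (rankCount σ q n 0) * D = Y ^ 4 * (Q ^ 6 - Q ^ 4 - Q) + Y ^ 2 * (Q ^ 4 + Q) - Q ^ 6
        + (Y ^ 3 - Y) * (Q ^ 5 - Q ^ 4) ∧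
    (rankCount σ q n 1) * D * Q ^ 2 = Y ^ 4 * (Q ^ 7 - Q ^ 2 - 1)
        + Y ^ 2 * (Q ^ 5 - Q ^ 6 + Q ^ 2 + 1) - Q ^ 5 * (Q ^ 2 - Q + 1)
        - Q ^ 2 * (Y ^ 3 - Y) * (Q ^ 5 - Q ^ 4 + Q ^ 3 - Q ^ 2 + Q - 1) ∧
    (rankCount σ q n 2) * D * Q ^ 3 = Y ^ 4 * (Q ^ 5 + Q - 1)
        - Y ^ 2 * (Q ^ 6 + Q ^ 4 + Q - 1) + Q ^ 4 * (Q ^ 2 - Q + 1)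
        + Q * (Y ^ 3 - Y) * (Q ^ 5 - Q ^ 4 + Q ^ 3 - Q ^ 2 + Q - 1) ∧
    (rankCount σ q n 3) * D * Q ^ 3 = (Y ^ 2 - 1) * (Y ^ 2 - Q ^ 3 - (Q ^ 2 - Q) * Y) := by
  have hq := h.two_lt
  have hQ0 : Q ≠ 0 := by rw [hQ]; positivity
  have hY0 : Y ≠ 0 := by rw [hY]; exact pow_ne_zero _ (neg_ne_zero.2 hQ0)
  have hK2 : (Fintype.card K : ℚ) = Y ^ 2 := by
    rw [hK, hY, hQ, ← pow_mul, mul_comm n 2, pow_mul (-(q : ℚ)), neg_sq, ← pow_mul]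
    push_cast
    ring
  have hY2 : (-Q) ^ (2 * n) = Y ^ 2 := by rw [hY, ← pow_mul, mul_comm]
  have m0 := rankCount_moments h hp hK hn 0
  have m1 := rankCount_moments h hp hK hn 1
  have m2 := rankCount_moments h hp hK hn 2
  have m3 := rankCount_moments h hp hK hn 3
  simp only [pow_one] at m1
  rw [sum_charSum h] at m1
  rw [sum_charSum_sq h] at m2
  rw [sum_charSum_cube h] at m3
  simp only [pow_zero, mul_one, Finset.sum_const, Finset.card_univ, Fintype.card_prod,
    nsmul_eq_mul] at m0
  replace m0 := congrArg (Int.cast (R := ℚ)) m0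
  replace m1 := congrArg (Int.cast (R := ℚ)) m1
  replace m2 := congrArg (Int.cast (R := ℚ)) m2
  replace m3 := congrArg (Int.cast (R := ℚ)) m3
  rw [Fin.sum_univ_four] at m0 m1 m2 m3
  push_cast at m0 m1 m2 m3
  simp only [hK2, ← hQ, hY2, pow_add, ← hY, Fin.val_zero, Fin.val_one, Fin.val_two, pow_zero, pow_one, mul_one,
    show ((3 : Fin 4) : ℕ) = 3 from rfl] at m0 m1 m2 m3
  obtain ⟨e0, e1, e2, e3⟩ := moments_div (Q := Q)
    (g₀ := rankCount σ q n 0) (g₁ := rankCount σ q n 1) (g₂ := rankCount σ q n 2)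
    (g₃ := rankCount σ q n 3) hY0 (by linear_combination m0) (by linear_combination m1) (by linear_combination m2) (by linear_combination m3)
  exact moment_solution hD e0 e1 e2 e3

end Radical

/-! ### Comparison with the tabulated frequencies -/

section Frequencies

variable {p : ℕ} [Fact p.Prime] {K : Type*} [Field K] [Fintype K] [DecidableEq K]
  [Algebra (ZMod p) K] {σ : K ≃ₐ[ZMod p] K} {q n : ℕ}

/-- Up to sign, the denominator is the product `(Q + 1)(Q² - 1)(Q³ + 1)` of the differences between
the node `1` and the nodes `-Q, Q², -Q³`. -/
lemma freqDen_pos {Q : ℚ} (hQ : 1 < Q) : 0 < Q ^ 6 + Q ^ 5 - Q ^ 4 + Q ^ 2 - Q - 1 := by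
  have : Q ^ 6 + Q ^ 5 - Q ^ 4 + Q ^ 2 - Q - 1 =
    (Q + 1) ^ 2 * ((Q - 1) * (Q + 1)) * (Q * (Q - 1) + 1) := by ring
  rw [this]
  have h1 : 0 < Q - 1 := by linarith
  positivity

lemma div_gcd_div_two {m ℓ : ℕ} (hδ : 0 < m.gcd ℓ) (hm : m = 2 * (n * m.gcd ℓ)) :
    m / m.gcd ℓ / 2 = n := by
  have h1 : m / m.gcd ℓ = 2 * n := Nat.div_eq_of_eq_mul_left hδ (by rw [mul_assoc]; exact hm)
  rw [h1, Nat.mul_div_cancel_left _ (by norm_num)]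

lemma eps_eq {m ℓ : ℕ} (hδ : 0 < m.gcd ℓ) (hm : m = 2 * (n * m.gcd ℓ)) :
    eps m ℓ = (-1) ^ n := by
  rw [eps, div_gcd_div_two hδ hm]

/-- The numbers of forms with given exponential sum are the tabulated frequencies. -/
lemma rankCount_eq_freq (h : IsHermitianFrobenius σ q) (hp : p ≠ 2)
    (hK : Fintype.card K = q ^ (2 * n)) (hn : 4 ≤ n) {m ℓ : ℕ} (hδ : 0 < m.gcd ℓ)
    (hm : m = 2 * (n * m.gcd ℓ)) (hq : q = p ^ m.gcd ℓ) (i : Fin 4) :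
    (rankCount σ q n i : ℚ) = freq p m ℓ i := by
  have he : ((eps m ℓ : ℤ) : ℚ) = (-1) ^ n := by
    rw [eps_eq hδ hm]
    push_cast
    rfl
  rw [freq, he]
  generalize m.gcd ℓ = δ at *
  have hwδ : 4 * δ ≤ n * δ := Nat.mul_le_mul_right _ hn
  have hX : (p : ℚ) ^ (n * δ) = ((p : ℚ) ^ δ) ^ n := by rw [← pow_mul, mul_comm]
  have hp0 : (p : ℚ) ≠ 0 := by exact_mod_cast (Fact.out : p.Prime).ne_zero
  have hq2 := h.two_lt
  have hQ : (p : ℚ) ^ δ = q := by rw [hq]; push_cast; rfl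
  have hQ1 : 1 < (p : ℚ) ^ δ := by rw [hQ]; exact_mod_cast (by omega : 1 < q)
  have hD := (freqDen_pos hQ1).ne'
  obtain ⟨e0, e1, e2, e3⟩ := rankCount_eqs h hp hK hn hQ rfl rfl
  rw [neg_pow, ← hX] at e0 e1 e2 e3
  -- Now `Y = e X` with `X = p ^ (m / 2)` and `e² = 1`, so the sign survives exactly in the odd
  -- powers of `Y`.
  have hsq : ((-1 : ℚ) ^ n) ^ 2 = 1 := by rw [← pow_mul, mul_comm, pow_mul]; simp
  generalize (-1 : ℚ) ^ n = e at *
  generalize n * δ = w at *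
  subst hm
  have a1 : ∀ k, (p : ℚ) ^ (k * δ) = (p ^ δ) ^ k := fun k => by rw [← pow_mul, mul_comm]
  have a2 : 3 * (2 * w) / 2 = 3 * w := by omega
  have a3 : 2 * w / 2 = w := by omega
  have b0 : (p : ℚ) ^ (2 * (2 * w)) = (p ^ w) ^ 4 := by rw [← pow_mul]; congr 1; ring
  have b1 : (p : ℚ) ^ (2 * w) = (p ^ w) ^ 2 := by rw [← pow_mul]; congr 1; ring
  have b2 : (p : ℚ) ^ (3 * w) = (p ^ w) ^ 3 := by rw [← pow_mul]; congr 1; ring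
  have sub : ∀ s k, k * δ ≤ s → (p : ℚ) ^ (s - k * δ) = p ^ s / (p ^ δ) ^ k := by
    intro s k hs
    rw [← a1, eq_div_iff (pow_ne_zero _ hp0), ← pow_add, Nat.sub_add_cancel hs]
  have sub1 : ∀ s, δ ≤ s → (p : ℚ) ^ (s - δ) = p ^ s / p ^ δ := by
    intro s hs
    rw [eq_div_iff (pow_ne_zero _ hp0), ← pow_add, Nat.sub_add_cancel hs]
  have hQ0 : (p : ℚ) ^ δ ≠ 0 := pow_ne_zero _ hp0
  have h3 : e ^ 3 = e := by linear_combination e * hsq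
  have h4 : e ^ 4 = 1 := by linear_combination (e ^ 2 + 1) * hsq
  fin_cases i
  · simp only [Fin.zero_eta, Matrix.cons_val_zero, freq0, freqDen, a2, a3, pow_add, a1, b0, b1, b2]
    rw [eq_div_iff hD]
    generalize (p : ℚ) ^ δ = Q at *
    generalize (p : ℚ) ^ w = X at *
    rw [e0]
    linear_combination (X ^ 4 * (Q ^ 6 - Q ^ 4 - Q)) * h4 + X ^ 2 * (Q ^ 4 + Q) * hsq
      + X ^ 3 * (Q ^ 5 - Q ^ 4) * h3
  · simp only [Fin.mk_one, Matrix.cons_val_one, Matrix.cons_val_zero, freq1, freqDen, altSum, a2, a3]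
    rw [sub _ 2 (by omega), sub _ 2 (by omega)]
    simp only [Finset.sum_range_succ, Finset.sum_range_zero, a1, b0, b1, b2]
    rw [eq_div_iff hD]
    generalize (p : ℚ) ^ δ = Q at *
    generalize (p : ℚ) ^ w = X at *
    refine mul_right_cancel₀ (pow_ne_zero 2 hQ0) ?_
    rw [e1]
    field_simp
    linear_combination (X ^ 4 * (Q ^ 7 - Q ^ 2 - 1)) * h4
      + X ^ 2 * (Q ^ 5 - Q ^ 6 + Q ^ 2 + 1) * hsq
      - Q ^ 2 * X ^ 3 * (Q ^ 5 - Q ^ 4 + Q ^ 3 - Q ^ 2 + Q - 1) * h3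
  · simp only [Fin.reduceFinMk, Matrix.cons_val, freq2, freqDen, altSum, a2, a3]
    rw [sub _ 3 (by omega), sub _ 3 (by omega), sub _ 2 (by omega), sub _ 2 (by omega)]
    simp only [Finset.sum_range_succ, Finset.sum_range_zero, a1, b0, b1, b2]
    rw [eq_div_iff hD]
    generalize (p : ℚ) ^ δ = Q at *
    generalize (p : ℚ) ^ w = X at *
    refine mul_right_cancel₀ (pow_ne_zero 3 hQ0) ?_
    rw [e2]
    field_simp
    linear_combination (X ^ 4 * (Q ^ 5 + Q - 1)) * h4
      - X ^ 2 * (Q ^ 6 + Q ^ 4 + Q - 1) * hsq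
      + Q * X ^ 3 * (Q ^ 5 - Q ^ 4 + Q ^ 3 - Q ^ 2 + Q - 1) * h3
  · simp only [Fin.reduceFinMk, Matrix.cons_val, freq3, freqDen, a2, a3]
    rw [sub _ 3 (by omega), sub _ 3 (by omega), sub _ 2 (by omega), sub _ 2 (by omega),
      sub1 _ (by omega), sub1 _ (by omega)]
    simp only [a1, b0, b1, b2]
    rw [eq_div_iff hD]
    generalize (p : ℚ) ^ δ = Q at *
    generalize (p : ℚ) ^ w = X at *
    refine mul_right_cancel₀ (pow_ne_zero 3 hQ0) ?_
    rw [e3]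
    field_simp
    linear_combination X ^ 4 * h4 - (X ^ 2 + X ^ 2 * Q ^ 3) * hsq - (Q ^ 2 - Q) * X ^ 3 * h3

/-- Since `4 ≤ n` gives `|Y| ≥ Q⁴`, the term `Y²` dominates in both factors of the closed formula,
whichever the sign of `Y`. This guarantees that the extremal words exist. -/
lemma rankCount_three_pos (h : IsHermitianFrobenius σ q) (hp : p ≠ 2)
    (hK : Fintype.card K = q ^ (2 * n)) (hn : 4 ≤ n) : 0 < rankCount σ q n 3 := by
  have hq2 := h.two_lt
  obtain ⟨-, -, -, e3⟩ := rankCount_eqs h hp hK hn (Q := q) rfl rfl rfl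
  have hQ : (2 : ℚ) < q := by exact_mod_cast hq2
  have hD := freqDen_pos (by linarith : (1 : ℚ) < q)
  have habs : |(-(q : ℚ)) ^ n| = (q : ℚ) ^ n := by
    rw [abs_pow, abs_neg, abs_of_pos (by linarith)]
  have hge : (q : ℚ) ^ 4 ≤ |(-(q : ℚ)) ^ n| := by
    rw [habs]; exact pow_le_pow_right₀ (by linarith) hn
  generalize (-(q : ℚ)) ^ n = Y at *
  generalize (q : ℚ) = Q at *
  have h2 : Q ^ 2 < Q ^ 4 := pow_lt_pow_right₀ (by linarith) (by norm_num)
  have h3 : Q ^ 3 < Q ^ 4 := pow_lt_pow_right₀ (by linarith) (by norm_num)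
  have hsq : Y ^ 2 = |Y| ^ 2 := (sq_abs Y).symm
  have hle : (Q ^ 2 - Q) * Y ≤ (Q ^ 2 - Q) * |Y| :=
    mul_le_mul_of_nonneg_left (le_abs_self Y) (by nlinarith)
  have hY1 : 1 < |Y| := lt_of_lt_of_le (one_lt_pow₀ (by linarith) (by norm_num)) hge
  have f1 : 0 < Y ^ 2 - 1 := by rw [hsq]; nlinarith
  have f2 : 0 < Y ^ 2 - Q ^ 3 - (Q ^ 2 - Q) * Y := by
    have : |Y| * 1 ≤ |Y| * (|Y| - (Q ^ 2 - Q)) := by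
      refine mul_le_mul_of_nonneg_left ?_ (abs_nonneg _)
      nlinarith
    rw [hsq]
    nlinarith
  have hpos : 0 < (rankCount σ q n 3 : ℚ) * ((Q ^ 6 + Q ^ 5 - Q ^ 4 + Q ^ 2 - Q - 1) * Q ^ 3) := by
    rw [← mul_assoc, e3]
    exact mul_pos f1 f2
  have : (0 : ℚ) < rankCount σ q n 3 := by
    refine pos_of_mul_pos_left hpos ?_
    positivity
  exact_mod_cast this

end Frequencies

/-! ### Zeros of a form with linear and constant terms -/

section Levels

variable {p : ℕ} [Fact p.Prime] {K : Type*} [Field K] [Fintype K] [DecidableEq K]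
  [Algebra (ZMod p) K] (σ : K ≃ₐ[ZMod p] K) {q n : ℕ} (a b : K)

/-- The number of zeros in `K` of `x ↦ Tr (x (a σ(x) + b σ³(x)) + β x) + c`. -/
noncomputable def zeroCount (c : ZMod p) (β : K) : ℕ :=
  (Finset.univ.filter fun x : K =>
    qform σ a b x + Algebra.trace (ZMod p) K (β * x) + c = 0).card

/-- Completing the square: the substitution `x ↦ x + y` absorbs the linear term. -/
lemma zeroCount_polar (c : ZMod p) (y : K) :
    zeroCount σ a b c (polar σ a b y) = levelCard σ a b (qform σ a b y - c) := by
  refine Finset.card_bij' (fun x _ => x + y) (fun x _ => x - y) ?_ ?_ ?_ ?_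
  · intro x hx
    simp only [Finset.mem_filter, Finset.mem_univ, true_and] at hx ⊢
    rw [qform_add, mul_comm x]
    linear_combination hx
  · intro x hx
    simp only [Finset.mem_filter, Finset.mem_univ, true_and] at hx ⊢
    have := qform_add σ a b (x - y) y
    rw [sub_add_cancel] at this
    rw [mul_comm]
    linear_combination hx - this
  · intro x _; simp
  · intro x _; simp

/-- The polar map is self-adjoint for the nondegenerate trace form, so its image is the orthogonal
complement of its kernel. -/
lemma exists_radical_trace_ne {β : K} (hβ : ∀ y, polar σ a b y ≠ β) :
    ∃ z, polar σ a b z = 0 ∧ Algebra.trace (ZMod p) K (β * z) ≠ 0 := by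
  have : FiniteDimensional (ZMod p) K := Module.Finite.of_finite
  have hnd := traceForm_nondegenerate (ZMod p) K
  have hoo := LinearMap.BilinForm.orthogonal_orthogonal hnd
    (Algebra.traceForm_isSymm (ZMod p) (S := K)).isRefl (LinearMap.range (polar σ a b))
  have h1 : β ∉ LinearMap.range (polar σ a b) := by
    rintro ⟨y, hy⟩
    exact hβ y hy
  rw [← hoo, LinearMap.BilinForm.mem_orthogonal_iff] at h1
  push Not at h1
  obtain ⟨z, hz, hzβ⟩ := h1
  refine ⟨z, ?_, ?_⟩
  · rw [LinearMap.BilinForm.mem_orthogonal_iff] at hz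
    refine hnd.1 _ fun y => ?_
    have h2 : Algebra.trace (ZMod p) K (polar σ a b y * z) = 0 := hz _ ⟨y, rfl⟩
    rw [Algebra.traceForm_apply, mul_comm, trace_mul_polar, mul_comm]
    exact h2
  · rw [mul_comm]
    exact hzβ

/-- Translation along a radical vector leaves Q unchanged but moves the linear term through all of
𝔽_p, so every constant yields equally many zeros. -/
lemma mul_zeroCount_of_forall_ne (hp : p ≠ 2) (c : ZMod p) {β : K}
    (hβ : ∀ y, polar σ a b y ≠ β) : p * zeroCount σ a b c β = Fintype.card K := by
  obtain ⟨z, hz, hzβ⟩ := exists_radical_trace_ne σ a b hβ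
  have key : ∀ d, zeroCount σ a b d β = zeroCount σ a b c β := by
    intro d
    set s : ZMod p := (d - c) / Algebra.trace (ZMod p) K (β * z) with hs
    have hs' : s * Algebra.trace (ZMod p) K (β * z) = d - c := div_mul_cancel₀ _ hzβ
    have hsz : polar σ a b (s • z) = 0 := by rw [map_smul, hz, smul_zero]
    have hshift : ∀ x, qform σ a b (x + s • z) + Algebra.trace (ZMod p) K (β * (x + s • z))
        = qform σ a b x + Algebra.trace (ZMod p) K (β * x) + (d - c) := by
      intro x
      rw [qform_add, hsz, qform_eq_zero_of_polar σ a b hp hsz, mul_zero, map_zero, mul_add, map_add,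
        mul_smul_comm, map_smul, smul_eq_mul, hs']
      ring
    refine Finset.card_bij' (fun x _ => x + s • z) (fun x _ => x - s • z) ?_ ?_ ?_ ?_
    · intro x hx
      simp only [Finset.mem_filter, Finset.mem_univ, true_and] at hx ⊢
      rw [hshift]
      linear_combination hx
    · intro x hx
      simp only [Finset.mem_filter, Finset.mem_univ, true_and] at hx ⊢
      have := hshift (x - s • z)
      rw [sub_add_cancel] at this
      linear_combination hx - this
    · intro x _; simp
    · intro x _; simp
  have hsum : ∑ d : ZMod p, zeroCount σ a b d β = Fintype.card K := by
    rw [← Finset.card_univ, Finset.card_eq_sum_card_fiberwise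
      (f := fun x => -(qform σ a b x + Algebra.trace (ZMod p) K (β * x))) (t := Finset.univ)]
    · refine Finset.sum_congr rfl fun d _ => ?_
      rw [zeroCount]
      congr 1
      ext x
      simp only [Finset.mem_filter, Finset.mem_univ, true_and]
      constructor
      · intro h; linear_combination -h
      · intro h; linear_combination -h
    · intro x _; simp
  rw [← hsum, Finset.sum_congr rfl fun d _ => key d, Finset.sum_const, Finset.card_univ, ZMod.card,
    smul_eq_mul]

/-- The deviation `p N - |K|` of the number `N` of zeros from its mean. -/
noncomputable def excess (c : ZMod p) (β : K) : ℤ :=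
  p * zeroCount σ a b c β - Fintype.card K

variable {σ} {a b}

lemma excess_of_level (h : IsHermitianFrobenius σ q) {c : ZMod p} {β : K}
    (hβ : ∃ y, polar σ a b y = β ∧ qform σ a b y = c) :
    excess σ a b c β = (p - 1) * charSum σ a b := by
  obtain ⟨y, rfl, rfl⟩ := hβ
  rw [excess, zeroCount_polar, sub_self, mul_levelCard_zero a b h]
  ring

lemma excess_of_off_level (h : IsHermitianFrobenius σ q) {c : ZMod p} {β : K}
    (hβ : ∃ y, polar σ a b y = β ∧ qform σ a b y ≠ c) :
    excess σ a b c β = - charSum σ a b := by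
  obtain ⟨y, rfl, hy⟩ := hβ
  rw [excess, zeroCount_polar, mul_levelCard_of_ne a b h (sub_ne_zero.2 hy)]
  ring

lemma excess_of_forall_ne (hp : p ≠ 2) {c : ZMod p} {β : K}
    (hβ : ∀ y, polar σ a b y ≠ β) : excess σ a b c β = 0 := by
  rw [excess, ← mul_zeroCount_of_forall_ne σ a b hp c hβ]
  push_cast
  ring

variable (σ a b) in
lemma level_trichotomy (c : ZMod p) (β : K) : (∃ y, polar σ a b y = β ∧ qform σ a b y = c) ∨
    (∃ y, polar σ a b y = β ∧ qform σ a b y ≠ c) ∨ ∀ y, polar σ a b y ≠ β := by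
  by_cases h : ∃ y, polar σ a b y = β
  · obtain ⟨y, hy⟩ := h
    by_cases hc : qform σ a b y = c
    · exact Or.inl ⟨y, hy, hc⟩
    · exact Or.inr (Or.inl ⟨y, hy, hc⟩)
  · push Not at h
    exact Or.inr (Or.inr h)

/-- Otherwise `p - 1` would be a power of `q`; it exceeds 1 because `p` is odd and is smaller than
`q`. So an on-level excess never equals an off-level one. -/
lemma neg_pow_ne (hp : p ≠ 2) (hq : 2 < q) (hpq : p ∣ q) (i j : ℕ) :
    -(-(q : ℤ)) ^ i ≠ (p - 1) * (-(q : ℤ)) ^ j := by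
  intro he
  have hp2 := (Fact.out : p.Prime).two_le
  have h1 := congrArg Int.natAbs he
  have h2 : ((p : ℤ) - 1).natAbs = p - 1 := by omega
  rw [Int.natAbs_neg, Int.natAbs_mul, Int.natAbs_pow, Int.natAbs_pow, Int.natAbs_neg,
    Int.natAbs_natCast, h2] at h1
  have hle : p ≤ q := Nat.le_of_dvd (by omega) hpq
  have hpos : 0 < q ^ j := by positivity
  have hlt : j < i := by
    refine (Nat.pow_lt_pow_iff_right (a := q) (by omega)).1 ?_
    rw [h1]
    exact lt_mul_of_one_lt_left hpos (by omega)
  obtain ⟨k, rfl⟩ := Nat.exists_eq_add_of_lt hlt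
  rw [show j + k + 1 = (k + 1) + j by ring, pow_add] at h1
  have h3 := Nat.eq_of_mul_eq_mul_right hpos h1
  have h4 : q ≤ q ^ (k + 1) := Nat.le_self_pow (by omega) q
  omega

lemma exists_charSum_eq_pow (h : IsHermitianFrobenius σ q) (hp : p ≠ 2)
    (hK : Fintype.card K = q ^ (2 * n)) (a b : K) :
    ∃ j, n ≤ j ∧ charSum σ a b = (-(q : ℤ)) ^ j := by
  by_cases hab : (a, b) = 0
  · have ha : a = 0 := congrArg Prod.fst hab
    have hb : b = 0 := congrArg Prod.snd hab
    exact ⟨2 * n, by omega, by rw [ha, hb]; exact charSum_zero hK⟩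
  · obtain ⟨i, hi⟩ := exists_charSum_eq h hp hK hab
    exact ⟨n + i, by omega, hi⟩

lemma excess_eq_zero_iff (h : IsHermitianFrobenius σ q) (hp : p ≠ 2)
    (hK : Fintype.card K = q ^ (2 * n)) (c : ZMod p) (β : K) :
    excess σ a b c β = 0 ↔ ∀ y, polar σ a b y ≠ β := by
  refine ⟨fun he => ?_, excess_of_forall_ne hp⟩
  obtain ⟨j, -, hj⟩ := exists_charSum_eq_pow h hp hK a b
  have hq := h.two_lt
  have hS : charSum σ a b ≠ 0 := by rw [hj]; exact pow_ne_zero _ (by omega)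
  have hp2 := (Fact.out : p.Prime).two_le
  rcases level_trichotomy σ a b c β with h1 | h1 | h1
  · rw [excess_of_level h h1] at he
    exact absurd he (mul_ne_zero (by omega) hS)
  · rw [excess_of_off_level h h1] at he
    exact absurd he (neg_ne_zero.2 hS)
  · exact h1

lemma excess_eq_level_iff (h : IsHermitianFrobenius σ q) (hp : p ≠ 2) (hpq : p ∣ q)
    (hK : Fintype.card K = q ^ (2 * n)) (c : ZMod p) (β : K) (i : ℕ) :
    excess σ a b c β = (p - 1) * (-(q : ℤ)) ^ i ↔
      charSum σ a b = (-(q : ℤ)) ^ i ∧ ∃ y, polar σ a b y = β ∧ qform σ a b y = c := by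
  have hq := h.two_lt
  have hp2 := (Fact.out : p.Prime).two_le
  refine ⟨fun he => ?_, fun ⟨h1, h2⟩ => by rw [excess_of_level h h2, h1]⟩
  rcases level_trichotomy σ a b c β with h1 | h1 | h1
  · rw [excess_of_level h h1] at he
    exact ⟨mul_left_cancel₀ (by omega) he, h1⟩
  · obtain ⟨j, -, hj⟩ := exists_charSum_eq_pow h hp hK a b
    rw [excess_of_off_level h h1, hj] at he
    exact absurd he (neg_pow_ne hp hq hpq j i)
  · rw [excess_of_forall_ne hp h1] at he
    exact absurd he.symm (mul_ne_zero (by omega) (pow_ne_zero _ (by omega)))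

lemma excess_eq_off_level_iff (h : IsHermitianFrobenius σ q) (hp : p ≠ 2) (hpq : p ∣ q)
    (hK : Fintype.card K = q ^ (2 * n)) (c : ZMod p) (β : K) (i : ℕ) :
    excess σ a b c β = -(-(q : ℤ)) ^ i ↔
      charSum σ a b = (-(q : ℤ)) ^ i ∧ ∃ y, polar σ a b y = β ∧ qform σ a b y ≠ c := by
  have hq := h.two_lt
  refine ⟨fun he => ?_, fun ⟨h1, h2⟩ => by rw [excess_of_off_level h h2, h1]⟩
  rcases level_trichotomy σ a b c β with h1 | h1 | h1
  · obtain ⟨j, -, hj⟩ := exists_charSum_eq_pow h hp hK a b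
    rw [excess_of_level h h1, hj] at he
    exact absurd he.symm (neg_pow_ne hp hq hpq i j)
  · rw [excess_of_off_level h h1] at he
    exact ⟨neg_injective he, h1⟩
  · rw [excess_of_forall_ne hp h1] at he
    exact absurd he.symm (neg_ne_zero.2 (pow_ne_zero _ (by omega)))

lemma sq_dvd_excess (h : IsHermitianFrobenius σ q) (hp : p ≠ 2) (hpq : p ∣ q)
    (hK : Fintype.card K = q ^ (2 * n)) (hn : 4 ≤ n) (c : ZMod p) (β : K) :
    (p : ℤ) ^ 2 ∣ excess σ a b c β := by
  obtain ⟨j, hnj, hj⟩ := exists_charSum_eq_pow h hp hK a b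
  have hd : (p : ℤ) ^ 2 ∣ charSum σ a b := by
    rw [hj]
    have h1 : (p : ℤ) ∣ -(q : ℤ) := (dvd_neg).2 (by exact_mod_cast hpq)
    exact (pow_dvd_pow_of_dvd h1 2).trans (pow_dvd_pow _ (by omega))
  rcases level_trichotomy σ a b c β with h1 | h1 | h1
  · rw [excess_of_level h h1]; exact hd.mul_left _
  · rw [excess_of_off_level h h1]; exact (dvd_neg).2 hd
  · rw [excess_of_forall_ne hp h1]; exact dvd_zero _

/-- Counting linear terms `β` in the image of `polar` by their preimages. -/
lemma radCard_mul_card_image (P : K → Prop) [DecidablePred P]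
    (hP : ∀ x y, polar σ a b x = polar σ a b y → P x → P y) :
    radCard σ a b * (Finset.univ.filter fun β => ∃ y, polar σ a b y = β ∧ P y).card =
      (Finset.univ.filter P).card := by
  have himg : (Finset.univ.filter fun β => ∃ y, polar σ a b y = β ∧ P y) =
      (Finset.univ.filter P).image (polar σ a b) := by
    ext β
    simp only [Finset.mem_filter, Finset.mem_univ, true_and, Finset.mem_image]
    exact exists_congr fun y => and_comm
  rw [himg, Finset.card_eq_sum_card_image (polar σ a b) (Finset.univ.filter P), mul_comm]
  rw [Finset.sum_congr rfl (g := fun _ => radCard σ a b), Finset.sum_const, smul_eq_mul]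
  -- Each fibre of `polar` is a coset of the radical, and `hP` makes `P` constant on it.
  intro β hβ
  obtain ⟨y, hy, rfl⟩ := Finset.mem_image.1 hβ
  simp only [Finset.mem_filter, Finset.mem_univ, true_and] at hy
  refine Finset.card_bij' (fun x _ => x - y) (fun z _ => z + y) ?_ ?_ ?_ ?_
  · intro x hx
    simp only [Finset.mem_filter, Finset.mem_univ, true_and] at hx ⊢
    rw [map_sub, hx.2, sub_self]
  · intro z hz
    simp only [Finset.mem_filter, Finset.mem_univ, true_and] at hz ⊢
    have : polar σ a b (z + y) = polar σ a b y := by rw [map_add, hz, zero_add]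
    exact ⟨hP _ _ this.symm hy, this⟩
  · intro x _; simp
  · intro x _; simp

lemma qform_eq_of_polar_eq (hp : p ≠ 2) {x y : K} (hxy : polar σ a b x = polar σ a b y) :
    qform σ a b x = qform σ a b y := by
  have hz : polar σ a b (x - y) = 0 := by rw [map_sub, hxy, sub_self]
  have h1 := qform_add σ a b y (x - y)
  rw [add_sub_cancel, hz, qform_eq_zero_of_polar σ a b hp hz] at h1
  simpa using h1

lemma radCard_pos : 0 < radCard σ a b := Finset.card_pos.2 ⟨0, by simp⟩

lemma card_level (hp : p ≠ 2) (c : ZMod p) :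
    ((Finset.univ.filter fun β => ∃ y, polar σ a b y = β ∧ qform σ a b y = c).card : ℚ) =
      levelCard σ a b c / radCard σ a b := by
  have h1 := radCard_mul_card_image (σ := σ) (a := a) (b := b) (fun y => qform σ a b y = c)
    (fun x y hxy hx => by rw [← qform_eq_of_polar_eq hp hxy, hx])
  rw [eq_div_iff (by exact_mod_cast radCard_pos.ne'), mul_comm]
  exact_mod_cast h1

lemma card_off_level (hp : p ≠ 2) (c : ZMod p) :
    ((Finset.univ.filter fun β => ∃ y, polar σ a b y = β ∧ qform σ a b y ≠ c).card : ℚ) =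
      (Fintype.card K - levelCard σ a b c) / radCard σ a b := by
  have h1 := radCard_mul_card_image (σ := σ) (a := a) (b := b) (fun y => qform σ a b y ≠ c)
    (fun x y hxy hx => by rw [← qform_eq_of_polar_eq hp hxy]; exact hx)
  have h2 : levelCard σ a b c + (Finset.univ.filter fun y => qform σ a b y ≠ c).card =
      Fintype.card K := by
    rw [levelCard, Finset.card_filter_add_card_filter_not, Finset.card_univ]
  rw [eq_div_iff (by exact_mod_cast radCard_pos.ne'), mul_comm, ← h2]
  push_cast
  rw [add_sub_cancel_left]
  exact_mod_cast h1

lemma card_not_image :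
    ((Finset.univ.filter fun β => ∀ y, polar σ a b y ≠ β).card : ℚ) =
      Fintype.card K - Fintype.card K / radCard σ a b := by
  have h1 := radCard_mul_card_image (σ := σ) (a := a) (b := b) (fun _ => True)
    (fun x y hxy hx => trivial)
  have h2 : (Finset.univ.filter fun β => ∃ y, polar σ a b y = β ∧ True).card +
      (Finset.univ.filter fun β => ∀ y, polar σ a b y ≠ β).card = Fintype.card K := by
    rw [← Finset.card_univ]
    refine Eq.trans ?_ (Finset.card_filter_add_card_filter_not (s := Finset.univ)
      (p := fun β => ∃ y, polar σ a b y = β ∧ True))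
    refine congrArg₂ _ rfl (congrArg Finset.card ?_)
    ext β
    simp
  rw [Finset.filter_true, Finset.card_univ] at h1
  have hr : (radCard σ a b : ℚ) ≠ 0 := by exact_mod_cast radCard_pos.ne'
  have h3 : (Fintype.card K : ℚ) / radCard σ a b =
      (Finset.univ.filter fun β => ∃ y, polar σ a b y = β ∧ True).card := by
    rw [div_eq_iff hr, mul_comm]
    exact_mod_cast h1.symm
  rw [h3, eq_sub_iff_add_eq, add_comm]
  exact_mod_cast h2

end Levels

/-! ### Codewords, their weights and the frequencies -/

section Words

variable {p : ℕ} [Fact p.Prime] {K : Type*} [Field K] [Fintype K] [DecidableEq K]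
  [Algebra (ZMod p) K] (σ : K ≃ₐ[ZMod p] K) {q n : ℕ}

/-- The linear map sending `((a, b), c, β)` to the word
`(Tr (x (a σ(x) + b σ³(x)) + β x) + c)_{x ∈ Kˣ}`. -/
noncomputable def wordMap : ((K × K) × ZMod p × K) →ₗ[ZMod p] (Kˣ → ZMod p) where
  toFun w x := qform σ w.1.1 w.1.2 x + Algebra.trace (ZMod p) K (w.2.2 * x) + w.2.1
  map_add' v w := by
    funext x
    simp only [qform, form, Prod.fst_add, Prod.snd_add, add_mul, mul_add, map_add, Pi.add_apply]
    ring
  map_smul' r w := by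
    funext x
    simp only [qform, form, Prod.smul_fst, Prod.smul_snd, smul_mul_assoc, ← smul_add, map_smul,
      mul_smul_comm, Pi.smul_apply, RingHom.id_apply, smul_eq_mul, mul_add]

/-- The words with `β = 0`. -/
noncomputable def wordMap₀ : ((K × K) × ZMod p) →ₗ[ZMod p] (Kˣ → ZMod p) where
  toFun w := wordMap σ (w.1, w.2, 0)
  map_add' v w := by rw [← map_add]; simp
  map_smul' r w := by rw [← map_smul]; simp

lemma wordMap_apply (w : (K × K) × ZMod p × K) (x : Kˣ) : wordMap σ w x =
    qform σ w.1.1 w.1.2 x + Algebra.trace (ZMod p) K (w.2.2 * x) + w.2.1 := rfl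

lemma wordMap₀_apply (w : (K × K) × ZMod p) : wordMap₀ σ w = wordMap σ (w.1, w.2, 0) := rfl

/-- The coordinates omit `x = 0`, where the function takes the value `c`; this costs one nonzero
coordinate exactly when `c ≠ 0`. -/
lemma hammingNorm_wordMap (w : (K × K) × ZMod p × K) :
    (hammingNorm (wordMap σ w) : ℤ) =
      Fintype.card K - zeroCount σ w.1.1 w.1.2 w.2.1 w.2.2 - if w.2.1 = 0 then 0 else 1 := by
  set f : K → ZMod p := fun x =>
    qform σ w.1.1 w.1.2 x + Algebra.trace (ZMod p) K (w.2.2 * x) + w.2.1 with hf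
  have hf0 : f 0 = w.2.1 := by simp [hf, qform_zero]
  have h1 : hammingNorm (wordMap σ w) = ((Finset.univ.filter fun x : K => f x ≠ 0).erase 0).card := by
    refine Finset.card_bij (fun x _ => (x : K)) ?_ ?_ ?_
    · intro x hx
      simp only [Finset.mem_filter, Finset.mem_univ, true_and] at hx
      simpa [hf, wordMap_apply] using hx
    · intro x _ y _ hxy
      exact Units.ext hxy
    · intro x hx
      simp only [Finset.mem_erase, Finset.mem_filter, Finset.mem_univ, true_and] at hx
      refine ⟨Units.mk0 x hx.1, ?_, rfl⟩
      simp only [Finset.mem_filter, Finset.mem_univ, true_and]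
      exact hx.2
  have h2 : zeroCount σ w.1.1 w.1.2 w.2.1 w.2.2 + (Finset.univ.filter fun x : K => f x ≠ 0).card =
      Fintype.card K := by
    rw [zeroCount, Finset.card_filter_add_card_filter_not, Finset.card_univ]
  rw [h1, ← h2]
  split_ifs with hc
  · rw [Finset.erase_eq_of_notMem (by simp [hf0, hc])]
    push_cast
    ring
  · have hmem : (0 : K) ∈ Finset.univ.filter fun x : K => f x ≠ 0 := by simp [hf0, hc]
    rw [← Finset.card_erase_add_one hmem]
    push_cast
    ring

lemma mul_hammingNorm_wordMap (w : (K × K) × ZMod p × K) :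
    (p : ℤ) * hammingNorm (wordMap σ w) = (p - 1) * Fintype.card K
      - excess σ w.1.1 w.1.2 w.2.1 w.2.2 - if w.2.1 = 0 then 0 else (p : ℤ) := by
  rw [hammingNorm_wordMap, excess]
  split_ifs <;> ring

variable {σ}

/-- Both excesses are divisible by `p²`, whereas a nonzero constant term changes `p` times the
weight by `p`. The two cases therefore cannot share a weight. -/
lemma hammingNorm_eq_iff_of_dvd (h : IsHermitianFrobenius σ q) (hp : p ≠ 2) (hpq : p ∣ q)
    (hK : Fintype.card K = q ^ (2 * n)) (hn : 4 ≤ n) {e ω : ℤ} (he : (p : ℤ) ^ 2 ∣ e)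
    (hω : p * ω = (p - 1) * Fintype.card K - e) (w : (K × K) × ZMod p × K) :
    (hammingNorm (wordMap σ w) : ℤ) = ω ↔
      w.2.1 = 0 ∧ excess σ w.1.1 w.1.2 w.2.1 w.2.2 = e := by
  have hp0 : (p : ℤ) ≠ 0 := by exact_mod_cast (Fact.out : p.Prime).ne_zero
  have hp2 := (Fact.out : p.Prime).two_le
  have hd := sq_dvd_excess h hp hpq hK hn (a := w.1.1) (b := w.1.2) w.2.1 w.2.2
  have hN := mul_hammingNorm_wordMap σ w
  constructor
  · intro heq
    rw [heq, hω] at hN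
    split_ifs at hN with hc
    · exact ⟨hc, by linarith⟩
    · exfalso
      have h1 : (p : ℤ) ^ 2 ∣ p := by
        have h2 : (p : ℤ) = e - excess σ w.1.1 w.1.2 w.2.1 w.2.2 := by linarith
        rw [h2]
        nth_rw 1 [← h2]
        exact dvd_sub he hd
      have := Int.le_of_dvd (by omega) h1
      nlinarith
  · rintro ⟨hc, hex⟩
    rw [if_pos hc, hex, sub_zero, ← hω] at hN
    exact mul_left_cancel₀ hp0 hN

lemma hammingNorm_eq_iff_of_dvd' (h : IsHermitianFrobenius σ q) (hp : p ≠ 2) (hpq : p ∣ q)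
    (hK : Fintype.card K = q ^ (2 * n)) (hn : 4 ≤ n) {e ω : ℤ} (he : (p : ℤ) ^ 2 ∣ e)
    (hω : p * ω = (p - 1) * Fintype.card K - e - p) (w : (K × K) × ZMod p × K) :
    (hammingNorm (wordMap σ w) : ℤ) = ω ↔
      w.2.1 ≠ 0 ∧ excess σ w.1.1 w.1.2 w.2.1 w.2.2 = e := by
  have hp0 : (p : ℤ) ≠ 0 := by exact_mod_cast (Fact.out : p.Prime).ne_zero
  have hp2 := (Fact.out : p.Prime).two_le
  have hd := sq_dvd_excess h hp hpq hK hn (a := w.1.1) (b := w.1.2) w.2.1 w.2.2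
  have hN := mul_hammingNorm_wordMap σ w
  constructor
  · intro heq
    rw [heq, hω] at hN
    split_ifs at hN with hc
    · exfalso
      have h1 : (p : ℤ) ^ 2 ∣ p := by
        have h2 : (p : ℤ) = excess σ w.1.1 w.1.2 w.2.1 w.2.2 - e := by linarith
        rw [h2]
        nth_rw 1 [← h2]
        exact dvd_sub hd he
      have := Int.le_of_dvd (by omega) h1
      nlinarith
    · exact ⟨hc, by linarith⟩
  · rintro ⟨hc, hex⟩
    rw [if_neg hc, hex, ← hω] at hN
    exact mul_left_cancel₀ hp0 hN

lemma sq_dvd_pow (hpq : p ∣ q) {i : ℕ} (hi : 2 ≤ i) : (p : ℤ) ^ 2 ∣ (-(q : ℤ)) ^ i := by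
  have h1 : (p : ℤ) ∣ -(q : ℤ) := (dvd_neg).2 (by exact_mod_cast hpq)
  exact (pow_dvd_pow_of_dvd h1 2).trans (pow_dvd_pow _ hi)

lemma neg_pow_top (hK : Fintype.card K = q ^ (2 * n)) :
    (-(q : ℤ)) ^ (n + n) = Fintype.card K := by
  rw [hK, Even.neg_pow ⟨n, rfl⟩, two_mul]
  push_cast
  rfl

lemma charSum_eq_top_iff (h : IsHermitianFrobenius σ q) (hp : p ≠ 2)
    (hK : Fintype.card K = q ^ (2 * n)) (hn : 4 ≤ n) (u : K × K) :
    charSum σ u.1 u.2 = (-(q : ℤ)) ^ (n + n) ↔ u = 0 := by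
  constructor
  · intro hu
    by_contra h0
    obtain ⟨i, hi⟩ := exists_charSum_eq h hp hK (a := u.1) (b := u.2) h0
    have := neg_pow_injective h.two_lt (hu.symm.trans hi)
    omega
  · rintro rfl
    rw [← two_mul]
    exact charSum_zero hK

lemma polar_zero (z : K) : polar σ 0 0 z = 0 := by simp [polar_apply]

/-- Weight zero is the on-level case with exponent `n + n`. That value of S forces the form to
vanish, and then `polar = 0` forces `β = 0`. -/
lemma wordMap_injective (h : IsHermitianFrobenius σ q) (hp : p ≠ 2) (hpq : p ∣ q)
    (hK : Fintype.card K = q ^ (2 * n)) (hn : 4 ≤ n) : Function.Injective (wordMap σ) := by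
  rw [injective_iff_map_eq_zero]
  rintro w hw
  have h1 : (hammingNorm (wordMap σ w) : ℤ) = 0 := by rw [hw]; simp
  rw [hammingNorm_eq_iff_of_dvd h hp hpq hK hn (e := (p - 1) * (-(q : ℤ)) ^ (n + n))
    ((sq_dvd_pow hpq (by omega)).mul_left _)
    (by rw [neg_pow_top hK]; ring),
    excess_eq_level_iff h hp hpq hK, charSum_eq_top_iff h hp hK hn] at h1
  obtain ⟨hc, hu, y, hy, -⟩ := h1
  obtain ⟨u, c, β⟩ := w
  simp only at hc hu hy
  subst hu hc
  rw [← hy]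
  simp only [Prod.fst_zero, Prod.snd_zero, polar_zero]
  rfl

lemma wordMap₀_injective (h : IsHermitianFrobenius σ q) (hp : p ≠ 2) (hpq : p ∣ q)
    (hK : Fintype.card K = q ^ (2 * n)) (hn : 4 ≤ n) : Function.Injective (wordMap₀ σ) := by
  intro v w hvw
  have := wordMap_injective h hp hpq hK hn hvw
  simp only [Prod.mk.injEq, and_true] at this
  exact Prod.ext this.1 this.2

lemma weightFreq_range {F V ι : Type*} [Field F] [DecidableEq F] [Fintype ι] [AddCommGroup V]
    [Module F V] [Fintype V] {Φ : V →ₗ[F] (ι → F)} (hΦ : Function.Injective Φ) {ω : ℤ}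
    (P : V → Prop) [DecidablePred P] (hP : ∀ v, (hammingNorm (Φ v) : ℤ) = ω ↔ P v) :
    weightFreq (LinearMap.range Φ) ω = (Finset.univ.filter P).card := by
  rw [weightFreq, ← Set.ncard_coe_finset, ← Set.ncard_image_of_injective _ hΦ]
  congr 1
  ext c
  simp only [LinearMap.mem_range, Set.mem_ofPred_eq, Finset.coe_filter, Finset.mem_univ, true_and,
    Set.mem_image]
  constructor
  · rintro ⟨⟨v, rfl⟩, hv⟩
    exact ⟨v, (hP v).1 hv, rfl⟩
  · rintro ⟨v, hv, rfl⟩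
    exact ⟨⟨v, rfl⟩, (hP v).2 hv⟩

lemma card_params (f : K × K → Prop) [DecidablePred f] (C : ZMod p → Prop) [DecidablePred C]
    (P : K × K → ZMod p → K → Prop) [∀ u c, DecidablePred (P u c)] (M : K × K → ℚ)
    (hM : ∀ u c, f u → C c → ((Finset.univ.filter (P u c)).card : ℚ) = M u) :
    ((Finset.univ.filter fun w : (K × K) × ZMod p × K =>
      C w.2.1 ∧ f w.1 ∧ P w.1 w.2.1 w.2.2).card : ℚ) =
      (Finset.univ.filter C).card * ∑ u ∈ Finset.univ.filter f, M u := by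
  rw [Finset.card_filter, Fintype.sum_prod_type, Finset.sum_filter, Finset.mul_sum]
  push_cast
  refine Finset.sum_congr rfl fun u _ => ?_
  rw [Fintype.sum_prod_type, Finset.card_filter]
  push_cast
  rw [Finset.sum_mul]
  refine Finset.sum_congr rfl fun c _ => ?_
  by_cases hc : C c
  · by_cases hu : f u
    · simp only [hc, hu, true_and, if_true, one_mul]
      rw [← hM u c hu hc, Finset.card_filter]
      push_cast
      rfl
    · simp [hu]
  · simp [hc]

lemma card_filter_eq_zero : (Finset.univ.filter fun c : ZMod p => c = 0).card = 1 := by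
  simp [Finset.filter_eq']

lemma card_filter_ne_zero : ((Finset.univ.filter fun c : ZMod p => c ≠ 0).card : ℚ) = p - 1 := by
  have h1 : 1 ≤ p := (Fact.out : p.Prime).one_le
  rw [Finset.filter_ne', Finset.card_erase_of_mem (Finset.mem_univ _), Finset.card_univ, ZMod.card]
  push_cast [h1]
  rfl

variable (σ) in
/-- The number of pairs `(a, b)` with exponential sum `s`. -/
noncomputable def sumCount (s : ℤ) : ℕ :=
  (Finset.univ.filter fun u : K × K => charSum σ u.1 u.2 = s).card

section Counts

variable {ω : ℤ} {i : ℕ}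

/-- The number of suitable `β` is a level size divided by the size of the radical. The index `i` is
any natural number: `i = n` is the zero form, so the exceptional weights `0` and `p ^ m - 1` need no
separate argument. -/
lemma weightFreq_level (h : IsHermitianFrobenius σ q) (hp : p ≠ 2) (hpq : p ∣ q)
    (hK : Fintype.card K = q ^ (2 * n)) (hn : 4 ≤ n)
    (hω : p * ω = (p - 1) * Fintype.card K - (p - 1) * (-(q : ℤ)) ^ (n + i)) :
    (weightFreq (LinearMap.range (wordMap σ)) ω : ℚ) = sumCount σ ((-(q : ℤ)) ^ (n + i)) *
      (((Fintype.card K : ℚ) + (p - 1) * (-(q : ℚ)) ^ (n + i)) / (p * q ^ (2 * i))) := by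
  have hp0 : (p : ℚ) ≠ 0 := by exact_mod_cast (Fact.out : p.Prime).ne_zero
  rw [weightFreq_range (wordMap_injective h hp hpq hK hn) _ fun w => by
    rw [hammingNorm_eq_iff_of_dvd h hp hpq hK hn ((sq_dvd_pow hpq (by omega)).mul_left _) hω,
      excess_eq_level_iff h hp hpq hK],
    card_params (fun u => charSum σ u.1 u.2 = (-(q : ℤ)) ^ (n + i)) (fun c => c = 0)
      (fun u c β => ∃ y, polar σ u.1 u.2 y = β ∧ qform σ u.1 u.2 y = c)
      (fun _ => ((Fintype.card K : ℚ) + (p - 1) * (-(q : ℚ)) ^ (n + i)) / (p * q ^ (2 * i)))]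
  · rw [card_filter_eq_zero, Finset.sum_const, nsmul_eq_mul, Nat.cast_one, one_mul, sumCount]
  · rintro u c hu rfl
    have h1 := congrArg (Int.cast (R := ℚ)) (mul_levelCard_zero u.1 u.2 h)
    rw [hu] at h1
    push_cast at h1
    rw [card_level hp, radCard_of_charSum h hp hK hu, ← h1]
    push_cast
    rw [mul_div_mul_left _ _ hp0]

lemma weightFreq_level' (h : IsHermitianFrobenius σ q) (hp : p ≠ 2) (hpq : p ∣ q)
    (hK : Fintype.card K = q ^ (2 * n)) (hn : 4 ≤ n)
    (hω : p * ω = (p - 1) * Fintype.card K - (p - 1) * (-(q : ℤ)) ^ (n + i) - p) :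
    (weightFreq (LinearMap.range (wordMap σ)) ω : ℚ) = (p - 1) * sumCount σ ((-(q : ℤ)) ^ (n + i)) *
      (((Fintype.card K : ℚ) - (-(q : ℚ)) ^ (n + i)) / (p * q ^ (2 * i))) := by
  have hp0 : (p : ℚ) ≠ 0 := by exact_mod_cast (Fact.out : p.Prime).ne_zero
  rw [weightFreq_range (wordMap_injective h hp hpq hK hn) _ fun w => by
    rw [hammingNorm_eq_iff_of_dvd' h hp hpq hK hn ((sq_dvd_pow hpq (by omega)).mul_left _) hω,
      excess_eq_level_iff h hp hpq hK],
    card_params (fun u => charSum σ u.1 u.2 = (-(q : ℤ)) ^ (n + i)) (fun c => c ≠ 0)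
      (fun u c β => ∃ y, polar σ u.1 u.2 y = β ∧ qform σ u.1 u.2 y = c)
      (fun _ => ((Fintype.card K : ℚ) - (-(q : ℚ)) ^ (n + i)) / (p * q ^ (2 * i)))]
  · rw [card_filter_ne_zero, Finset.sum_const, nsmul_eq_mul, sumCount, mul_assoc]
  · rintro u c hu hc
    have h1 := congrArg (Int.cast (R := ℚ)) (mul_levelCard_of_ne u.1 u.2 h hc)
    rw [hu] at h1
    push_cast at h1
    rw [card_level hp, radCard_of_charSum h hp hK hu, ← h1]
    push_cast
    rw [mul_div_mul_left _ _ hp0]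

lemma weightFreq_off_level (h : IsHermitianFrobenius σ q) (hp : p ≠ 2) (hpq : p ∣ q)
    (hK : Fintype.card K = q ^ (2 * n)) (hn : 4 ≤ n)
    (hω : p * ω = (p - 1) * Fintype.card K - -(-(q : ℤ)) ^ (n + i)) :
    (weightFreq (LinearMap.range (wordMap σ)) ω : ℚ) = sumCount σ ((-(q : ℤ)) ^ (n + i)) *
      ((p - 1) * ((Fintype.card K : ℚ) - (-(q : ℚ)) ^ (n + i)) / (p * q ^ (2 * i))) := by
  have hp0 : (p : ℚ) ≠ 0 := by exact_mod_cast (Fact.out : p.Prime).ne_zero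
  rw [weightFreq_range (wordMap_injective h hp hpq hK hn) _ fun w => by
    rw [hammingNorm_eq_iff_of_dvd h hp hpq hK hn ((dvd_neg).2 (sq_dvd_pow hpq (by omega))) hω,
      excess_eq_off_level_iff h hp hpq hK],
    card_params (fun u => charSum σ u.1 u.2 = (-(q : ℤ)) ^ (n + i)) (fun c => c = 0)
      (fun u c β => ∃ y, polar σ u.1 u.2 y = β ∧ qform σ u.1 u.2 y ≠ c)
      (fun _ => (p - 1) * ((Fintype.card K : ℚ) - (-(q : ℚ)) ^ (n + i)) / (p * q ^ (2 * i)))]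
  · rw [card_filter_eq_zero, Finset.sum_const, nsmul_eq_mul, Nat.cast_one, one_mul, sumCount]
  · rintro u c hu rfl
    have h1 := congrArg (Int.cast (R := ℚ)) (mul_levelCard_zero u.1 u.2 h)
    rw [hu] at h1
    push_cast at h1
    rw [card_off_level hp, radCard_of_charSum h hp hK hu, ← mul_div_mul_left _ _ hp0, mul_sub, h1]
    push_cast
    congr 1
    ring

lemma weightFreq_off_level' (h : IsHermitianFrobenius σ q) (hp : p ≠ 2) (hpq : p ∣ q)
    (hK : Fintype.card K = q ^ (2 * n)) (hn : 4 ≤ n)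
    (hω : p * ω = (p - 1) * Fintype.card K - -(-(q : ℤ)) ^ (n + i) - p) :
    (weightFreq (LinearMap.range (wordMap σ)) ω : ℚ) = (p - 1) * sumCount σ ((-(q : ℤ)) ^ (n + i)) *
      (((p - 1) * (Fintype.card K : ℚ) + (-(q : ℚ)) ^ (n + i)) / (p * q ^ (2 * i))) := by
  have hp0 : (p : ℚ) ≠ 0 := by exact_mod_cast (Fact.out : p.Prime).ne_zero
  rw [weightFreq_range (wordMap_injective h hp hpq hK hn) _ fun w => by
    rw [hammingNorm_eq_iff_of_dvd' h hp hpq hK hn ((dvd_neg).2 (sq_dvd_pow hpq (by omega))) hω,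
      excess_eq_off_level_iff h hp hpq hK],
    card_params (fun u => charSum σ u.1 u.2 = (-(q : ℤ)) ^ (n + i)) (fun c => c ≠ 0)
      (fun u c β => ∃ y, polar σ u.1 u.2 y = β ∧ qform σ u.1 u.2 y ≠ c)
      (fun _ => ((p - 1) * (Fintype.card K : ℚ) + (-(q : ℚ)) ^ (n + i)) / (p * q ^ (2 * i)))]
  · rw [card_filter_ne_zero, Finset.sum_const, nsmul_eq_mul, sumCount, mul_assoc]
  · rintro u c hu hc
    have h1 := congrArg (Int.cast (R := ℚ)) (mul_levelCard_of_ne u.1 u.2 h hc)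
    rw [hu] at h1
    push_cast at h1
    rw [card_off_level hp, radCard_of_charSum h hp hK hu, ← mul_div_mul_left _ _ hp0, mul_sub, h1]
    push_cast
    congr 1
    ring

lemma sum_card_not_image (h : IsHermitianFrobenius σ q) (hp : p ≠ 2)
    (hK : Fintype.card K = q ^ (2 * n)) (hn : 4 ≤ n) :
    ∑ u : K × K, ((Fintype.card K : ℚ) - Fintype.card K / radCard σ u.1 u.2) =
      Fintype.card K - 1 + ∑ i : Fin 4, (rankCount σ q n i : ℚ) *
        (Fintype.card K - Fintype.card K / q ^ (2 * (i : ℕ))) := by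
  have hq := h.two_lt
  have hq0 : (q : ℚ) ≠ 0 := by exact_mod_cast (by omega : q ≠ 0)
  -- By `charSum_sq` the size of the image of `polar` is a function of S alone, so the sum over
  -- pairs reduces to the rank counts.
  have hr : ∀ u : K × K, (Fintype.card K : ℚ) / radCard σ u.1 u.2 =
      Fintype.card K ^ 2 / (charSum σ u.1 u.2 : ℚ) ^ 2 := by
    intro u
    have h1 := congrArg (Int.cast (R := ℚ)) (charSum_sq u.1 u.2 h hp)
    push_cast at h1
    have hk : (Fintype.card K : ℚ) ≠ 0 := by exact_mod_cast Fintype.card_ne_zero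
    rw [h1, pow_two, mul_div_mul_left _ _ hk]
  simp only [hr]
  rw [sum_eq_sum_rankCount h hp hK hn
    (fun x => (Fintype.card K : ℚ) - (Fintype.card K : ℚ) ^ 2 / (x : ℚ) ^ 2)]
  congr 1
  · have : (((-(q : ℤ)) ^ (2 * n) : ℤ) : ℚ) = Fintype.card K := by
      rw [hK, pow_mul, neg_sq, ← pow_mul]; push_cast; rfl
    have hk : (Fintype.card K : ℚ) ≠ 0 := by exact_mod_cast Fintype.card_ne_zero
    rw [this, div_self (pow_ne_zero _ hk)]
  · refine Finset.sum_congr rfl fun i _ => ?_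
    congr 2
    have e1 : (((-(q : ℤ)) ^ (n + (i : ℕ)) : ℤ) : ℚ) ^ 2 = q ^ (2 * n) * q ^ (2 * (i : ℕ)) := by
      push_cast
      rw [← pow_mul, mul_comm, pow_mul, neg_sq, ← pow_mul, mul_add, pow_add]
    rw [e1, hK]
    push_cast
    rw [pow_two, mul_div_mul_left _ _ (pow_ne_zero _ hq0)]

lemma weightFreq_not_image (h : IsHermitianFrobenius σ q) (hp : p ≠ 2) (hpq : p ∣ q)
    (hK : Fintype.card K = q ^ (2 * n)) (hn : 4 ≤ n)
    (hω : p * ω = (p - 1) * Fintype.card K - 0) :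
    (weightFreq (LinearMap.range (wordMap σ)) ω : ℚ) =
      Fintype.card K - 1 + ∑ i : Fin 4, (rankCount σ q n i : ℚ) *
        (Fintype.card K - Fintype.card K / q ^ (2 * (i : ℕ))) := by
  rw [weightFreq_range (wordMap_injective h hp hpq hK hn)
    (fun w => w.2.1 = 0 ∧ True ∧ ∀ y, polar σ w.1.1 w.1.2 y ≠ w.2.2) fun w => by
      rw [hammingNorm_eq_iff_of_dvd h hp hpq hK hn (dvd_zero _) hω, excess_eq_zero_iff h hp hK,
        true_and],
    card_params (fun _ => True) (fun c => c = 0) (fun u c β => ∀ y, polar σ u.1 u.2 y ≠ β)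
      (fun u => (Fintype.card K : ℚ) - Fintype.card K / radCard σ u.1 u.2)
      (fun u c _ _ => card_not_image), card_filter_eq_zero, Nat.cast_one, one_mul, Finset.filter_true,
    sum_card_not_image h hp hK hn]

lemma weightFreq_not_image' (h : IsHermitianFrobenius σ q) (hp : p ≠ 2) (hpq : p ∣ q)
    (hK : Fintype.card K = q ^ (2 * n)) (hn : 4 ≤ n)
    (hω : p * ω = (p - 1) * Fintype.card K - 0 - p) :
    (weightFreq (LinearMap.range (wordMap σ)) ω : ℚ) =
      (p - 1) * (Fintype.card K - 1 + ∑ i : Fin 4, (rankCount σ q n i : ℚ) *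
        (Fintype.card K - Fintype.card K / q ^ (2 * (i : ℕ)))) := by
  rw [weightFreq_range (wordMap_injective h hp hpq hK hn)
    (fun w => w.2.1 ≠ 0 ∧ True ∧ ∀ y, polar σ w.1.1 w.1.2 y ≠ w.2.2) fun w => by
      rw [hammingNorm_eq_iff_of_dvd' h hp hpq hK hn (dvd_zero _) hω, excess_eq_zero_iff h hp hK,
        true_and],
    card_params (fun _ => True) (fun c => c ≠ 0) (fun u c β => ∀ y, polar σ u.1 u.2 y ≠ β)
      (fun u => (Fintype.card K : ℚ) - Fintype.card K / radCard σ u.1 u.2)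
      (fun u c _ _ => card_not_image), card_filter_ne_zero, Finset.filter_true,
    sum_card_not_image h hp hK hn]

/-- With `β = 0` one may take `y = 0`, where Q vanishes. Hence `c = 0` is on level and `c ≠ 0` is
off level: two of the five cases for general `β` remain, each with one word per pair and constant.
-/
lemma weightFreq₀_level (h : IsHermitianFrobenius σ q) (hp : p ≠ 2) (hpq : p ∣ q)
    (hK : Fintype.card K = q ^ (2 * n)) (hn : 4 ≤ n)
    (hω : p * ω = (p - 1) * Fintype.card K - (p - 1) * (-(q : ℤ)) ^ (n + i)) :
    weightFreq (LinearMap.range (wordMap₀ σ)) ω = sumCount σ ((-(q : ℤ)) ^ (n + i)) := by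
  rw [weightFreq_range (wordMap₀_injective h hp hpq hK hn)
    (fun w => charSum σ w.1.1 w.1.2 = (-(q : ℤ)) ^ (n + i) ∧ w.2 = 0) fun w => by
      rw [wordMap₀_apply,
        hammingNorm_eq_iff_of_dvd h hp hpq hK hn ((sq_dvd_pow hpq (by omega)).mul_left _) hω,
        excess_eq_level_iff h hp hpq hK]
      constructor
      · rintro ⟨hc, hs, -⟩
        exact ⟨hs, hc⟩
      · rintro ⟨hs, hc⟩
        exact ⟨hc, hs, 0, map_zero _, by rw [qform_zero]; exact hc.symm⟩]
  rw [← Finset.univ_product_univ, Finset.filter_product (fun u : K × K => charSum σ u.1 u.2 = _)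
    (fun c : ZMod p => c = 0), Finset.card_product, card_filter_eq_zero, mul_one, sumCount]

lemma weightFreq₀_off_level' (h : IsHermitianFrobenius σ q) (hp : p ≠ 2) (hpq : p ∣ q)
    (hK : Fintype.card K = q ^ (2 * n)) (hn : 4 ≤ n)
    (hω : p * ω = (p - 1) * Fintype.card K - -(-(q : ℤ)) ^ (n + i) - p) :
    (weightFreq (LinearMap.range (wordMap₀ σ)) ω : ℚ) =
      (p - 1) * sumCount σ ((-(q : ℤ)) ^ (n + i)) := by
  rw [weightFreq_range (wordMap₀_injective h hp hpq hK hn)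
    (fun w => charSum σ w.1.1 w.1.2 = (-(q : ℤ)) ^ (n + i) ∧ w.2 ≠ 0) fun w => by
      rw [wordMap₀_apply,
        hammingNorm_eq_iff_of_dvd' h hp hpq hK hn ((dvd_neg).2 (sq_dvd_pow hpq (by omega))) hω,
        excess_eq_off_level_iff h hp hpq hK]
      constructor
      · rintro ⟨hc, hs, -⟩
        exact ⟨hs, hc⟩
      · rintro ⟨hs, hc⟩
        exact ⟨hc, hs, 0, map_zero _, by rw [qform_zero]; exact hc.symm⟩]
  rw [← Finset.univ_product_univ, Finset.filter_product (fun u : K × K => charSum σ u.1 u.2 = _)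
    (fun c : ZMod p => c ≠ 0), Finset.card_product, Nat.cast_mul, card_filter_ne_zero, sumCount,
    mul_comm]

lemma sumCount_eq_rankCount (i : Fin 4) :
    sumCount σ ((-(q : ℤ)) ^ (n + (i : ℕ))) = rankCount σ q n i := rfl

lemma sumCount_top (h : IsHermitianFrobenius σ q) (hp : p ≠ 2)
    (hK : Fintype.card K = q ^ (2 * n)) (hn : 4 ≤ n) :
    sumCount σ ((-(q : ℤ)) ^ (n + n)) = 1 := by
  simp only [sumCount, charSum_eq_top_iff h hp hK hn]
  simp [Finset.filter_eq']

end Counts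

end Words

/-! ### The Frobenius power x ↦ x^(p^ℓ) and the codes as images of the word maps -/

section Frobenius

variable {p : ℕ} [Fact p.Prime] {K : Type*} [Field K] [Fintype K] [DecidableEq K]
  [Algebra (ZMod p) K] {σ : K ≃ₐ[ZMod p] K} {q n m ℓ : ℕ}

variable (p K) in
lemma exists_frobenius_pow (ℓ : ℕ) : ∃ σ : K ≃ₐ[ZMod p] K, ∀ x, σ x = x ^ p ^ ℓ := by
  have : FiniteDimensional (ZMod p) K := Module.Finite.of_finite
  induction ℓ with
  | zero => exact ⟨AlgEquiv.refl, by simp⟩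
  | succ k ih =>
    obtain ⟨τ, hτ⟩ := ih
    refine ⟨τ.trans (FiniteField.frobeniusAlgEquivOfAlgebraic (ZMod p) K), fun x => ?_⟩
    rw [AlgEquiv.trans_apply, FiniteField.coe_frobeniusAlgEquivOfAlgebraic, hτ, ZMod.card, pow_succ,
      pow_mul]

lemma isPeriodicPt_pow_iff (k : ℕ) (x : K) :
    Function.IsPeriodicPt (fun y : K => y ^ p) k x ↔ x ^ p ^ k = x := by
  rw [Function.IsPeriodicPt, Function.IsFixedPt, pow_iterate]

lemma gcd_two_mul (hδ : 0 < m.gcd ℓ) (hm : m = 2 * (n * m.gcd ℓ)) :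
    (ℓ + ℓ).gcd m = 2 * m.gcd ℓ := by
  obtain ⟨l, hl⟩ := Nat.gcd_dvd_right m ℓ
  have hcop : Nat.gcd (2 * n) l = 1 := by
    have h1 : Nat.gcd (m.gcd ℓ * (2 * n)) (m.gcd ℓ * l) = m.gcd ℓ := by
      rw [← hl, show m.gcd ℓ * (2 * n) = m by conv_rhs => rw [hm]
                                              ring]
    rw [Nat.gcd_mul_left] at h1
    exact Nat.eq_of_mul_eq_mul_left hδ (by rw [h1, mul_one])
  have hcop' : Nat.gcd l n = 1 := (Nat.Coprime.coprime_mul_left (k := 2) hcop).symm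
  generalize m.gcd ℓ = δ at *
  rw [hm, hl, show δ * l + δ * l = 2 * δ * l by ring, show 2 * (n * δ) = 2 * δ * n by ring,
    Nat.gcd_mul_left, hcop', mul_one]

/-- If the quotient of `ℓ` by the gcd were even, twice the gcd would divide both `m` and `ℓ`. -/
lemma exists_odd_quotient (hδ : 0 < m.gcd ℓ) (hm : m = 2 * (n * m.gcd ℓ)) :
    ∃ k, ℓ = m.gcd ℓ + 2 * m.gcd ℓ * k := by
  obtain ⟨l, hl⟩ := Nat.gcd_dvd_right m ℓ
  have hodd : Odd l := by
    rw [← Nat.not_even_iff_odd]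
    intro hev
    obtain ⟨j, hj⟩ := hev.two_dvd
    have h1 : 2 * m.gcd ℓ ∣ m.gcd ℓ := by
      refine Nat.dvd_gcd ⟨n, ?_⟩ ⟨j, ?_⟩
      · rw [mul_assoc, mul_comm (m.gcd ℓ) n]
        exact hm
      · rw [hj] at hl
        rw [mul_assoc, mul_left_comm]
        exact hl
    have := Nat.le_of_dvd hδ h1
    omega
  obtain ⟨k, hk⟩ := hodd
  refine ⟨k, ?_⟩
  rw [hk] at hl
  calc ℓ = m.gcd ℓ * (2 * k + 1) := hl
    _ = m.gcd ℓ + 2 * m.gcd ℓ * k := by ring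

lemma isHermitianFrobenius (hp : p ≠ 2) (hσ : ∀ x, σ x = x ^ p ^ ℓ)
    (hK : Fintype.card K = p ^ m) (hδ : 0 < m.gcd ℓ) (hm : m = 2 * (n * m.gcd ℓ)) :
    IsHermitianFrobenius σ (p ^ m.gcd ℓ) := by
  have hp3 : 3 ≤ p := by
    have := (Fact.out : p.Prime).two_le
    omega
  have hsq : (p ^ m.gcd ℓ) ^ 2 = p ^ (2 * m.gcd ℓ) := by rw [← pow_mul, mul_comm]
  refine ⟨?_, ?_, ?_, ?_⟩
  · intro x
    have h1 : σ (σ x) = x ^ p ^ (ℓ + ℓ) := by rw [hσ, hσ, ← pow_mul, ← pow_add]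
    rw [h1, hsq, ← isPeriodicPt_pow_iff, ← isPeriodicPt_pow_iff]
    constructor
    -- Every element is periodic under Frobenius with period `m`; together with the period `2ℓ` this
    -- gives the period `gcd(2ℓ, m) = 2δ`.
    · intro h2
      have h3 : Function.IsPeriodicPt (fun y : K => y ^ p) m x := by
        rw [isPeriodicPt_pow_iff, ← hK, FiniteField.pow_card]
      rw [← gcd_two_mul hδ hm]
      exact h2.gcd h3
    · intro h2
      refine h2.trans_dvd ?_
      rw [← two_mul]
      exact Nat.mul_dvd_mul_left 2 (Nat.gcd_dvd_right m ℓ)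
  · intro x hx
    rw [hsq, ← isPeriodicPt_pow_iff] at hx
    obtain ⟨k, hk⟩ := exists_odd_quotient hδ hm
    have h1 := (isPeriodicPt_pow_iff (p := p) _ x).1 (hx.mul_const k)
    have h2 : p ^ ℓ = p ^ (2 * m.gcd ℓ * k) * p ^ m.gcd ℓ := by
      rw [← pow_add, add_comm, ← hk]
    rw [hσ, h2, pow_mul, h1]
  · have h1 : (p ^ m.gcd ℓ + 1) * (p ^ m.gcd ℓ - 1) = (p ^ m.gcd ℓ) ^ 2 - 1 := by
      rw [sq_eq_of_pos (by positivity), Nat.add_sub_cancel]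
    have h2 : Fintype.card K = ((p ^ m.gcd ℓ) ^ 2) ^ n := by
      rw [hK, ← pow_mul, ← pow_mul]
      congr 1
      conv_lhs => rw [hm]
      ring
    rw [h1, h2]
    simpa using Nat.sub_dvd_pow_sub_pow ((p ^ m.gcd ℓ) ^ 2) 1 n
  · calc 2 < p := by omega
      _ ≤ p ^ m.gcd ℓ := Nat.le_self_pow hδ.ne' p

lemma mul_eval_eq_form (hσ : ∀ x, σ x = x ^ p ^ ℓ) (a b x : K) :
    x * (a • X ^ p ^ ℓ + b • X ^ p ^ (3 * ℓ) : K[X]).eval x = form σ a b x := by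
  have h3 : σ (σ (σ x)) = x ^ p ^ (3 * ℓ) := by
    rw [hσ, hσ, hσ, ← pow_mul, ← pow_mul, ← pow_add, ← pow_add]
    congr 2
    ring
  simp only [eval_add, eval_smul, eval_pow, eval_X, smul_eq_mul]
  rw [form, h3, hσ]

lemma mem_linFamily_iff {R : K[X]} :
    R ∈ linFamily p K ℓ ↔ ∃ a b : K, a • X ^ p ^ ℓ + b • X ^ p ^ (3 * ℓ) = R :=
  Submodule.mem_span_pair

lemma code2_eq_range (hσ : ∀ x, σ x = x ^ p ^ ℓ) :
    code2 p (linFamily p K ℓ) = LinearMap.range (wordMap σ) := by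
  ext c
  rw [LinearMap.mem_range]
  constructor
  · rintro ⟨R, hR, β, b, rfl⟩
    obtain ⟨a, a', rfl⟩ := mem_linFamily_iff.1 hR
    refine ⟨((a, a'), b, β), ?_⟩
    funext x
    rw [mul_eval_eq_form hσ, map_add]
    rfl
  · rintro ⟨⟨⟨a, a'⟩, b, β⟩, rfl⟩
    refine ⟨_, mem_linFamily_iff.2 ⟨a, a', rfl⟩, β, b, ?_⟩
    funext x
    rw [mul_eval_eq_form hσ, map_add]
    rfl

lemma code0_eq_range (hσ : ∀ x, σ x = x ^ p ^ ℓ) :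
    code0 p (linFamily p K ℓ) = LinearMap.range (wordMap₀ σ) := by
  ext c
  rw [LinearMap.mem_range]
  constructor
  · rintro ⟨R, hR, b, rfl⟩
    obtain ⟨a, a', rfl⟩ := mem_linFamily_iff.1 hR
    refine ⟨((a, a'), b), ?_⟩
    funext x
    rw [mul_eval_eq_form hσ, wordMap₀_apply, wordMap_apply, zero_mul, map_zero, add_zero]
    rfl
  · rintro ⟨⟨⟨a, a'⟩, b⟩, rfl⟩
    refine ⟨_, mem_linFamily_iff.2 ⟨a, a', rfl⟩, b, ?_⟩
    funext x
    rw [mul_eval_eq_form hσ, wordMap₀_apply, wordMap_apply, zero_mul, map_zero, add_zero]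
    rfl

end Frobenius

/-! ### The two weight tables -/

section Distributions

variable {p : ℕ} [Fact p.Prime] {K : Type*} [Field K] [Fintype K] [DecidableEq K]
  [Algebra (ZMod p) K] {σ : K ≃ₐ[ZMod p] K} {n m ℓ : ℕ}

lemma mem_table0_iff {row : ℤ × ℚ} : row ∈ table0 p m ℓ ↔
    row = (0, 1) ∨ row = ((p : ℤ) ^ m - 1, (p : ℚ) - 1) ∨ ∃ i : Fin 4,
    row = ((p : ℤ) ^ m - (p : ℤ) ^ (m - 1)
        - sgn m ℓ i * ((p : ℤ) - 1) * (p : ℤ) ^ (m / 2 + i * m.gcd ℓ - 1),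
      freq p m ℓ i) ∨
    row = ((p : ℤ) ^ m - (p : ℤ) ^ (m - 1)
        + sgn m ℓ i * (p : ℤ) ^ (m / 2 + i * m.gcd ℓ - 1) - 1,
      ((p : ℚ) - 1) * freq p m ℓ i) := by
  simp only [table0, List.mem_append, List.mem_cons, List.mem_flatMap, List.mem_finRange, true_and,
    List.not_mem_nil, or_false, or_assoc]

lemma mem_table2_iff {row : ℤ × ℚ} : row ∈ table2 p m ℓ ↔
    row = (0, 1) ∨ row = ((p : ℤ) ^ m - 1, (p : ℚ) - 1) ∨
    row = ((p : ℤ) ^ m - (p : ℤ) ^ (m - 1),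
      (p : ℚ) ^ m - 1
        + ∑ i : Fin 4, freq p m ℓ i * ((p : ℚ) ^ m - (p : ℚ) ^ (m - 2 * i * m.gcd ℓ))) ∨
    row = ((p : ℤ) ^ m - (p : ℤ) ^ (m - 1) - 1,
      ((p : ℚ) - 1) * ((p : ℚ) ^ m - 1
        + ∑ i : Fin 4, freq p m ℓ i * ((p : ℚ) ^ m - (p : ℚ) ^ (m - 2 * i * m.gcd ℓ)))) ∨
    ∃ i : Fin 4,
    row = ((p : ℤ) ^ m - (p : ℤ) ^ (m - 1)
        - sgn m ℓ i * ((p : ℤ) - 1) * (p : ℤ) ^ (m / 2 + i * m.gcd ℓ - 1),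
      ((p : ℚ) ^ (m - 2 * i * m.gcd ℓ - 1)
        + sgn m ℓ i * ((p : ℚ) - 1) * (p : ℚ) ^ (m / 2 - i * m.gcd ℓ - 1)) * freq p m ℓ i) ∨
    row = ((p : ℤ) ^ m - (p : ℤ) ^ (m - 1)
        + sgn m ℓ i * (p : ℤ) ^ (m / 2 + i * m.gcd ℓ - 1),
      ((p : ℚ) ^ (m - 2 * i * m.gcd ℓ - 1)
        - sgn m ℓ i * (p : ℚ) ^ (m / 2 - i * m.gcd ℓ - 1)) * ((p : ℚ) - 1) * freq p m ℓ i) ∨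
    row = ((p : ℤ) ^ m - (p : ℤ) ^ (m - 1) - 1
        - sgn m ℓ i * ((p : ℤ) - 1) * (p : ℤ) ^ (m / 2 + i * m.gcd ℓ - 1),
      ((p : ℚ) ^ (m - 2 * i * m.gcd ℓ - 1)
        - sgn m ℓ i * (p : ℚ) ^ (m / 2 - i * m.gcd ℓ - 1)) * ((p : ℚ) - 1) * freq p m ℓ i) ∨
    row = ((p : ℤ) ^ m - (p : ℤ) ^ (m - 1) - 1
        + sgn m ℓ i * (p : ℤ) ^ (m / 2 + i * m.gcd ℓ - 1),
      ((p : ℚ) ^ (m - 2 * i * m.gcd ℓ) - (p : ℚ) ^ (m - 2 * i * m.gcd ℓ - 1)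
        + sgn m ℓ i * (p : ℚ) ^ (m / 2 - i * m.gcd ℓ - 1)) * ((p : ℚ) - 1) * freq p m ℓ i) := by
  simp only [table2, List.mem_append, List.mem_cons, List.mem_flatMap, List.mem_finRange, true_and,
    List.not_mem_nil, or_false, or_assoc]

lemma mul_pow_pred (hm0 : 0 < m) : (p : ℤ) * (p : ℤ) ^ (m - 1) = (p : ℤ) ^ m := by
  rw [← pow_succ', Nat.sub_add_cancel hm0]

/-- This identifies `p ε_i u_i` with the exponential sum; the factor `p` absorbs the `- 1` in the
exponent. -/
lemma mul_sgn_pow (hδ : 0 < m.gcd ℓ) (hm : m = 2 * (n * m.gcd ℓ)) (hn : 4 ≤ n) (i : Fin 4) :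
    (p : ℤ) * (sgn m ℓ i * (p : ℤ) ^ (m / 2 + i * m.gcd ℓ - 1)) =
      (-((p ^ m.gcd ℓ : ℕ) : ℤ)) ^ (n + (i : ℕ)) := by
  rw [sgn, eps_eq hδ hm]
  generalize m.gcd ℓ = δ at *
  have h4 : 4 * δ ≤ n * δ := Nat.mul_le_mul_right _ hn
  have h1 : m / 2 = n * δ := by omega
  rw [h1, neg_pow ((p ^ δ : ℕ) : ℤ), mul_left_comm, mul_pow_pred (by omega), ← add_mul]
  push_cast
  rw [← pow_mul]
  ring

/-- The two power identities behind the frequencies of the large code. -/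
lemma freq_pow_identities (hδ : 0 < m.gcd ℓ) (hm : m = 2 * (n * m.gcd ℓ)) (hn : 4 ≤ n)
    (i : Fin 4) :
    (p : ℚ) ^ (m - 2 * i * m.gcd ℓ - 1) =
      (p : ℚ) ^ m / (p * ((p ^ m.gcd ℓ : ℕ) : ℚ) ^ (2 * (i : ℕ))) ∧
    (p : ℚ) ^ (m - 2 * i * m.gcd ℓ) = (p : ℚ) ^ m / ((p ^ m.gcd ℓ : ℕ) : ℚ) ^ (2 * (i : ℕ)) ∧
    (sgn m ℓ i : ℚ) * (p : ℚ) ^ (m / 2 - i * m.gcd ℓ - 1) =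
      (-((p ^ m.gcd ℓ : ℕ) : ℚ)) ^ (n + (i : ℕ)) /
        (p * ((p ^ m.gcd ℓ : ℕ) : ℚ) ^ (2 * (i : ℕ))) := by
  rw [sgn, eps_eq hδ hm]
  have hp0 : (p : ℚ) ≠ 0 := by exact_mod_cast (Fact.out : p.Prime).ne_zero
  generalize m.gcd ℓ = δ at *
  have h4 : 4 * δ ≤ n * δ := Nat.mul_le_mul_right _ hn
  have h3 : (i : ℕ) * δ ≤ 3 * δ := Nat.mul_le_mul_right _ (by omega)
  have h1 : m / 2 = n * δ := by omega
  have h2 : 2 * (i : ℕ) * δ = 2 * (i * δ) := by ring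
  have hq : ((p ^ δ : ℕ) : ℚ) ^ (2 * (i : ℕ)) = (p : ℚ) ^ (2 * (i * δ)) := by
    push_cast
    rw [← pow_mul]
    congr 1
    ring
  have hq0 : (p : ℚ) ^ (2 * (i * δ)) ≠ 0 := pow_ne_zero _ hp0
  rw [hq, h2]
  refine ⟨?_, ?_, ?_⟩
  · rw [eq_div_iff (mul_ne_zero hp0 hq0), ← pow_succ', ← pow_add]
    congr 1
    omega
  · rw [eq_div_iff hq0, ← pow_add]
    congr 1
    omega
  · rw [eq_div_iff (mul_ne_zero hp0 hq0), ← pow_succ', mul_assoc, ← pow_add (p : ℚ),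
      neg_pow ((p ^ δ : ℕ) : ℚ), h1]
    push_cast
    rw [← pow_mul, show n * δ - i * δ - 1 + (2 * (i * δ) + 1) = δ * (n + i) by
      rw [mul_add, mul_comm δ n, mul_comm δ (i : ℕ)]; omega]
    ring

lemma card_eq_pow (hK : Fintype.card K = p ^ m) (hm : m = 2 * (n * m.gcd ℓ)) :
    Fintype.card K = (p ^ m.gcd ℓ) ^ (2 * n) := by
  rw [hK, ← pow_mul]
  congr 1
  conv_lhs => rw [hm]
  ring

theorem hasWeightDistribution_table0 (hp : p ≠ 2) (h : IsHermitianFrobenius σ (p ^ m.gcd ℓ))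
    (hK : Fintype.card K = p ^ m) (hδ : 0 < m.gcd ℓ) (hm : m = 2 * (n * m.gcd ℓ)) (hn : 4 ≤ n) :
    HasWeightDistribution (LinearMap.range (wordMap₀ σ)) (table0 p m ℓ) := by
  have hpq : p ∣ p ^ m.gcd ℓ := dvd_pow_self p hδ.ne'
  have hK' := card_eq_pow hK hm
  have hm0 : 0 < m := Nat.pos_of_ne_zero fun h0 => by
    have := Nat.mul_pos (by omega : 0 < n) hδ
    omega
  have hp0 : (p : ℤ) ≠ 0 := by exact_mod_cast (Fact.out : p.Prime).ne_zero
  have hKz : (Fintype.card K : ℤ) = (p : ℤ) ^ m := by rw [hK]; push_cast; rfl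
  have hpm := mul_pow_pred (p := p) hm0
  have hs := mul_sgn_pow (p := p) hδ hm hn
  have htop := neg_pow_top hK'
  have hF := rankCount_eq_freq h hp hK' hn hδ hm rfl
  refine ⟨?_, ?_⟩
  · intro row hrow
    rcases mem_table0_iff.1 hrow with rfl | rfl | ⟨i, rfl | rfl⟩
    -- The two single rows are the zero form, obtained at `i = n`.
    · rw [weightFreq₀_level (i := n) h hp hpq hK' hn (by rw [htop]; ring),
        sumCount_top h hp hK' hn, Nat.cast_one]
    · rw [weightFreq₀_off_level' (i := n) h hp hpq hK' hn (by rw [htop, hKz]; ring),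
        sumCount_top h hp hK' hn, Nat.cast_one, mul_one]
    · rw [weightFreq₀_level (i := i) h hp hpq hK' hn
        (by rw [hKz]; linear_combination -hpm - (p - 1 : ℤ) * hs i), sumCount_eq_rankCount, hF]
    · rw [weightFreq₀_off_level' (i := i) h hp hpq hK' hn
        (by rw [hKz]; linear_combination -hpm + hs i), sumCount_eq_rankCount, hF]
  · rintro _ ⟨⟨u, c⟩, rfl⟩
    have hN := mul_hammingNorm_wordMap σ (u, c, 0)
    simp only at hN
    rw [wordMap₀_apply]
    by_cases hc : c = 0
    · rw [if_pos hc, excess_of_level h ⟨0, map_zero _, by rw [qform_zero, hc]⟩, hKz] at hN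
      by_cases hu : u = 0
      · have h1 := (charSum_eq_top_iff h hp hK' hn u).2 hu
        rw [h1, htop, hKz] at hN
        refine ⟨_, mem_table0_iff.2 (Or.inl rfl), mul_left_cancel₀ hp0 ?_⟩
        rw [hN]; ring
      · obtain ⟨i, hi⟩ := exists_charSum_eq h hp hK' (a := u.1) (b := u.2) hu
        rw [hi] at hN
        refine ⟨_, mem_table0_iff.2 (Or.inr (Or.inr ⟨i, Or.inl rfl⟩)), mul_left_cancel₀ hp0 ?_⟩
        rw [hN]; linear_combination hpm + (p - 1 : ℤ) * hs i
    · rw [if_neg hc, excess_of_off_level h ⟨0, map_zero _, by rw [qform_zero]; exact Ne.symm hc⟩,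
        hKz] at hN
      by_cases hu : u = 0
      · have h1 := (charSum_eq_top_iff h hp hK' hn u).2 hu
        rw [h1, htop, hKz] at hN
        refine ⟨_, mem_table0_iff.2 (Or.inr (Or.inl rfl)), mul_left_cancel₀ hp0 ?_⟩
        rw [hN]; ring
      · obtain ⟨i, hi⟩ := exists_charSum_eq h hp hK' (a := u.1) (b := u.2) hu
        rw [hi] at hN
        refine ⟨_, mem_table0_iff.2 (Or.inr (Or.inr ⟨i, Or.inr rfl⟩)), mul_left_cancel₀ hp0 ?_⟩
        rw [hN]; linear_combination hpm - hs i

theorem hasWeightDistribution_table2 (hp : p ≠ 2) (h : IsHermitianFrobenius σ (p ^ m.gcd ℓ))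
    (hK : Fintype.card K = p ^ m) (hδ : 0 < m.gcd ℓ) (hm : m = 2 * (n * m.gcd ℓ)) (hn : 4 ≤ n) :
    HasWeightDistribution (LinearMap.range (wordMap σ)) (table2 p m ℓ) := by
  have hpq : p ∣ p ^ m.gcd ℓ := dvd_pow_self p hδ.ne'
  have hK' := card_eq_pow hK hm
  have hm0 : 0 < m := Nat.pos_of_ne_zero fun h0 => by
    have := Nat.mul_pos (by omega : 0 < n) hδ
    omega
  have hp0 : (p : ℤ) ≠ 0 := by exact_mod_cast (Fact.out : p.Prime).ne_zero
  have hpQ : (p : ℚ) ≠ 0 := by exact_mod_cast (Fact.out : p.Prime).ne_zero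
  have hKz : (Fintype.card K : ℤ) = (p : ℤ) ^ m := by rw [hK]; push_cast; rfl
  have hKq : (Fintype.card K : ℚ) = (p : ℚ) ^ m := by rw [hK]; push_cast; rfl
  have hpm := mul_pow_pred (p := p) hm0
  have hs := mul_sgn_pow (p := p) hδ hm hn
  have htop := neg_pow_top hK'
  have htopQ : (-((p ^ m.gcd ℓ : ℕ) : ℚ)) ^ (n + n) = (p : ℚ) ^ m := by
    rw [← hKq]; exact_mod_cast congrArg (Int.cast (R := ℚ)) htop
  have htopr : ((p ^ m.gcd ℓ : ℕ) : ℚ) ^ (2 * n) = (p : ℚ) ^ m := by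
    rw [← hKq, hK']; push_cast; rfl
  have hpm0 : (p : ℚ) ^ m ≠ 0 := pow_ne_zero _ hpQ
  have hF := rankCount_eq_freq h hp hK' hn hδ hm rfl
  have hid := freq_pow_identities (p := p) hδ hm hn
  refine ⟨?_, ?_⟩
  · intro row hrow
    rcases mem_table2_iff.1 hrow with rfl | rfl | rfl | rfl | ⟨i, rfl | rfl | rfl | rfl⟩
    · rw [weightFreq_level (i := n) h hp hpq hK' hn (by rw [htop]; ring),
        sumCount_top h hp hK' hn, htopQ, htopr, hKq]
      field_simp
      ring
    · rw [weightFreq_off_level' (i := n) h hp hpq hK' hn (by rw [htop, hKz]; ring),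
        sumCount_top h hp hK' hn, htopQ, htopr, hKq]
      field_simp
      ring
    · rw [weightFreq_not_image h hp hpq hK' hn (by rw [hKz]; linear_combination -hpm), hKq]
      simp only [hF, (hid _).2.1]
    · rw [weightFreq_not_image' h hp hpq hK' hn (by rw [hKz]; linear_combination -hpm), hKq]
      simp only [hF, (hid _).2.1]
    · rw [weightFreq_level (i := i) h hp hpq hK' hn
        (by rw [hKz]; linear_combination -hpm - (p - 1 : ℤ) * hs i), sumCount_eq_rankCount, hF, hKq]
      rw [mul_right_comm (sgn m ℓ i : ℚ), (hid i).1, (hid i).2.2]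
      ring
    · rw [weightFreq_off_level (i := i) h hp hpq hK' hn
        (by rw [hKz]; linear_combination -hpm + hs i), sumCount_eq_rankCount, hF, hKq]
      rw [(hid i).1, (hid i).2.2]
      ring
    · rw [weightFreq_level' (i := i) h hp hpq hK' hn
        (by rw [hKz]; linear_combination -hpm - (p - 1 : ℤ) * hs i), sumCount_eq_rankCount, hF, hKq]
      rw [(hid i).1, (hid i).2.2]
      ring
    · rw [weightFreq_off_level' (i := i) h hp hpq hK' hn
        (by rw [hKz]; linear_combination -hpm + hs i), sumCount_eq_rankCount, hF, hKq]
      rw [(hid i).1, (hid i).2.1, (hid i).2.2]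
      have hr : ((p ^ m.gcd ℓ : ℕ) : ℚ) ^ (2 * (i : ℕ)) ≠ 0 := by
        push_cast
        exact pow_ne_zero _ (pow_ne_zero _ hpQ)
      generalize ((p ^ m.gcd ℓ : ℕ) : ℚ) ^ (2 * (i : ℕ)) = r at *
      field_simp
  · rintro _ ⟨⟨u, c, β⟩, rfl⟩
    have hN := mul_hammingNorm_wordMap σ (u, c, β)
    simp only at hN
    rw [hKz] at hN
    -- Comparing `p` times the weights keeps every identity free of division.
    suffices hsuff : ∃ row ∈ table2 p m ℓ, (p : ℤ) * hammingNorm (wordMap σ (u, c, β)) = p * row.1 by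
      obtain ⟨row, hrow, heq⟩ := hsuff
      exact ⟨row, hrow, mul_left_cancel₀ hp0 heq⟩
    simp only [mem_table2_iff]
    rw [hN]
    rcases level_trichotomy σ u.1 u.2 c β with h1 | h1 | h1
    · rw [excess_of_level h h1]
      by_cases hu : u = 0
      · have hc : c = 0 := by
          obtain ⟨y, -, hy⟩ := h1
          subst hu
          rw [← hy]
          simp [qform, form]
        rw [(charSum_eq_top_iff h hp hK' hn u).2 hu, htop, hKz, if_pos hc]
        exact ⟨_, Or.inl rfl, by ring⟩
      · obtain ⟨i, hi⟩ := exists_charSum_eq h hp hK' (a := u.1) (b := u.2) hu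
        rw [hi]
        split_ifs
        · exact ⟨_, Or.inr (Or.inr (Or.inr (Or.inr ⟨i, Or.inl rfl⟩))),
            by linear_combination hpm + (p - 1 : ℤ) * hs i⟩
        · exact ⟨_, Or.inr (Or.inr (Or.inr (Or.inr ⟨i, Or.inr (Or.inr (Or.inl rfl))⟩))),
            by linear_combination hpm + (p - 1 : ℤ) * hs i⟩
    · rw [excess_of_off_level h h1]
      by_cases hu : u = 0
      · have hc : c ≠ 0 := by
          obtain ⟨y, -, hy⟩ := h1
          subst hu
          intro hc
          apply hy
          rw [hc]
          simp [qform, form]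
        rw [(charSum_eq_top_iff h hp hK' hn u).2 hu, htop, hKz, if_neg hc]
        exact ⟨_, Or.inr (Or.inl rfl), by ring⟩
      · obtain ⟨i, hi⟩ := exists_charSum_eq h hp hK' (a := u.1) (b := u.2) hu
        rw [hi]
        split_ifs
        · exact ⟨_, Or.inr (Or.inr (Or.inr (Or.inr ⟨i, Or.inr (Or.inl rfl)⟩))),
            by linear_combination hpm - hs i⟩
        · exact ⟨_, Or.inr (Or.inr (Or.inr (Or.inr ⟨i, Or.inr (Or.inr (Or.inr rfl))⟩))),
            by linear_combination hpm - hs i⟩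
    · rw [excess_of_forall_ne hp h1]
      split_ifs
      · exact ⟨_, Or.inr (Or.inr (Or.inl rfl)), by linear_combination hpm⟩
      · exact ⟨_, Or.inr (Or.inr (Or.inr (Or.inl rfl))), by linear_combination hpm⟩

end Distributions

/-! ### Dimensions and minimum distances -/

section Parameters

/-- By linearity distances are weights of differences. Only the row of `d` needs a nonzero
frequency; for the lower bound it suffices to inspect the listed weights. -/
lemma isLeast_dist_of_table {F ι : Type*} [Field F] [DecidableEq F] [Fintype ι]
    {C : Submodule F (ι → F)} {T : List (ℤ × ℚ)} (hT : HasWeightDistribution C T) {d : ℕ}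
    (hd : 0 < d) {f : ℚ} (hmem : ((d : ℤ), f) ∈ T) (hf : f ≠ 0)
    (hle : ∀ row ∈ T, row.1 = 0 ∨ (d : ℤ) ≤ row.1) :
    IsLeast {e : ℕ | ∃ c ∈ C, ∃ c' ∈ C, c ≠ c' ∧ hammingDist c c' = e} d := by
  constructor
  · have h1 := hT.1 _ hmem
    have h2 : weightFreq C d ≠ 0 := by
      intro h0
      rw [h0, Nat.cast_zero] at h1
      exact hf h1.symm
    obtain ⟨c, hc, hw⟩ := Set.nonempty_of_ncard_ne_zero h2
    have hw' : hammingNorm c = d := by exact_mod_cast hw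
    refine ⟨c, hc, 0, C.zero_mem, ?_, ?_⟩
    · rintro rfl
      simp at hw'
      omega
    · rw [hammingDist_zero_right, hw']
  · rintro e ⟨c, hc, c', hc', hne, rfl⟩
    rw [hammingDist_eq_hammingNorm]
    obtain ⟨row, hrow, hw⟩ := hT.2 (-c + c') (C.add_mem (C.neg_mem hc) hc')
    rcases hle row hrow with h0 | h0
    · rw [h0] at hw
      have : hammingNorm (-c + c') = 0 := by exact_mod_cast hw
      rw [hammingNorm_eq_zero, neg_add_eq_zero] at this
      exact absurd this hne
    · rw [← hw] at h0
      exact_mod_cast h0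

variable {p : ℕ} [Fact p.Prime] {K : Type*} [Field K] [Fintype K] [DecidableEq K]
  [Algebra (ZMod p) K] {σ : K ≃ₐ[ZMod p] K} {n m ℓ : ℕ}

lemma finrank_eq_of_card (hK : Fintype.card K = p ^ m) : Module.finrank (ZMod p) K = m := by
  have h1 := Module.card_eq_pow_finrank (K := ZMod p) (V := K)
  rw [hK, ZMod.card] at h1
  exact (Nat.pow_right_injective (Fact.out : p.Prime).two_le h1).symm

lemma finrank_range_wordMap (hΦ : Function.Injective (wordMap σ)) (hK : Fintype.card K = p ^ m) :
    Module.finrank (ZMod p) (LinearMap.range (wordMap σ)) = 3 * m + 1 := by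
  have : FiniteDimensional (ZMod p) K := Module.Finite.of_finite
  rw [LinearMap.finrank_range_of_inj hΦ, Module.finrank_prod, Module.finrank_prod,
    Module.finrank_prod, Module.finrank_self, finrank_eq_of_card hK]
  ring

lemma finrank_range_wordMap₀ (hΦ : Function.Injective (wordMap₀ σ))
    (hK : Fintype.card K = p ^ m) :
    Module.finrank (ZMod p) (LinearMap.range (wordMap₀ σ)) = 2 * m + 1 := by
  have : FiniteDimensional (ZMod p) K := Module.Finite.of_finite
  rw [LinearMap.finrank_range_of_inj hΦ, Module.finrank_prod, Module.finrank_prod,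
    Module.finrank_self, finrank_eq_of_card hK]
  ring

/-- The size comparisons between the deviations `u_i = p ^ (m/2 + iδ - 1)` needed to find the least
weight. -/
lemma deviation_bounds (hp : p ≠ 2) (hδ : 0 < m.gcd ℓ) (hm : m = 2 * (n * m.gcd ℓ)) (hn : 4 ≤ n)
    {u : Fin 4 → ℤ} (hu : ∀ i : Fin 4, u i = (p : ℤ) ^ (m / 2 + i * m.gcd ℓ - 1)) :
    (∀ i, 1 ≤ u i) ∧ (∀ i, u i ≤ u 3) ∧ (∀ i, i ≠ 3 → (p - 1) * u i ≤ u 3) ∧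
      (∀ i, (p - 1) * u i ≤ (p - 1) * u 3) ∧ 2 * u 3 ≤ (p - 1) * u 3 ∧
      (p - 1) * u 3 + 1 < (p : ℤ) ^ (m - 1) := by
  have hp3 : 3 ≤ p := by
    have := (Fact.out : p.Prime).two_le
    omega
  have hp1 : (1 : ℤ) ≤ p := by omega
  generalize m.gcd ℓ = δ at *
  have h4 : 4 * δ ≤ n * δ := Nat.mul_le_mul_right _ hn
  have hpos : ∀ i, 1 ≤ u i := fun i => by rw [hu]; exact one_le_pow₀ hp1
  have hv3 : ((3 : Fin 4) : ℕ) = 3 := rfl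
  have hle : ∀ i, u i ≤ u 3 := fun i => by
    have h3 : (i : ℕ) * δ ≤ 3 * δ := Nat.mul_le_mul_right _ (by omega)
    rw [hu, hu, hv3]
    exact pow_le_pow_right₀ hp1 (by omega)
  have hp0 : (0 : ℤ) ≤ p - 1 := by omega
  refine ⟨hpos, hle, ?_, fun i => mul_le_mul_of_nonneg_left (hle i) hp0, ?_, ?_⟩
  · intro i hi
    have h2 : (i : ℕ) * δ ≤ 2 * δ := Nat.mul_le_mul_right _ (by
      have : (i : ℕ) ≠ 3 := fun h => hi (Fin.ext h)
      omega)
    -- Consecutive exponents differ by `δ ≥ 1`, which gains at least a factor `p`.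
    have h5 : (p : ℤ) * u i ≤ u 3 := by
      rw [hu, hu, hv3, ← pow_succ']
      exact pow_le_pow_right₀ hp1 (by omega)
    have := hpos i
    linarith
  · exact mul_le_mul_of_nonneg_right (by omega) (by linarith [hpos 3])
  · have h5 : (p : ℤ) * u 3 ≤ (p : ℤ) ^ (m - 1) := by
      rw [hu, hv3, ← pow_succ']
      exact pow_le_pow_right₀ hp1 (by omega)
    have h6 : (p : ℤ) ^ 1 ≤ u 3 := by
      rw [hu, hv3]
      exact pow_le_pow_right₀ hp1 (by omega)
    rw [pow_one] at h6
    linarith [show (3 : ℤ) ≤ p by omega]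

lemma sgn_values (hδ : 0 < m.gcd ℓ) (hm : m = 2 * (n * m.gcd ℓ)) :
    (Even n → sgn m ℓ 0 = 1 ∧ sgn m ℓ 1 = -1 ∧ sgn m ℓ 2 = 1 ∧ sgn m ℓ 3 = -1) ∧
    (¬ Even n → sgn m ℓ 0 = -1 ∧ sgn m ℓ 1 = 1 ∧ sgn m ℓ 2 = -1 ∧ sgn m ℓ 3 = 1) := by
  simp only [sgn, eps_eq hδ hm]
  constructor
  · intro h
    rw [h.neg_one_pow]
    refine ⟨?_, ?_, ?_, ?_⟩ <;> rfl
  · intro h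
    rw [(Nat.not_even_iff_odd.1 h).neg_one_pow]
    refine ⟨?_, ?_, ?_, ?_⟩ <;> rfl

/-- The largest deviations of the number of zeros are those of the forms with largest radical. -/
lemma signed_deviation_bounds (hp : p ≠ 2) (hδ : 0 < m.gcd ℓ) (hm : m = 2 * (n * m.gcd ℓ))
    (hn : 4 ≤ n) {u : Fin 4 → ℤ} (hu : ∀ i : Fin 4, u i = (p : ℤ) ^ (m / 2 + i * m.gcd ℓ - 1)) :
    (Even n → sgn m ℓ 3 = -1 ∧
      ∀ i, sgn m ℓ i * (p - 1) * u i ≤ u 3 ∧ -u 3 ≤ sgn m ℓ i * u i) ∧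
    (¬ Even n → sgn m ℓ 3 = 1 ∧
      ∀ i, sgn m ℓ i * (p - 1) * u i ≤ (p - 1) * u 3 ∧ -((p - 1) * u 3) + 1 ≤ sgn m ℓ i * u i) := by
  obtain ⟨b1, b2, b3, b4, b5, -⟩ := deviation_bounds hp hδ hm hn hu
  obtain ⟨s1, s2⟩ := sgn_values hδ hm
  have hp2 := (Fact.out : p.Prime).two_le
  have hnn : ∀ i, 0 ≤ ((p : ℤ) - 1) * u i := fun i =>
    mul_nonneg (by omega) (zero_le_one.trans (b1 i))
  constructor
  · intro hev
    obtain ⟨t0, t1, t2, t3⟩ := s1 hev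
    refine ⟨t3, fun i => ?_⟩
    fin_cases i <;> simp only [Fin.zero_eta, Fin.mk_one, Fin.reduceFinMk, t0, t1, t2, t3] <;>
      constructor <;> linarith [b1 0, b1 1, b1 2, b1 3, b2 1, b3 0 (by decide), b3 2 (by decide),
        hnn 1, hnn 3]
  · intro hev
    obtain ⟨t0, t1, t2, t3⟩ := s2 hev
    refine ⟨t3, fun i => ?_⟩
    fin_cases i <;> simp only [Fin.zero_eta, Fin.mk_one, Fin.reduceFinMk, t0, t1, t2, t3] <;>
      constructor <;> linarith [b1 0, b1 1, b1 2, b1 3, b2 0, b2 2, b4 1, hnn 0, hnn 2, hnn 3]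

lemma freq_three_pos (hp : p ≠ 2) (h : IsHermitianFrobenius σ (p ^ m.gcd ℓ))
    (hK : Fintype.card K = p ^ m) (hδ : 0 < m.gcd ℓ) (hm : m = 2 * (n * m.gcd ℓ)) (hn : 4 ≤ n) :
    0 < freq p m ℓ 3 := by
  rw [← rankCount_eq_freq h hp (card_eq_pow hK hm) hn hδ hm rfl]
  exact_mod_cast rankCount_three_pos h hp (card_eq_pow hK hm) hn

/-- The sign at `i = 3` selects the extremal row. For odd `n` it is positive and the deviation `(p -
1) u₃` wins. For even `n` it is negative, so `u₃ + 1` competes with `(p - 1) u_i` for `i = 0, 2`,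
each of which is at most `u₃`. -/
theorem isLeast_dist_code0 (hp : p ≠ 2) (h : IsHermitianFrobenius σ (p ^ m.gcd ℓ))
    (hK : Fintype.card K = p ^ m) (hδ : 0 < m.gcd ℓ) (hm : m = 2 * (n * m.gcd ℓ)) (hn : 4 ≤ n)
    {d : ℕ} (hd : (d : ℤ) = (p : ℤ) ^ (m - 1) * ((p : ℤ) - 1)
        - (if Even n then (p : ℤ) ^ (m / 2 + 3 * m.gcd ℓ - 1) + 1
            else ((p : ℤ) - 1) * (p : ℤ) ^ (m / 2 + 3 * m.gcd ℓ - 1))) :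
    IsLeast {e : ℕ | ∃ c ∈ LinearMap.range (wordMap₀ σ), ∃ c' ∈ LinearMap.range (wordMap₀ σ),
      c ≠ c' ∧ hammingDist c c' = e} d := by
  have hm0 : 0 < m := Nat.pos_of_ne_zero fun h0 => by
    have := Nat.mul_pos (by omega : 0 < n) hδ
    omega
  have hpm := mul_pow_pred (p := p) hm0
  have hF := freq_three_pos hp h hK hδ hm hn
  have hp3 : 3 ≤ p := by
    have := (Fact.out : p.Prime).two_le
    omega
  have hp1 : (0 : ℚ) < p - 1 := by
    have : (3 : ℚ) ≤ p := by exact_mod_cast hp3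
    linarith
  obtain ⟨b1, -, -, -, b5, b6⟩ := deviation_bounds hp hδ hm hn (u := fun i =>
    (p : ℤ) ^ (m / 2 + i * m.gcd ℓ - 1)) fun i => rfl
  obtain ⟨s1, s2⟩ := signed_deviation_bounds hp hδ hm hn (u := fun i =>
    (p : ℤ) ^ (m / 2 + i * m.gcd ℓ - 1)) fun i => rfl
  have hT := hasWeightDistribution_table0 hp h hK hδ hm hn
  have hv3 : ((3 : Fin 4) : ℕ) = 3 := rfl
  have hP : 2 * (p : ℤ) ^ (m - 1) ≤ (p : ℤ) ^ m - (p : ℤ) ^ (m - 1) := by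
    rw [← hpm]
    have : (0 : ℤ) ≤ (p : ℤ) ^ (m - 1) := by positivity
    nlinarith [show (3 : ℤ) ≤ p by omega]
  by_cases hev : Even n
  · obtain ⟨t3, hb⟩ := s1 hev
    rw [if_pos hev] at hd
    have hd' : (d : ℤ) = (p : ℤ) ^ m - (p : ℤ) ^ (m - 1)
        + sgn m ℓ 3 * (p : ℤ) ^ (m / 2 + (3 : Fin 4) * m.gcd ℓ - 1) - 1 := by
      rw [hd, t3, hv3]; linear_combination hpm
    have hd0 : (0 : ℤ) < d := by
      rw [hd', t3]; linarith [b1 3]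
    refine isLeast_dist_of_table hT (by exact_mod_cast hd0)
      (f := ((p : ℚ) - 1) * freq p m ℓ 3) ?_ (mul_pos hp1 hF).ne' ?_
    · rw [mem_table0_iff, hd']
      exact Or.inr (Or.inr ⟨3, Or.inr rfl⟩)
    · intro row hrow
      rcases mem_table0_iff.1 hrow with rfl | rfl | ⟨i, rfl | rfl⟩
      · exact Or.inl rfl
      · right; rw [hd', t3]; linarith [b1 3]
      · right
        rw [hd', t3]
        linarith [(hb i).1, (hb i).2, b1 3]
      · right
        rw [hd', t3]
        linarith [(hb i).1, (hb i).2, b1 3]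
  · obtain ⟨t3, hb⟩ := s2 hev
    rw [if_neg hev] at hd
    have hd' : (d : ℤ) = (p : ℤ) ^ m - (p : ℤ) ^ (m - 1)
        - sgn m ℓ 3 * ((p : ℤ) - 1) * (p : ℤ) ^ (m / 2 + (3 : Fin 4) * m.gcd ℓ - 1) := by
      rw [hd, t3, hv3]; linear_combination hpm
    have hd0 : (0 : ℤ) < d := by
      rw [hd', t3]; linarith [b1 3]
    refine isLeast_dist_of_table hT (by exact_mod_cast hd0) (f := freq p m ℓ 3) ?_ hF.ne' ?_
    · rw [mem_table0_iff, hd']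
      exact Or.inr (Or.inr ⟨3, Or.inl rfl⟩)
    · intro row hrow
      rcases mem_table0_iff.1 hrow with rfl | rfl | ⟨i, rfl | rfl⟩
      · exact Or.inl rfl
      · right; rw [hd', t3]; linarith [b1 3]
      · right
        rw [hd', t3]
        linarith [(hb i).1, (hb i).2, b1 3]
      · right
        rw [hd', t3]
        linarith [(hb i).1, (hb i).2, b1 3]

theorem isLeast_dist_code2 (hp : p ≠ 2) (h : IsHermitianFrobenius σ (p ^ m.gcd ℓ))
    (hK : Fintype.card K = p ^ m) (hδ : 0 < m.gcd ℓ) (hm : m = 2 * (n * m.gcd ℓ)) (hn : 4 ≤ n)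
    {d : ℕ} (hd : (d : ℤ) = (p : ℤ) ^ (m - 1) * ((p : ℤ) - 1)
        - (if Even n then (p : ℤ) ^ (m / 2 + 3 * m.gcd ℓ - 1) + 1
            else ((p : ℤ) - 1) * (p : ℤ) ^ (m / 2 + 3 * m.gcd ℓ - 1) + 1)) :
    IsLeast {e : ℕ | ∃ c ∈ LinearMap.range (wordMap σ), ∃ c' ∈ LinearMap.range (wordMap σ),
      c ≠ c' ∧ hammingDist c c' = e} d := by
  have hm0 : 0 < m := Nat.pos_of_ne_zero fun h0 => by
    have := Nat.mul_pos (by omega : 0 < n) hδ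
    omega
  have hpm := mul_pow_pred (p := p) hm0
  have hF := freq_three_pos hp h hK hδ hm hn
  have hp3 : 3 ≤ p := by
    have := (Fact.out : p.Prime).two_le
    omega
  have hp3' : (3 : ℚ) ≤ p := by exact_mod_cast hp3
  have hp1 : (0 : ℚ) < p - 1 := by linarith
  obtain ⟨b1, -, -, -, b5, b6⟩ := deviation_bounds hp hδ hm hn (u := fun i =>
    (p : ℤ) ^ (m / 2 + i * m.gcd ℓ - 1)) fun i => rfl
  obtain ⟨s1, s2⟩ := signed_deviation_bounds hp hδ hm hn (u := fun i =>
    (p : ℤ) ^ (m / 2 + i * m.gcd ℓ - 1)) fun i => rfl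
  have hT := hasWeightDistribution_table2 hp h hK hδ hm hn
  have hv3 : ((3 : Fin 4) : ℕ) = 3 := rfl
  have hP : 2 * (p : ℤ) ^ (m - 1) ≤ (p : ℤ) ^ m - (p : ℤ) ^ (m - 1) := by
    rw [← hpm]
    have : (0 : ℤ) ≤ (p : ℤ) ^ (m - 1) := by positivity
    nlinarith [show (3 : ℤ) ≤ p by omega]
  have hδn : 4 * m.gcd ℓ ≤ n * m.gcd ℓ := Nat.mul_le_mul_right _ hn
  -- The minimal row also carries a factor counting the `β`. It is positive because `v₃ < p ^ (r₃ -
  -- 1)`, which holds as `m / 2 > 3δ`.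
  have hlt : (p : ℚ) ^ (m / 2 - (3 : Fin 4) * m.gcd ℓ - 1) <
      (p : ℚ) ^ (m - 2 * (3 : Fin 4) * m.gcd ℓ - 1) :=
    pow_lt_pow_right₀ (by linarith) (by rw [hv3]; omega)
  have hlt2 : (p : ℚ) ^ (m - 2 * (3 : Fin 4) * m.gcd ℓ - 1) <
      (p : ℚ) ^ (m - 2 * (3 : Fin 4) * m.gcd ℓ) - (p : ℚ) ^ (m - 2 * (3 : Fin 4) * m.gcd ℓ - 1) := by
    have h1 : (p : ℚ) ^ (m - 2 * (3 : Fin 4) * m.gcd ℓ) =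
        p * (p : ℚ) ^ (m - 2 * (3 : Fin 4) * m.gcd ℓ - 1) := by
      rw [← pow_succ']
      congr 1
      rw [hv3]
      omega
    have h2 : (0 : ℚ) < (p : ℚ) ^ (m - 2 * (3 : Fin 4) * m.gcd ℓ - 1) :=
      pow_pos (by linarith) _
    rw [h1]
    nlinarith
  by_cases hev : Even n
  · obtain ⟨t3, hb⟩ := s1 hev
    rw [if_pos hev] at hd
    have hd' : (d : ℤ) = (p : ℤ) ^ m - (p : ℤ) ^ (m - 1) - 1
        + sgn m ℓ 3 * (p : ℤ) ^ (m / 2 + (3 : Fin 4) * m.gcd ℓ - 1) := by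
      rw [hd, t3, hv3]; linear_combination hpm
    have hd0 : (0 : ℤ) < d := by
      rw [hd', t3]; linarith [b1 3]
    refine isLeast_dist_of_table hT (by exact_mod_cast hd0)
      (f := ((p : ℚ) ^ (m - 2 * (3 : Fin 4) * m.gcd ℓ)
        - (p : ℚ) ^ (m - 2 * (3 : Fin 4) * m.gcd ℓ - 1)
        + sgn m ℓ 3 * (p : ℚ) ^ (m / 2 - (3 : Fin 4) * m.gcd ℓ - 1)) * ((p : ℚ) - 1) * freq p m ℓ 3)
      ?_ ?_ ?_
    · rw [mem_table2_iff, hd']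
      exact Or.inr (Or.inr (Or.inr (Or.inr ⟨3, Or.inr (Or.inr (Or.inr rfl))⟩)))
    · refine (mul_pos (mul_pos ?_ hp1) hF).ne'
      rw [t3]
      push_cast
      linarith
    · intro row hrow
      rcases mem_table2_iff.1 hrow with rfl | rfl | rfl | rfl | ⟨i, rfl | rfl | rfl | rfl⟩
      · exact Or.inl rfl
      · right; rw [hd', t3]; linarith [b1 3]
      · right; rw [hd', t3]; linarith [b1 3]
      · right; rw [hd', t3]; linarith [b1 3]
      all_goals
        right
        rw [hd', t3]
        linarith [(hb i).1, (hb i).2, b1 3]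
  · obtain ⟨t3, hb⟩ := s2 hev
    rw [if_neg hev] at hd
    have hd' : (d : ℤ) = (p : ℤ) ^ m - (p : ℤ) ^ (m - 1) - 1
        - sgn m ℓ 3 * ((p : ℤ) - 1) * (p : ℤ) ^ (m / 2 + (3 : Fin 4) * m.gcd ℓ - 1) := by
      rw [hd, t3, hv3]; linear_combination hpm
    have hd0 : (0 : ℤ) < d := by
      rw [hd', t3]; linarith [b1 3]
    refine isLeast_dist_of_table hT (by exact_mod_cast hd0)
      (f := ((p : ℚ) ^ (m - 2 * (3 : Fin 4) * m.gcd ℓ - 1)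
        - sgn m ℓ 3 * (p : ℚ) ^ (m / 2 - (3 : Fin 4) * m.gcd ℓ - 1)) * ((p : ℚ) - 1) * freq p m ℓ 3)
      ?_ ?_ ?_
    · rw [mem_table2_iff, hd']
      exact Or.inr (Or.inr (Or.inr (Or.inr ⟨3, Or.inr (Or.inr (Or.inl rfl))⟩)))
    · refine (mul_pos (mul_pos ?_ hp1) hF).ne'
      rw [t3]
      push_cast
      linarith
    · intro row hrow
      rcases mem_table2_iff.1 hrow with rfl | rfl | rfl | rfl | ⟨i, rfl | rfl | rfl | rfl⟩
      · exact Or.inl rfl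
      · right; rw [hd', t3]; linarith [b1 3]
      · right; rw [hd', t3]; linarith [b1 3]
      · right; rw [hd', t3]; linarith [b1 3]
      all_goals
        right
        rw [hd', t3]
        linarith [(hb i).1, (hb i).2, b1 3]

end Parameters

end TraceCode

theorem theorem5p2 (p m ℓ : ℕ) [Fact p.Prime] (hp : p ≠ 2) (hm : 0 < m) (hℓ : 0 < ℓ)
    (hEven : Even (m / m.gcd ℓ)) (hmℓ : 6 * ℓ < m)
    (K : Type*) [Field K] [Fintype K] [DecidableEq K] [Algebra (ZMod p) K]
    (hK : Fintype.card K = p ^ m) :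
    (∃ d dhat : ℕ,
      (d : ℤ) = (p : ℤ) ^ (m - 1) * ((p : ℤ) - 1)
        - (if Even (m / m.gcd ℓ / 2) then (p : ℤ) ^ (m / 2 + 3 * m.gcd ℓ - 1) + 1
            else ((p : ℤ) - 1) * (p : ℤ) ^ (m / 2 + 3 * m.gcd ℓ - 1)) ∧
      (dhat : ℤ) = (if Even (m / m.gcd ℓ / 2) then (d : ℤ) else (d : ℤ) - 1) ∧
      TraceCode.IsCode (TraceCode.code0 p (TraceCode.linFamily p K ℓ)) (p ^ m - 1) (2 * m + 1) d ∧
      TraceCode.IsCode (TraceCode.code2 p (TraceCode.linFamily p K ℓ))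
        (p ^ m - 1) (3 * m + 1) dhat) ∧
    TraceCode.HasWeightDistribution (TraceCode.code0 p (TraceCode.linFamily p K ℓ))
      (TraceCode.table0 p m ℓ) ∧
    TraceCode.HasWeightDistribution (TraceCode.code2 p (TraceCode.linFamily p K ℓ))
      (TraceCode.table2 p m ℓ) := by
  open TraceCode in
  have hδ : 0 < m.gcd ℓ := Nat.gcd_pos_of_pos_left _ hm
  obtain ⟨n, hn2⟩ := hEven
  have hmn : m = 2 * (n * m.gcd ℓ) := by
    have h1 := Nat.div_mul_cancel (Nat.gcd_dvd_left m ℓ)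
    rw [hn2] at h1
    rw [← mul_assoc, two_mul]
    exact h1.symm
  -- From `2nδ = m > 6ℓ ≥ 6δ` one gets `n > 3`.
  have hn : 4 ≤ n := by
    have h1 : m.gcd ℓ ≤ ℓ := Nat.le_of_dvd hℓ (Nat.gcd_dvd_right m ℓ)
    by_contra hlt
    have h2 : n * m.gcd ℓ ≤ 3 * m.gcd ℓ := Nat.mul_le_mul_right _ (by omega)
    omega
  obtain ⟨σ, hσ⟩ := exists_frobenius_pow p K ℓ
  have h := isHermitianFrobenius hp hσ hK hδ hmn
  have hpq : p ∣ p ^ m.gcd ℓ := dvd_pow_self p hδ.ne'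
  have hK' := card_eq_pow hK hmn
  have hlen : Fintype.card Kˣ = p ^ m - 1 := by rw [Fintype.card_units, hK]
  rw [code0_eq_range hσ, code2_eq_range hσ, div_gcd_div_two hδ hmn]
  refine ⟨?_, hasWeightDistribution_table0 hp h hK hδ hmn hn,
    hasWeightDistribution_table2 hp h hK hδ hmn hn⟩
  obtain ⟨b1, -, -, -, b5, b6⟩ := deviation_bounds hp hδ hmn hn (u := fun i =>
    (p : ℤ) ^ (m / 2 + i * m.gcd ℓ - 1)) fun i => rfl
  have hu := b1 3
  have hv3 : ((3 : Fin 4) : ℕ) = 3 := rfl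
  simp only [hv3] at hu b5 b6
  have hP : (p : ℤ) ^ (m - 1) ≤ (p : ℤ) ^ (m - 1) * (p - 1) :=
    le_mul_of_one_le_right (by positivity) (by
      have := (Fact.out : p.Prime).two_le
      omega)
  have hex : ∀ e : ℤ, 0 ≤ e → ∃ d : ℕ, (d : ℤ) = e := fun e he => ⟨e.toNat, Int.toNat_of_nonneg he⟩
  obtain ⟨d, hd⟩ := hex ((p : ℤ) ^ (m - 1) * ((p : ℤ) - 1)
        - (if Even n then (p : ℤ) ^ (m / 2 + 3 * m.gcd ℓ - 1) + 1
            else ((p : ℤ) - 1) * (p : ℤ) ^ (m / 2 + 3 * m.gcd ℓ - 1)))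
      (by split_ifs <;> linarith)
  obtain ⟨dhat, hdhat⟩ := hex ((p : ℤ) ^ (m - 1) * ((p : ℤ) - 1)
        - (if Even n then (p : ℤ) ^ (m / 2 + 3 * m.gcd ℓ - 1) + 1
            else ((p : ℤ) - 1) * (p : ℤ) ^ (m / 2 + 3 * m.gcd ℓ - 1) + 1))
      (by split_ifs <;> linarith)
  refine ⟨d, dhat, hd, ?_, ⟨hlen, ?_, ?_⟩, ⟨hlen, ?_, ?_⟩⟩
  · rw [hdhat, hd]
    split_ifs <;> ring
  · exact finrank_range_wordMap₀ (wordMap₀_injective h hp hpq hK' hn) hK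
  · exact isLeast_dist_code0 hp h hK hδ hmn hn hd
  · exact finrank_range_wordMap (wordMap_injective h hp hpq hK' hn) hK
  · exact isLeast_dist_code2 hp h hK hδ hmn hn hdhat
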